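/- Let $\mathbb F_q$ be a finite field with $q$ elements, $q$ odd, and for a nonzero $f\in\mathbb F_q[x]$ of degree $d(f)$ put $|f|=q^{d(f)}$. Let $\mathcal M$ be the set of monic polynomials and $\mathcal P$ the set of monic irreducible polynomials in $\mathbb F_q[x]$, and let $\mathcal H_{2g+1}$ be the set of monic square-free polynomials of degree $2g+1$. Put $\Lambda(f)=d(P)$ if $f=aP^j$ with $a\in\mathbb F_q^\times$, $P\in\mathcal P$, $j\ge1$, and $\Lambda(f)=0$ otherwise. Let $\chi_D(f)=\left(\frac{D}{f}\right)$ be the Jacobi symbol, that is, $\left(\frac{D}{P}\right)\in\{0,\pm1\}$ with $\left(\frac{D}{P}\right)\equiv D^{(|P|-1)/2}\pmod P$ for $P\in\mathcal P$, extended completely multiplicatively to $f\in\mathcal M$. For real $X\ge 1$ let \[ P_X(\tfrac12,\chi_D)=\exp\Big(\sum_{f\in\mathcal M,\ 1\le d(f)\le X}\frac{\Lambda(f)\chi_D(f)}{|f|^{1/2}d(f)}\Big). \] For real $k$ let $\tau_k$ be the multiplicative function on $\mathcal M$ with $\tau_k(P^a)=k(k+1)\cdots(k+a-1)/a!$, and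 let \[ \mathcal A_k=\prod_{P\in\mathcal P}\Big[\Big(1-\frac1{|P|}\Big)^{k(k+1)/2}\Big(1+\Big(1+\frac1{|P|}\Big)^{-1}\sum_{j=1}^\infty\frac{\tau_k(P^{2j})}{|P|^j}\Big)\Big]. \] Then, for every real $k$, the inner series and the (unordered) product defining $\mathcal A_k$ converge, and for every $0<c<2$ we have \[ \frac1{|\mathcal H_{2g+1}|}\sum_{D\in\mathcal H_{2g+1}}P_X(\tfrac12,\chi_D)^k=2^{-k/2}\mathcal A_k\,(e^\gamma X)^{k(k+1)/2}+O\big(X^{k(k+1)/2-1}\big) \] for all integers $g\ge1$ and all real $X$ with $1\le X\le (2-c)\log g/\log q$, where $\gamma$ is Euler's constant and the implied constant depends only on $q$, $k$ and $c$. -/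

import Mathlib

namespace PartialEulerMoments

open Polynomial UniqueFactorizationMonoid
open scoped Classical Nat

noncomputable section

variable {F : Type*} [Field F] [Fintype F]

/-- The norm `|f| = q ^ d(f)` of a nonzero polynomial over the field with `q` elements. -/
def polyNorm (f : F[X]) : ℕ := Fintype.card F ^ f.natDegree

/-- Monic irreducible polynomials. -/
def IsMonicPrime (P : F[X]) : Prop := P.Monic ∧ Irreducible P

variable (F) in
/-- The set of monic irreducible polynomials, as a type. -/
abbrev MonicPrime : Type _ := {P : F[X] // IsMonicPrime P}

theorem finite_natDegree_le (n : ℕ) : {f : F[X] | f.natDegree ≤ n}.Finite := by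
  refine Set.Finite.of_injOn (f := fun (f : F[X]) (i : Fin (n + 1)) => f.coeff i)
    (t := Set.univ) (fun _ _ => Set.mem_univ _) ?_ Set.finite_univ
  intro f hf g hg h
  ext i
  by_cases hi : i < n + 1
  · exact congrFun h ⟨i, hi⟩
  · have hf' : f.natDegree ≤ n := hf
    have hg' : g.natDegree ≤ n := hg
    rw [coeff_eq_zero_of_natDegree_lt (by omega), coeff_eq_zero_of_natDegree_lt (by omega)]

theorem finite_monic_degree_le (X : ℝ) : {f : F[X] | f.Monic ∧ (f.natDegree : ℝ) ≤ X}.Finite :=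
  (finite_natDegree_le ⌊X⌋₊).subset fun _ hf => Nat.le_floor hf.2

theorem finite_squarefree (d : ℕ) :
    {D : F[X] | D.Monic ∧ Squarefree D ∧ D.natDegree = d}.Finite :=
  (finite_natDegree_le d).subset fun _ hf => hf.2.2.le

variable (F) in
/-- The monic polynomials of degree at most `X`. -/
def monicLE (X : ℝ) : Finset F[X] := (finite_monic_degree_le (F := F) X).toFinset

variable (F) in
/-- `H_d`: the monic square-free polynomials of degree `d`. -/
def squarefreeMonic (d : ℕ) : Finset F[X] := (finite_squarefree (F := F) d).toFinset

/-- The von Mangoldt function: `d(P)` if `f = c P ^ j` with `c` a nonzero constant, `P` monic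
irreducible and `j ≥ 1` (such a `P` is unique), and `0` otherwise. -/
def vonMangoldt (f : F[X]) : ℕ :=
  if h : ∃ P : F[X], IsMonicPrime P ∧ ∃ c : F, c ≠ 0 ∧ ∃ j : ℕ, 1 ≤ j ∧ f = C c * P ^ j
  then h.choose.natDegree else 0

/-- The quadratic residue symbol `(a / P)` for `P` monic irreducible (and `q` odd): the element of
`{0, 1, -1}` congruent to `a ^ ((|P| - 1) / 2)` modulo `P`. -/
def residueSymbol (a P : F[X]) : ℤ :=
  if P ∣ a ^ ((polyNorm P - 1) / 2) - 1 then 1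
  else if P ∣ a ^ ((polyNorm P - 1) / 2) + 1 then -1
  else 0

/-- The Jacobi symbol `(a / Q)`: the product of `(a / P)` over the monic irreducible factors `P`
of `Q`, with multiplicity. -/
def jacobiSymbol (a Q : F[X]) : ℤ := ((normalizedFactors Q).map (residueSymbol a)).prod

/-- The quadratic character `χ_D(f) = (D / f)`. -/
def chi (D f : F[X]) : ℤ := jacobiSymbol D f

/-- The partial Euler product `P_X(s, χ_D)` at a real point `s`. The term `f = 1` contributes
nothing, as `Λ(1) = 0`. -/
def partialEuler (X s : ℝ) (D : F[X]) : ℝ :=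
  Real.exp (∑ f ∈ monicLE F X,
    (vonMangoldt f : ℝ) * (chi D f : ℝ) / ((polyNorm f : ℝ) ^ s * (f.natDegree : ℝ)))

variable (F) in
/-- The expected value of `Φ` over `H_d`. -/
def expectation (d : ℕ) (Φ : F[X] → ℝ) : ℝ :=
  ((squarefreeMonic F d).card : ℝ)⁻¹ * ∑ D ∈ squarefreeMonic F d, Φ D

/-- The `k`-th divisor function for real `k`: the multiplicative function of monic `f` with
`τ_k(P ^ a) = k (k + 1) ⋯ (k + a - 1) / a!`. -/
def tau (k : ℝ) (f : F[X]) : ℝ :=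
  ∏ P ∈ (normalizedFactors f).toFinset,
    (ascPochhammer ℝ ((normalizedFactors f).count P)).eval k / ((normalizedFactors f).count P)!

/-- The terms, indexed by `j = i + 1`, of the series `∑_{j ≥ 1} τ_k(P ^ (2 j)) / |P| ^ j`. -/
def localTerm (k : ℝ) (P : F[X]) (i : ℕ) : ℝ :=
  tau k (P ^ (2 * (i + 1))) / (polyNorm P : ℝ) ^ (i + 1)

/-- The factor at `P` of the arithmetic constant `A_k`. -/
def localFactor (k : ℝ) (P : F[X]) : ℝ :=
  (1 - 1 / (polyNorm P : ℝ)) ^ (k * (k + 1) / 2) *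
    (1 + (1 + 1 / (polyNorm P : ℝ))⁻¹ * ∑' i : ℕ, localTerm k P i)

variable (F) in
/-- The arithmetic constant `A_k`. -/
def arithConst (k : ℝ) : ℝ := ∏' P : MonicPrime F, localFactor k P.1

end

end PartialEulerMoments

namespace PartialEulerMoments

open Polynomial UniqueFactorizationMonoid
open scoped Classical

set_option linter.unusedSectionVars false

noncomputable section

variable {F : Type*} [Field F] [Fintype F]

/-! ### Residue symbols as quadratic characters of residue fields -/

section Symbols

/-! Over `D` in the family, the symbols `(D / P)` at different primes behave almost like independent
random variables, the one at `P` being `0` with probability `1 / (|P| + 1)` and `1` and `-1` with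
equal probability otherwise. Because `X` is at most `(2 - c) log g / log q`, the partial Euler
product is close in mean to its random counterpart, whose mean is a finite product over primes that
Mertens' theorem evaluates.

Comparison with the model. By `abs_expectation_prod_sub_le`, a monomial in the symbols of total
degree at most `g` has the model mean up to an exponentially small error in `g`. If all exponents
are even, the monomial is the indicator of coprimality to certain primes, and square-free
polynomials are counted by removing one prime at a time. If some exponent is odd, the monomial is a
nonprincipal character of modulus degree at most `g`; its sum over all monics of each degree `n ≥ g`
vanishes, and writing each monic as square-free times square gives power saving over square-frees.
The `k`-th power of the partial Euler product is the exponential of a polynomial in the symbols,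
bounded by `W ≤ |k| X g ^ (1 - c / 2)`. Its Taylor series truncated at `M`, about `g / X`, involves
only monomials of degree at most `g`; as `M` is much larger than `W`, the tail is negligible
(`abs_exp_moment_sub_le`, `exists_error_le`).

Evaluation of the model. Put `N = ⌊X⌋`. Independence makes the mean a product of `modelFactor k N P`
over `deg P ≤ N`. For `deg P ≤ N / 2` this is close to the mean `eulerMean k P` of the full Euler
factor to the power `k`. For `N / 2 < deg P ≤ N` only the term `j = 1` of the logarithm survives,
and the coefficient of `1 / |P|` is `k² / 2` instead of `k (k + 1) / 2`. The missing `-(k / 2) /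
|P|`, summed over this range, is `-(k / 2) log 2` by Mertens: this is the factor `2 ^ (-k / 2)`. The
product of the `eulerMean k P` gives `A_k (e ^ γ N) ^ (k (k + 1) / 2)`, again by Mertens, with
relative error `O(1 / N)`. -/

theorem polyNorm_pos (f : F[X]) : 0 < polyNorm f := pow_pos Fintype.card_pos _

theorem polyNorm_pow (f : F[X]) (n : ℕ) : polyNorm (f ^ n) = polyNorm f ^ n := by
  rw [polyNorm, natDegree_pow, mul_comm, pow_mul]; rfl

theorem IsMonicPrime.natDegree_pos {P : F[X]} (hP : IsMonicPrime P) : 0 < P.natDegree :=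
  hP.2.natDegree_pos

theorem IsMonicPrime.prime {P : F[X]} (hP : IsMonicPrime P) : Prime P := hP.2.prime

theorem card_adjoinRoot {P : F[X]} (hP : IsMonicPrime P) [Fintype (AdjoinRoot P)] :
    Fintype.card (AdjoinRoot P) = polyNorm P := by
  have : Module.Finite F (AdjoinRoot P) := (AdjoinRoot.powerBasis' hP.1).finite
  rw [Module.card_eq_pow_finrank (K := F), (AdjoinRoot.powerBasis' hP.1).finrank,
    AdjoinRoot.powerBasis'_dim]
  rfl

/-- Euler's criterion in the field `F[X] / P`, packaged abstractly so that the properties of the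
symbol below are inherited from `quadraticChar`. -/
theorem residueSymbol_spec.{u} {F : Type u} [Field F] [Fintype F] (hq : Odd (Fintype.card F)) {P : F[X]} (hP : IsMonicPrime P) :
    ∃ (K : Type u) (_ : Field K) (_ : Fintype K) (φ : F[X] →+* K), Function.Surjective φ ∧
      (∀ a, φ a = 0 ↔ P ∣ a) ∧ ringChar K ≠ 2 ∧
      ∀ a, residueSymbol a P = quadraticChar K (φ a) := by
  have : Fact (Irreducible P) := ⟨hP.2⟩
  have : Module.Finite F (AdjoinRoot P) := (AdjoinRoot.powerBasis' hP.1).finite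
  have : Finite (AdjoinRoot P) := Module.finite_of_finite F
  let _ : Fintype (AdjoinRoot P) := Fintype.ofFinite _
  have hcard := card_adjoinRoot hP
  have hodd : Odd (Fintype.card (AdjoinRoot P)) := by
    rw [hcard, polyNorm]; exact hq.pow
  have hchar : ringChar (AdjoinRoot P) ≠ 2 := fun h => by
    have := FiniteField.even_card_of_char_two h
    rw [Nat.odd_iff] at hodd; omega
  have hhalf : (polyNorm P - 1) / 2 = Fintype.card (AdjoinRoot P) / 2 := by
    rw [hcard] at *; rw [Nat.odd_iff] at hodd; omega
  refine ⟨AdjoinRoot P, inferInstance, inferInstance, AdjoinRoot.mk P,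
    AdjoinRoot.mk_surjective, fun a => AdjoinRoot.mk_eq_zero, hchar, fun a => ?_⟩
  have h1 := quadraticChar_eq_pow_of_char_ne_two' hchar (AdjoinRoot.mk P a)
  have h2 : (2 : AdjoinRoot P) ≠ 0 := Ring.two_ne_zero hchar
  have e1 : P ∣ a ^ ((polyNorm P - 1) / 2) - 1 ↔
      (quadraticChar (AdjoinRoot P) (AdjoinRoot.mk P a) : AdjoinRoot P) = 1 := by
    rw [← AdjoinRoot.mk_eq_zero, h1, hhalf, map_sub, map_pow, map_one, sub_eq_zero]
  have e2 : P ∣ a ^ ((polyNorm P - 1) / 2) + 1 ↔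
      (quadraticChar (AdjoinRoot P) (AdjoinRoot.mk P a) : AdjoinRoot P) = -1 := by
    rw [← AdjoinRoot.mk_eq_zero, h1, hhalf, map_add, map_pow, map_one, add_eq_zero_iff_eq_neg]
  rw [residueSymbol, if_congr e1 rfl rfl, if_congr e2 rfl rfl]
  -- In odd characteristic the two divisibility tests in the definition of the symbol cannot both
  -- succeed.
  have hne : (1 : AdjoinRoot P) ≠ -1 := fun h => h2 (by rw [← one_add_one_eq_two]; nth_rw 1 [h]; ring)
  by_cases h0 : AdjoinRoot.mk P a = 0
  · simp [h0]
  · rcases quadraticChar_dichotomy h0 with h | h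
    · simp [h]
    · simp [h, hne.symm]

theorem residueSymbol_mul (hq : Odd (Fintype.card F)) {P : F[X]} (hP : IsMonicPrime P)
    (a b : F[X]) : residueSymbol (a * b) P = residueSymbol a P * residueSymbol b P := by
  obtain ⟨K, _, _, φ, -, -, -, h⟩ := residueSymbol_spec hq hP
  simp only [h, map_mul]

theorem residueSymbol_one (hq : Odd (Fintype.card F)) {P : F[X]} (hP : IsMonicPrime P) :
    residueSymbol 1 P = 1 := by
  obtain ⟨K, _, _, φ, -, -, -, h⟩ := residueSymbol_spec hq hP
  simp [h]

theorem residueSymbol_congr (hq : Odd (Fintype.card F)) {P : F[X]} (hP : IsMonicPrime P)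
    {a b : F[X]} (hab : P ∣ a - b) : residueSymbol a P = residueSymbol b P := by
  obtain ⟨K, _, _, φ, -, h0, -, h⟩ := residueSymbol_spec hq hP
  rw [h, h, sub_eq_zero.1 ((map_sub φ a b).symm.trans ((h0 _).2 hab))]

theorem residueSymbol_eq_zero_iff (hq : Odd (Fintype.card F)) {P : F[X]} (hP : IsMonicPrime P)
    {a : F[X]} : residueSymbol a P = 0 ↔ P ∣ a := by
  obtain ⟨K, _, _, φ, -, h0, -, h⟩ := residueSymbol_spec hq hP
  rw [h, quadraticChar_eq_zero_iff, h0]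

theorem residueSymbol_sq (hq : Odd (Fintype.card F)) {P : F[X]} (hP : IsMonicPrime P)
    {a : F[X]} (ha : ¬ P ∣ a) : residueSymbol a P ^ 2 = 1 := by
  obtain ⟨K, _, _, φ, -, h0, -, h⟩ := residueSymbol_spec hq hP
  rw [h, quadraticChar_sq_one (fun hh => ha ((h0 _).1 hh))]

theorem abs_residueSymbol_le (hq : Odd (Fintype.card F)) {P : F[X]} (hP : IsMonicPrime P)
    (a : F[X]) : |residueSymbol a P| ≤ 1 := by
  by_cases ha : P ∣ a
  · simp [(residueSymbol_eq_zero_iff hq hP).2 ha]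
  · exact (sq_le_one_iff_abs_le_one _).1 (residueSymbol_sq hq hP ha).le

theorem exists_residueSymbol_eq_neg_one (hq : Odd (Fintype.card F)) {P : F[X]}
    (hP : IsMonicPrime P) : ∃ a, residueSymbol a P = -1 := by
  obtain ⟨K, _, _, φ, hs, h0, hc, h⟩ := residueSymbol_spec hq hP
  obtain ⟨b, hb⟩ := quadraticChar_exists_neg_one hc
  obtain ⟨a, rfl⟩ := hs b
  exact ⟨a, by rw [h, hb]⟩

theorem IsMonicPrime.normalizedFactors_pow {P : F[X]} (hP : IsMonicPrime P) (j : ℕ) :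
    normalizedFactors (P ^ j) = Multiset.replicate j P := by
  rw [UniqueFactorizationMonoid.normalizedFactors_pow, normalizedFactors_irreducible hP.2,
    hP.1.normalize_eq_self, Multiset.nsmul_singleton]

theorem chi_pow (D : F[X]) {P : F[X]} (hP : IsMonicPrime P) (j : ℕ) :
    chi D (P ^ j) = residueSymbol D P ^ j := by
  rw [chi, jacobiSymbol, hP.normalizedFactors_pow, Multiset.map_replicate, Multiset.prod_replicate]

theorem IsMonicPrime.eq_of_dvd {P Q : F[X]} (hP : IsMonicPrime P) (hQ : IsMonicPrime Q)
    (h : P ∣ Q) : P = Q :=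
  eq_of_monic_of_associated hP.1 hQ.1 (hP.2.associated_of_dvd hQ.2 h)

theorem vonMangoldt_pow {P : F[X]} (hP : IsMonicPrime P) {j : ℕ} (hj : 1 ≤ j) :
    vonMangoldt (P ^ j) = P.natDegree := by
  have h : ∃ Q : F[X], IsMonicPrime Q ∧ ∃ c : F, c ≠ 0 ∧ ∃ i : ℕ, 1 ≤ i ∧ P ^ j = C c * Q ^ i :=
    ⟨P, hP, 1, one_ne_zero, j, hj, by simp⟩
  rw [vonMangoldt, dif_pos h]
  obtain ⟨hQ, c, hc, i, hi, e⟩ := h.choose_spec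
  have : h.choose ∣ P ^ j := by
    exact (Dvd.dvd.mul_left (dvd_pow_self _ (by omega)) _).trans e.symm.dvd
  rw [hQ.eq_of_dvd hP (hQ.prime.dvd_of_dvd_pow this)]

theorem exists_eq_pow_of_vonMangoldt_ne_zero {f : F[X]} (hf : f.Monic) (h : vonMangoldt f ≠ 0) :
    ∃ P : F[X], IsMonicPrime P ∧ ∃ j : ℕ, 1 ≤ j ∧ f = P ^ j := by
  rw [vonMangoldt] at h
  split_ifs at h with h'
  · obtain ⟨P, hP, c, hc, j, hj, e⟩ := h'
    refine ⟨P, hP, j, hj, ?_⟩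
    have := congrArg leadingCoeff e
    rw [leadingCoeff_mul, leadingCoeff_C, (hP.1.pow j).leadingCoeff, hf.leadingCoeff, mul_one]
      at this
    rw [e, ← this]; simp
  · exact absurd rfl h

theorem tau_pow (k : ℝ) {P : F[X]} (hP : IsMonicPrime P) {a : ℕ} (ha : a ≠ 0) :
    tau k (P ^ a) = (ascPochhammer ℝ a).eval k / a.factorial := by
  rw [tau, hP.normalizedFactors_pow, Multiset.toFinset_replicate, if_neg ha]
  simp

end Symbols

/-! ### Monic polynomials: equidistribution in residue classes, and square-free parts -/

section Counting

variable (F) in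
/-- The polynomials of degree less than `n`. -/
def polyDegLT (n : ℕ) : Finset F[X] :=
  Set.Finite.toFinset (s := {f : F[X] | f.degree < n}) <|
    (finite_natDegree_le (F := F) n).subset fun _ hf => natDegree_le_of_degree_le (le_of_lt hf)

variable (F) in
/-- The monic polynomials of degree `n`. -/
def monicDeg (n : ℕ) : Finset F[X] :=
  Set.Finite.toFinset (s := {f : F[X] | f.Monic ∧ f.natDegree = n}) <|
    (finite_natDegree_le (F := F) n).subset fun _ hf => hf.2.le

@[simp] theorem mem_polyDegLT {n : ℕ} {f : F[X]} : f ∈ polyDegLT F n ↔ f.degree < n := by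
  simp [polyDegLT]

@[simp] theorem mem_monicDeg {n : ℕ} {f : F[X]} :
    f ∈ monicDeg F n ↔ f.Monic ∧ f.natDegree = n := by
  simp [monicDeg]

@[simp] theorem mem_squarefreeMonic {n : ℕ} {f : F[X]} :
    f ∈ squarefreeMonic F n ↔ f.Monic ∧ Squarefree f ∧ f.natDegree = n := by
  simp [squarefreeMonic]

theorem card_polyDegLT (n : ℕ) : (polyDegLT F n).card = Fintype.card F ^ n := by
  have e : (polyDegLT F n) ≃ (Fin n → F) :=
    (Equiv.subtypeEquivRight fun f => by rw [mem_polyDegLT, mem_degreeLT]).trans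
      (degreeLTEquiv F n).toEquiv
  rw [← Fintype.card_coe, Fintype.card_congr e]
  simp

/-- Division with remainder: once `n ≥ deg f`, the monics of degree `n` split into complete residue
systems modulo `f`, one for each quotient `h`. -/
theorem sum_monicDeg {f : F[X]} (hf : f.Monic) {n : ℕ} (hn : f.natDegree ≤ n) (G : F[X] → ℝ) :
    ∑ D ∈ monicDeg F n, G D =
      ∑ h ∈ monicDeg F (n - f.natDegree), ∑ r ∈ polyDegLT F f.natDegree, G (f * h + r) := by
  rw [← Finset.sum_product']
  symm
  refine Finset.sum_bij (fun x _ => f * x.1 + x.2) ?_ ?_ ?_ (fun _ _ => rfl)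
  · rintro ⟨h, r⟩ hx
    simp only [Finset.mem_product, mem_monicDeg, mem_polyDegLT] at hx
    obtain ⟨⟨hh, hd⟩, hr⟩ := hx
    have h1 : (f * h).natDegree = n := by rw [hf.natDegree_mul hh, hd]; omega
    have h2 : r.degree < (f * h).degree := by
      rw [degree_eq_natDegree (hf.mul hh).ne_zero, h1]
      exact hr.trans_le (by exact_mod_cast hn)
    rw [mem_monicDeg]
    exact ⟨(hf.mul hh).add_of_left h2, by rw [natDegree_add_eq_left_of_degree_lt h2, h1]⟩
  · rintro ⟨h, r⟩ hx ⟨h', r'⟩ hx' e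
    simp only [Finset.mem_product, mem_polyDegLT] at hx hx'
    have hr : r.degree < f.degree := by rw [degree_eq_natDegree hf.ne_zero]; exact hx.2
    have hr' : r'.degree < f.degree := by rw [degree_eq_natDegree hf.ne_zero]; exact hx'.2
    have h1 := div_modByMonic_unique h r hf ⟨add_comm _ _, hr⟩
    have h2 := div_modByMonic_unique h' r' hf ⟨add_comm _ _, hr'⟩
    simp only at e
    rw [e] at h1
    rw [Prod.mk.injEq]
    exact ⟨h1.1.symm.trans h2.1, h1.2.symm.trans h2.2⟩
  · intro D hD
    rw [mem_monicDeg] at hD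
    refine ⟨(D /ₘ f, D %ₘ f), ?_, ?_⟩
    · simp only [Finset.mem_product, mem_monicDeg, mem_polyDegLT]
      refine ⟨⟨?_, by rw [natDegree_divByMonic D hf, hD.2]⟩, ?_⟩
      · rw [Monic, leadingCoeff_divByMonic_of_monic hf, hD.1]
        rw [degree_eq_natDegree hf.ne_zero, degree_eq_natDegree hD.1.ne_zero, hD.2]
        exact_mod_cast hn
      · rw [← degree_eq_natDegree hf.ne_zero]; exact degree_modByMonic_lt D hf
    · simp only; rw [add_comm]; exact modByMonic_add_div D f

theorem monicDeg_zero : monicDeg F 0 = {1} := by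
  ext f
  rw [mem_monicDeg, Finset.mem_singleton]
  constructor
  · rintro ⟨h1, h2⟩; exact h1.natDegree_eq_zero.1 h2
  · rintro rfl; simp

theorem card_monicDeg (n : ℕ) : (monicDeg F n).card = Fintype.card F ^ n := by
  have h := sum_monicDeg (F := F) (monic_X_pow n) (n := n) (by simp) (fun _ => 1)
  simp [monicDeg_zero] at h
  rw [card_polyDegLT] at h
  exact_mod_cast h

theorem card_filter_dvd {f : F[X]} (hf : f.Monic) {n : ℕ} (hn : f.natDegree ≤ n) :
    ((monicDeg F n).filter (f ∣ ·)).card = Fintype.card F ^ (n - f.natDegree) := by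
  rw [← card_monicDeg]
  symm
  refine Finset.card_bij (fun h _ => f * h) ?_ ?_ ?_
  · intro h hh
    rw [mem_monicDeg] at hh
    rw [Finset.mem_filter, mem_monicDeg, hf.natDegree_mul hh.1, hh.2]
    exact ⟨⟨hf.mul hh.1, by omega⟩, dvd_mul_right _ _⟩
  · intro a _ b _ e
    exact mul_left_cancel₀ hf.ne_zero e
  · intro D hD
    rw [Finset.mem_filter, mem_monicDeg] at hD
    obtain ⟨⟨h1, h2⟩, h, rfl⟩ := hD
    have hh := hf.of_mul_monic_left h1
    rw [hf.natDegree_mul hh] at h2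
    exact ⟨h, by rw [mem_monicDeg]; exact ⟨hh, by omega⟩, rfl⟩

/-- Multiplication by `u` permutes the residues modulo `f`, so the complete sum is `χ u` times
itself and vanishes; monics of degree at least `deg f` fill whole residue systems. -/
theorem sum_nonprincipal_eq_zero {f : F[X]} (hf : f.Monic) {χ : F[X] → ℝ}
    (hper : ∀ a b, f ∣ a - b → χ a = χ b) (hmul : ∀ a b, χ (a * b) = χ a * χ b)
    {u : F[X]} (hu : IsCoprime u f) (hχ : χ u ≠ 1) {n : ℕ} (hn : f.natDegree ≤ n) :
    ∑ D ∈ monicDeg F n, χ D = 0 := by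
  have hr : ∑ r ∈ polyDegLT F f.natDegree, χ r = 0 := by
    have hmaps : ∀ r ∈ polyDegLT F f.natDegree, (u * r) %ₘ f ∈ polyDegLT F f.natDegree := by
      intro r _
      rw [mem_polyDegLT, ← degree_eq_natDegree hf.ne_zero]
      exact degree_modByMonic_lt _ hf
    have hval : ∀ r, χ ((u * r) %ₘ f) = χ u * χ r := by
      intro r
      rw [← hmul]
      refine hper _ _ ?_
      rw [← dvd_neg, neg_sub]
      exact ⟨(u * r) /ₘ f, by rw [sub_eq_iff_eq_add']; exact (modByMonic_add_div _ f).symm⟩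
    have hinj : Set.InjOn (fun r => (u * r) %ₘ f) (polyDegLT F f.natDegree) := by
      intro a ha b hb e
      simp only [Finset.mem_coe, mem_polyDegLT, ← degree_eq_natDegree hf.ne_zero] at ha hb
      have h1 : (u * (a - b)) %ₘ f = 0 := by
        rw [mul_sub, sub_modByMonic, sub_eq_zero]; exact e
      rw [modByMonic_eq_zero_iff_dvd hf] at h1
      have h2 := hu.symm.dvd_of_dvd_mul_left h1
      by_contra hne
      have h3 := degree_le_of_dvd h2 (sub_ne_zero.2 hne)
      exact absurd (h3.trans_lt ((degree_sub_le a b).trans_lt (max_lt ha hb))) (lt_irrefl _)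
    have hsum : ∑ r ∈ polyDegLT F f.natDegree, χ r =
        χ u * ∑ r ∈ polyDegLT F f.natDegree, χ r := by
      rw [Finset.mul_sum]
      refine (Finset.sum_bij (fun r _ => (u * r) %ₘ f) hmaps (fun a ha b hb e => hinj ha hb e)
        ?_ (fun r _ => (hval r).symm)).symm
      exact fun b hb => by
        obtain ⟨a, ha, e⟩ := Finset.surj_on_of_inj_on_of_card_le (fun r _ => (u * r) %ₘ f) hmaps
          (fun a b ha hb e => hinj ha hb e) le_rfl b hb
        exact ⟨a, ha, e.symm⟩
    have : (χ u - 1) * ∑ r ∈ polyDegLT F f.natDegree, χ r = 0 := by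
      rw [sub_mul, one_mul, ← hsum, sub_self]
    exact (mul_eq_zero.1 this).resolve_left (sub_ne_zero.2 hχ)
  rw [sum_monicDeg hf hn]
  refine Finset.sum_eq_zero fun h _ => ?_
  rw [← hr]
  refine Finset.sum_congr rfl fun r _ => hper _ _ ⟨h, by ring⟩

theorem exists_squarefree_mul_sq (n : ℕ) : ∀ {D : F[X]}, D.Monic → D.natDegree = n →
    ∃ s l : F[X], s.Monic ∧ Squarefree s ∧ l.Monic ∧ D = s * l ^ 2 := by
  induction n using Nat.strong_induction_on with
  | _ n ih =>
    intro D hD hn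
    by_cases hs : Squarefree D
    · exact ⟨D, 1, hD, hs, monic_one, by simp⟩
    · rw [Squarefree] at hs
      push Not at hs
      obtain ⟨x, ⟨z, hz⟩, hx⟩ := hs
      have hx0 : x ≠ 0 := by rintro rfl; simp at hz; exact hD.ne_zero hz
      have hm := monic_normalize hx0
      have hd : normalize x * normalize x ∣ D :=
        (mul_dvd_mul (normalize_dvd_iff.2 dvd_rfl) (normalize_dvd_iff.2 dvd_rfl)).trans ⟨z, hz⟩
      obtain ⟨E, hE⟩ := hd
      have hEm : E.Monic := (hm.mul hm).of_mul_monic_left (hE ▸ hD)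
      have hdeg : 0 < (normalize x).natDegree := by
        rw [natDegree_eq_of_degree_eq degree_normalize]
        exact Nat.pos_of_ne_zero fun h => hx (isUnit_iff_degree_eq_zero.2
          (by rw [degree_eq_natDegree hx0, h]; rfl))
      have hlt : E.natDegree < n := by
        have := congrArg natDegree hE
        rw [(hm.mul hm).natDegree_mul hEm, hm.natDegree_mul hm] at this
        omega
      obtain ⟨s, l, h1, h2, h3, h4⟩ := ih _ hlt hEm rfl
      exact ⟨s, normalize x * l, h1, h2, hm.mul h3, by rw [hE, h4]; ring⟩

/-- At each prime the multiplicity is `c + 2 b` with `c ≤ 1`, and such a representation determines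
both `b` and `c`. -/
theorem squarefree_mul_sq_unique {s l s' l' : F[X]} (hs : s.Monic) (hs2 : Squarefree s)
    (hl : l.Monic) (hs' : s'.Monic) (hs2' : Squarefree s') (hl' : l'.Monic)
    (h : s * l ^ 2 = s' * l' ^ 2) : s = s' ∧ l = l' := by
  have hc : ∀ P, (normalizedFactors l).count P = (normalizedFactors l').count P := by
    intro P
    have := congrArg (fun f => (normalizedFactors f).count P) h
    simp only [normalizedFactors_mul hs.ne_zero (hl.pow 2).ne_zero,
      normalizedFactors_mul hs'.ne_zero (hl'.pow 2).ne_zero, normalizedFactors_pow,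
      Multiset.count_add, Multiset.count_nsmul] at this
    have h1 := Multiset.nodup_iff_count_le_one.1
      ((squarefree_iff_nodup_normalizedFactors hs.ne_zero).1 hs2) P
    have h2 := Multiset.nodup_iff_count_le_one.1
      ((squarefree_iff_nodup_normalizedFactors hs'.ne_zero).1 hs2') P
    omega
  have hll : l = l' := by
    refine eq_of_monic_of_associated hl hl' ?_
    rw [associated_iff_normalizedFactors_eq_normalizedFactors hl.ne_zero hl'.ne_zero]
    exact Multiset.ext.2 hc
  subst hll
  exact ⟨mul_right_cancel₀ (hl.pow 2).ne_zero h, rfl⟩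

theorem sum_monicDeg_eq_sum_squarefree (n : ℕ) (G : F[X] → ℝ) :
    ∑ D ∈ monicDeg F n, G D = ∑ j ∈ Finset.range (n / 2 + 1),
      ∑ s ∈ squarefreeMonic F (n - 2 * j), ∑ l ∈ monicDeg F j, G (s * l ^ 2) := by
  simp_rw [← Finset.sum_product']
  rw [Finset.sum_sigma']
  symm
  refine Finset.sum_bij (fun x _ => x.2.1 * x.2.2 ^ 2) ?_ ?_ ?_ (fun _ _ => rfl)
  · rintro ⟨j, s, l⟩ hx
    simp only [Finset.mem_sigma, Finset.mem_range, Finset.mem_product, mem_squarefreeMonic,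
      mem_monicDeg] at hx ⊢
    obtain ⟨hj, ⟨hs, -, hs2⟩, hl, hl2⟩ := hx
    refine ⟨hs.mul (hl.pow 2), ?_⟩
    rw [hs.natDegree_mul (hl.pow 2), hl.natDegree_pow, hs2, hl2]; omega
  · rintro ⟨j, s, l⟩ hx ⟨j', s', l'⟩ hx' e
    simp only [Finset.mem_sigma, Finset.mem_range, Finset.mem_product, mem_squarefreeMonic,
      mem_monicDeg] at hx hx'
    obtain ⟨rfl, rfl⟩ := squarefree_mul_sq_unique hx.2.1.1 hx.2.1.2.1 hx.2.2.1 hx'.2.1.1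
      hx'.2.1.2.1 hx'.2.2.1 e
    have : j = j' := by rw [← hx.2.2.2, hx'.2.2.2]
    subst this; rfl
  · intro D hD
    rw [mem_monicDeg] at hD
    obtain ⟨s, l, h1, h2, h3, h4⟩ := exists_squarefree_mul_sq n hD.1 hD.2
    have hdeg := congrArg natDegree h4
    rw [h1.natDegree_mul (h3.pow 2), h3.natDegree_pow, hD.2] at hdeg
    refine ⟨⟨l.natDegree, s, l⟩, ?_, h4.symm⟩
    simp only [Finset.mem_sigma, Finset.mem_range, Finset.mem_product, mem_squarefreeMonic,
      mem_monicDeg]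
    exact ⟨by omega, ⟨h1, h2, by omega⟩, h3, trivial⟩

end Counting

/-! ### Counts of, and character sums over, square-free polynomials -/

section SquarefreeCounts

theorem three_le_card (hq : Odd (Fintype.card F)) : 3 ≤ Fintype.card F := by
  have := Fintype.one_lt_card (α := F)
  rw [Nat.odd_iff] at hq; omega

theorem card_squarefreeMonic_le (n : ℕ) :
    (squarefreeMonic F n).card ≤ Fintype.card F ^ n := by
  rw [← card_monicDeg]
  refine Finset.card_le_card fun f hf => ?_
  rw [mem_squarefreeMonic] at hf
  exact mem_monicDeg.2 ⟨hf.1, hf.2.2⟩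

theorem card_pow_eq_sum (n : ℕ) : (Fintype.card F : ℝ) ^ n = ∑ j ∈ Finset.range (n / 2 + 1),
    ((squarefreeMonic F (n - 2 * j)).card : ℝ) * (Fintype.card F : ℝ) ^ j := by
  have h := sum_monicDeg_eq_sum_squarefree (F := F) n (fun _ => 1)
  simp only [Finset.sum_const, card_monicDeg, nsmul_eq_mul, mul_one] at h
  push_cast at h
  exact h

/-- In the decomposition of `q ^ (n + 2)` by square parts, the terms with nontrivial square part add
up to `q` times the decomposition of `q ^ n`, leaving `q ^ (n + 2) - q ^ (n + 1)`. -/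
theorem card_squarefreeMonic_add_two (n : ℕ) : ((squarefreeMonic F (n + 2)).card : ℝ) =
    (Fintype.card F : ℝ) ^ (n + 2) * (1 - 1 / Fintype.card F) := by
  have h1 := card_pow_eq_sum (F := F) (n + 2)
  have h2 := card_pow_eq_sum (F := F) n
  have hq : (Fintype.card F : ℝ) ≠ 0 := by exact_mod_cast Fintype.card_ne_zero
  rw [show (n + 2) / 2 + 1 = (n / 2 + 1) + 1 by omega, Finset.sum_range_succ'] at h1
  have h3 : ∑ j ∈ Finset.range (n / 2 + 1), ((squarefreeMonic F (n + 2 - 2 * (j + 1))).card : ℝ) *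
      (Fintype.card F : ℝ) ^ (j + 1) = (Fintype.card F : ℝ) * (Fintype.card F : ℝ) ^ n := by
    rw [h2, Finset.mul_sum]
    refine Finset.sum_congr rfl fun j _ => ?_
    rw [show n + 2 - 2 * (j + 1) = n - 2 * j by omega, pow_succ]; ring
  rw [h3] at h1
  simp only [mul_zero, Nat.sub_zero, pow_zero, mul_one] at h1
  rw [eq_comm] at h1
  rw [eq_sub_of_add_eq' h1]; field_simp; ring

theorem card_squarefreeMonic_zero : (squarefreeMonic F 0).card = 1 := by
  rw [Finset.card_eq_one]
  refine ⟨1, ?_⟩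
  ext f
  rw [mem_squarefreeMonic, Finset.mem_singleton]
  constructor
  · rintro ⟨h1, -, h2⟩; exact h1.natDegree_eq_zero.1 h2
  · rintro rfl; exact ⟨monic_one, squarefree_one, natDegree_one⟩

theorem card_squarefreeMonic_one : ((squarefreeMonic F 1).card : ℝ) = Fintype.card F := by
  have h := card_pow_eq_sum (F := F) 1
  simpa using h.symm

/-- The number of monic square-free polynomials of degree `n` with no prime factor in `S`. -/
def coprimeCount (S : Finset F[X]) (n : ℕ) : ℝ :=
  ((squarefreeMonic F n).filter (fun D => ∀ P ∈ S, ¬ P ∣ D)).card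

/-- A square-free `D` divisible by `P` is `P * E` with `E` square-free and prime to `P`; since `P ∉
S`, the condition at `S` passes between `D` and `E`. -/
theorem coprimeCount_eq {S : Finset F[X]} (hS : ∀ Q ∈ S, IsMonicPrime Q) {P : F[X]}
    (hP : IsMonicPrime P) (hPS : P ∉ S) (n : ℕ) :
    coprimeCount S n = coprimeCount (insert P S) n +
      (if P.natDegree ≤ n then coprimeCount (insert P S) (n - P.natDegree) else 0) := by
  have hsplit : coprimeCount S n = coprimeCount (insert P S) n +
      (((squarefreeMonic F n).filter (fun D => ∀ Q ∈ S, ¬ Q ∣ D)).filter (P ∣ ·)).card := by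
    rw [coprimeCount, ← Finset.card_filter_add_card_filter_not (fun D => P ∣ D), coprimeCount,
      Finset.filter_filter (p := fun D => ∀ Q ∈ S, ¬ Q ∣ D) (q := fun D => ¬ P ∣ D)]
    push_cast
    rw [add_comm]
    congr 4
    ext D
    simp [and_comm]
  rw [hsplit]
  congr 1
  split_ifs with hd
  · rw [coprimeCount]
    congr 1
    symm
    refine Finset.card_bij (fun D _ => P * D) ?_ ?_ ?_
    · intro D hD
      simp only [Finset.mem_filter, mem_squarefreeMonic, Finset.mem_insert, forall_eq_or_imp]
        at hD ⊢
      obtain ⟨⟨h1, h2, h3⟩, h4, h5⟩ := hD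
      refine ⟨⟨⟨hP.1.mul h1, ?_, by rw [hP.1.natDegree_mul h1, h3]; omega⟩, ?_⟩, dvd_mul_right _ _⟩
      · rw [squarefree_mul_iff]
        exact ⟨((hP.2.coprime_iff_not_dvd).2 h4).isRelPrime, hP.2.squarefree, h2⟩
      · intro Q hQ hQd
        rcases (hS Q hQ).prime.dvd_or_dvd hQd with h | h
        · exact hPS ((hS Q hQ).eq_of_dvd hP h ▸ hQ)
        · exact h5 Q hQ h
    · intro a _ b _ e
      exact mul_left_cancel₀ hP.1.ne_zero e
    · intro D hD
      simp only [Finset.mem_filter, mem_squarefreeMonic] at hD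
      obtain ⟨⟨⟨h1, h2, h3⟩, h4⟩, E, rfl⟩ := hD
      have hE := hP.1.of_mul_monic_left h1
      rw [hP.1.natDegree_mul hE] at h3
      refine ⟨E, ?_, rfl⟩
      simp only [Finset.mem_filter, mem_squarefreeMonic, Finset.mem_insert, forall_eq_or_imp]
      refine ⟨⟨hE, h2.of_mul_right, by omega⟩, ?_, fun Q hQ h => h4 Q hQ (h.mul_left P)⟩
      rintro ⟨E', rfl⟩
      exact hP.2.not_isUnit (h2 P ⟨E', by ring⟩)
  · rw [Nat.cast_eq_zero, Finset.card_eq_zero, Finset.filter_eq_empty_iff]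
    intro D hD hPD
    simp only [Finset.mem_filter, mem_squarefreeMonic] at hD
    have := natDegree_le_of_dvd hPD hD.1.1.ne_zero
    omega

/-- With `Q = r ^ (2 d)`, the factor `Q / (Q + 1)` makes the main term solve the recurrence exactly
when `n ≥ d`, so only errors propagate. The loss `3` is the fixed point of `K + (2 / 3) * 3 K = 3
K`, using `1 / r ≤ 2 / 3`. It is applied with `r = √q` and `d = deg P`. -/
theorem abs_sub_le_of_recurrence {A B : ℕ → ℝ} {r c K : ℝ} {d : ℕ} (hr : 3 / 2 ≤ r)
    (hc : 0 ≤ c) (hc1 : c ≤ 1) (hK : 1 ≤ K) (hd : 1 ≤ d)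
    (hAB : ∀ n, A n = B n + (if d ≤ n then B (n - d) else 0))
    (hA : ∀ n, |A n - c * (r ^ 2) ^ n| ≤ K * r ^ n) (n : ℕ) :
    |B n - c * ((r ^ 2) ^ d / ((r ^ 2) ^ d + 1)) * (r ^ 2) ^ n| ≤ 3 * K * r ^ n := by
  have hr0 : 0 < r := by linarith
  set Q := (r ^ 2) ^ d with hQ
  have hQ0 : 0 < Q := by positivity
  induction n using Nat.strong_induction_on with
  | _ n ih =>
    have h1 := hA n
    rw [hAB n] at h1
    by_cases hdn : d ≤ n
    · rw [if_pos hdn] at h1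
      have h2 := ih (n - d) (by omega)
      have e1 : (r ^ 2) ^ n = Q * (r ^ 2) ^ (n - d) := by rw [hQ, ← pow_add]; congr 1; omega
      have e2 : r ^ n = r ^ d * r ^ (n - d) := by rw [← pow_add]; congr 1; omega
      have hrd : r ≤ r ^ d := le_self_pow₀ (by linarith) (by omega)
      have hpos : 0 < r ^ (n - d) := by positivity
      have hmain : 3 * K * r ^ (n - d) ≤ 2 * K * r ^ n := by
        rw [e2]
        have : 3 * r ^ (n - d) ≤ 2 * (r ^ d * r ^ (n - d)) := by nlinarith
        nlinarith
      have e3 : B n - c * (Q / (Q + 1)) * (r ^ 2) ^ n =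
          (B n + B (n - d) - c * (r ^ 2) ^ n) -
            (B (n - d) - c * (Q / (Q + 1)) * (r ^ 2) ^ (n - d)) := by
        rw [e1]; field_simp; ring
      rw [e3]
      refine (abs_sub _ _).trans ?_
      linarith
    · rw [if_neg hdn, add_zero] at h1
      have e3 : B n - c * (Q / (Q + 1)) * (r ^ 2) ^ n =
          (B n - c * (r ^ 2) ^ n) + c * ((r ^ 2) ^ n / (Q + 1)) := by field_simp; ring
      -- For `n < d` there is no recursion: the main term is off by at most `1`, which `K * r ^ n`
      -- absorbs.
      have hle : (r ^ 2) ^ n ≤ Q := pow_le_pow_right₀ (by nlinarith) (by omega)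
      have h3 : (r ^ 2) ^ n / (Q + 1) ≤ 1 := by rw [div_le_one (by linarith)]; linarith
      have h4 : 0 ≤ (r ^ 2) ^ n / (Q + 1) := by positivity
      have h5 : |c * ((r ^ 2) ^ n / (Q + 1))| ≤ 1 := by
        rw [abs_of_nonneg (by positivity)]; nlinarith
      have h6 : 1 ≤ r ^ n := one_le_pow₀ (by linarith)
      rw [e3]
      refine (abs_add_le _ _).trans ?_
      nlinarith

theorem three_halves_le_sqrt_card (hq : Odd (Fintype.card F)) :
    3 / 2 ≤ Real.sqrt (Fintype.card F) := by
  have h3 : (3 : ℝ) ≤ Fintype.card F := by exact_mod_cast three_le_card hq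
  exact Real.le_sqrt_of_sq_le (by norm_num; linarith)

/-- Induction on the set of primes, each new prime costing a factor `3` in the error. For the empty
set the count is exact from degree `2` on, and degrees `0` and `1` are checked by hand. -/
theorem abs_coprimeCount_sub_le (hq : Odd (Fintype.card F)) {S : Finset F[X]}
    (hS : ∀ Q ∈ S, IsMonicPrime Q) (n : ℕ) :
    |coprimeCount S n - ((1 - 1 / Fintype.card F) *
      ∏ P ∈ S, ((polyNorm P : ℝ) / (polyNorm P + 1))) * (Fintype.card F : ℝ) ^ n| ≤
      3 ^ S.card * Real.sqrt (Fintype.card F) ^ n := by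
  have h3 : (3 : ℝ) ≤ Fintype.card F := by exact_mod_cast three_le_card hq
  have hr := three_halves_le_sqrt_card hq
  have hsq : Real.sqrt (Fintype.card F) ^ 2 = Fintype.card F := Real.sq_sqrt (by linarith)
  have hc0 : (0 : ℝ) ≤ 1 - 1 / Fintype.card F := by
    rw [sub_nonneg, div_le_one (by linarith)]; linarith
  induction S using Finset.induction_on generalizing n with
  | empty =>
    have e : coprimeCount (∅ : Finset F[X]) n = (squarefreeMonic F n).card := by
      simp [coprimeCount]
    rw [e]
    simp only [Finset.prod_empty, mul_one, Finset.card_empty, pow_zero, one_mul]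
    match n with
    | 0 =>
      rw [card_squarefreeMonic_zero]
      simp only [pow_zero, mul_one, Nat.cast_one, sub_sub_cancel]
      rw [abs_of_nonneg (by positivity), div_le_one (by linarith)]; linarith
    | 1 =>
      rw [card_squarefreeMonic_one]
      have : (Fintype.card F : ℝ) - (1 - 1 / Fintype.card F) * (Fintype.card F : ℝ) ^ 1 = 1 := by
        field_simp; ring
      rw [this, abs_one, pow_one]; linarith
    | n + 2 =>
      rw [card_squarefreeMonic_add_two, mul_comm, sub_self, abs_zero]; positivity
  | insert P S hPS ih =>
    have hP := hS P (Finset.mem_insert_self _ _)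
    have hS' : ∀ Q ∈ S, IsMonicPrime Q := fun Q hQ => hS Q (Finset.mem_insert_of_mem hQ)
    have hprod : ∀ T : Finset F[X], 0 ≤ ∏ P ∈ T, ((polyNorm P : ℝ) / (polyNorm P + 1)) ∧
        ∏ P ∈ T, ((polyNorm P : ℝ) / (polyNorm P + 1)) ≤ 1 := fun T =>
      ⟨Finset.prod_nonneg fun _ _ => by positivity,
        Finset.prod_le_one (fun _ _ => by positivity) fun P _ => by
          rw [div_le_one (by positivity)]; linarith⟩
    have := abs_sub_le_of_recurrence (r := Real.sqrt (Fintype.card F))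
      (c := (1 - 1 / Fintype.card F) * ∏ P ∈ S, ((polyNorm P : ℝ) / (polyNorm P + 1)))
      (K := 3 ^ S.card) hr (mul_nonneg hc0 (hprod S).1)
      (mul_le_one₀ (by simp) (hprod S).1 (hprod S).2) (one_le_pow₀ (by norm_num))
      hP.natDegree_pos (coprimeCount_eq hS' hP hPS) (fun n => by rw [hsq]; exact ih hS' n) n
    rw [hsq] at this
    rw [Finset.prod_insert hPS, Finset.card_insert_of_notMem hPS, pow_succ', polyNorm]
    push_cast
    convert this using 3
    ring

/-- Writing monics as `s * l ^ 2` and using that the full sum vanishes for `n ≥ m`, the square-free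
sum is minus the terms with `deg l ≥ 1`, to which strong induction applies. With `r = √(2 q)` these
terms form the geometric series of ratio `1 / 2`; with `s = √(q / 2)` one has `s * r = q`, so the
trivial bound starts the induction for `n < m`. Any saving exponential in `g` suffices, so no deep
bound on `L`-functions is used. -/
theorem abs_sum_squarefree_le (hq : Odd (Fintype.card F)) {χ : F[X] → ℝ} {m : ℕ}
    (hmul : ∀ a b, χ (a * b) = χ a * χ b) (habs : ∀ a, |χ a| ≤ 1)
    (hzero : ∀ n, m ≤ n → ∑ D ∈ monicDeg F n, χ D = 0) (n : ℕ) :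
    |∑ D ∈ squarefreeMonic F n, χ D| ≤
      Real.sqrt (Fintype.card F / 2) ^ m * Real.sqrt (2 * Fintype.card F) ^ n := by
  have h3 : (3 : ℝ) ≤ Fintype.card F := by exact_mod_cast three_le_card hq
  set q : ℝ := (Fintype.card F : ℝ) with hqdef
  set s := Real.sqrt (q / 2)
  set r := Real.sqrt (2 * q)
  have hs1 : 1 ≤ s := Real.one_le_sqrt.2 (by linarith)
  have hr0 : 0 < r := Real.sqrt_pos.2 (by linarith)
  have hr2 : r ^ 2 = 2 * q := Real.sq_sqrt (by linarith)
  have hrs : s * r = q := by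
    rw [← Real.sqrt_mul (by linarith), show q / 2 * (2 * q) = q ^ 2 by ring,
      Real.sqrt_sq (by linarith)]
  induction n using Nat.strong_induction_on with
  | _ n ih =>
    by_cases hmn : m ≤ n
    · have h1 := hzero n hmn
      rw [sum_monicDeg_eq_sum_squarefree, Finset.sum_range_succ'] at h1
      simp only [mul_zero, Nat.sub_zero, monicDeg_zero, Finset.sum_singleton, one_pow,
        mul_one] at h1
      rw [add_comm, ← eq_neg_iff_add_eq_zero] at h1
      rw [h1, abs_neg]
      refine (Finset.abs_sum_le_sum_abs _ _).trans ?_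
      have hterm : ∀ j ∈ Finset.range (n / 2),
          |∑ t ∈ squarefreeMonic F (n - 2 * (j + 1)), ∑ l ∈ monicDeg F (j + 1), χ (t * l ^ 2)| ≤
            s ^ m * r ^ n * (1 / 2) ^ (j + 1) := by
        intro j hj
        rw [Finset.mem_range] at hj
        have e : ∑ t ∈ squarefreeMonic F (n - 2 * (j + 1)), ∑ l ∈ monicDeg F (j + 1),
            χ (t * l ^ 2) = (∑ t ∈ squarefreeMonic F (n - 2 * (j + 1)), χ t) *
              ∑ l ∈ monicDeg F (j + 1), χ l ^ 2 := by
          rw [Finset.sum_mul_sum]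
          simp_rw [pow_two, hmul]
        have h2 : |∑ l ∈ monicDeg F (j + 1), χ l ^ 2| ≤ q ^ (j + 1) := by
          refine (Finset.abs_sum_le_sum_abs _ _).trans ?_
          refine (Finset.sum_le_card_nsmul _ _ 1 fun l _ => ?_).trans ?_
          · rw [abs_pow]; exact pow_le_one₀ (abs_nonneg _) (habs l)
          · rw [card_monicDeg]; simp [hqdef]
        rw [e, abs_mul]
        refine (mul_le_mul (ih _ (by omega)) h2 (abs_nonneg _) (by positivity)).trans (le_of_eq ?_)
        -- Lowering the degree by `2 (j + 1)` saves `(2 q) ^ (j + 1)`, while the squares cost only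
        -- `q ^ (j + 1)`.
        have e3 : r ^ n = r ^ (n - 2 * (j + 1)) * (2 * q) ^ (j + 1) := by
          rw [← hr2, ← pow_mul, ← pow_add]; congr 1; omega
        rw [e3, mul_pow]
        have : (2 : ℝ) ^ (j + 1) * (1 / 2) ^ (j + 1) = 1 := by rw [← mul_pow]; norm_num
        linear_combination (-(s ^ m * r ^ (n - 2 * (j + 1)) * q ^ (j + 1))) * this
      refine (Finset.sum_le_sum hterm).trans ?_
      rw [← Finset.mul_sum]
      refine mul_le_of_le_one_right (by positivity) ?_
      have hg : ∀ N : ℕ, ∑ j ∈ Finset.range N, ((1 : ℝ) / 2) ^ (j + 1) = 1 - (1 / 2) ^ N := by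
        intro N
        induction N with
        | zero => simp
        | succ N ih => rw [Finset.sum_range_succ, ih]; ring
      rw [hg]
      have : (0 : ℝ) ≤ (1 / 2) ^ (n / 2) := by positivity
      linarith
    · refine (Finset.abs_sum_le_sum_abs _ _).trans ?_
      refine (Finset.sum_le_card_nsmul _ _ 1 fun l _ => habs l).trans ?_
      rw [nsmul_eq_mul, mul_one]
      have h1 : ((squarefreeMonic F n).card : ℝ) ≤ q ^ n := by
        rw [hqdef]; exact_mod_cast card_squarefreeMonic_le n
      refine h1.trans ?_
      rw [← hrs, mul_pow]
      exact mul_le_mul_of_nonneg_right (pow_le_pow_right₀ hs1 (by omega)) (by positivity)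

end SquarefreeCounts

/-! ### Mean values of monomials in the residue symbols -/

section MonomialMoments

/-- The `e`-th moment of the random model of the residue symbol at `P`. -/
def modelMoment (P : F[X]) (e : ℕ) : ℝ :=
  if e = 0 then 1 else if Even e then (polyNorm P : ℝ) / (polyNorm P + 1) else 0

theorem prod_residueSymbol_props (hq : Odd (Fintype.card F)) {S : Finset F[X]}
    (hS : ∀ P ∈ S, IsMonicPrime P) (a : F[X] → ℕ) :
    (∀ x y, ∏ P ∈ S, (residueSymbol (x * y) P : ℝ) ^ a P =
      (∏ P ∈ S, (residueSymbol x P : ℝ) ^ a P) * ∏ P ∈ S, (residueSymbol y P : ℝ) ^ a P) ∧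
    (∀ x, |∏ P ∈ S, (residueSymbol x P : ℝ) ^ a P| ≤ 1) ∧
    (∀ x y, ∏ P ∈ S, P ^ a P ∣ x - y →
      ∏ P ∈ S, (residueSymbol x P : ℝ) ^ a P = ∏ P ∈ S, (residueSymbol y P : ℝ) ^ a P) := by
  refine ⟨fun x y => ?_, fun x => ?_, fun x y hxy => ?_⟩
  · rw [← Finset.prod_mul_distrib]
    refine Finset.prod_congr rfl fun P hP => ?_
    rw [residueSymbol_mul hq (hS P hP), Int.cast_mul, mul_pow]
  · rw [Finset.abs_prod]
    refine Finset.prod_le_one (fun _ _ => abs_nonneg _) fun P hP => ?_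
    rw [abs_pow]
    refine pow_le_one₀ (abs_nonneg _) ?_
    exact_mod_cast abs_residueSymbol_le hq (hS P hP) x
  · refine Finset.prod_congr rfl fun P hP => ?_
    by_cases ha : a P = 0
    · simp [ha]
    · rw [residueSymbol_congr hq (hS P hP) (((dvd_pow_self P ha).trans
        (Finset.dvd_prod_of_mem (fun P => P ^ a P) hP)).trans hxy)]

/-- Chinese remainder theorem: take `u` a nonresidue modulo `Q` and congruent to `1` modulo the
other primes; the odd exponent at `Q` keeps the sign. -/
theorem exists_prod_residueSymbol_eq_neg_one (hq : Odd (Fintype.card F)) {S : Finset F[X]}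
    (hS : ∀ P ∈ S, IsMonicPrime P) (a : F[X] → ℕ) {Q : F[X]} (hQ : Q ∈ S) (hodd : ¬ Even (a Q)) :
    ∃ u, IsCoprime u (∏ P ∈ S, P ^ a P) ∧ ∏ P ∈ S, (residueSymbol u P : ℝ) ^ a P = -1 := by
  obtain ⟨v, hv⟩ := exists_residueSymbol_eq_neg_one hq (hS Q hQ)
  have hcop : IsCoprime Q (∏ P ∈ S.erase Q, P) := by
    refine IsCoprime.prod_right fun P hP => ?_
    rw [(hS Q hQ).2.coprime_iff_not_dvd]
    exact fun h => (Finset.ne_of_mem_erase hP)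
      ((hS Q hQ).eq_of_dvd (hS P (Finset.mem_of_mem_erase hP)) h).symm
  obtain ⟨x, y, hxy⟩ := hcop
  set M := ∏ P ∈ S.erase Q, P with hM
  set u := v * (y * M) + x * Q with hu
  have huQ : residueSymbol u Q = -1 := by
    rw [← hv]
    exact residueSymbol_congr hq (hS Q hQ) ⟨x * (1 - v), by
      rw [hu]; linear_combination (v : F[X]) * hxy⟩
  have huP : ∀ P ∈ S.erase Q, residueSymbol u P = 1 := by
    intro P hP
    have hP' := hS P (Finset.mem_of_mem_erase hP)
    rw [← residueSymbol_one hq hP']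
    refine residueSymbol_congr hq hP' ((Finset.dvd_prod_of_mem _ hP).trans (b := M) ⟨y * (v - 1), ?_⟩)
    rw [hu]; linear_combination hxy
  refine ⟨u, IsCoprime.prod_right fun P hP => IsCoprime.pow_right ?_, ?_⟩
  · refine (((hS P hP).2.coprime_iff_not_dvd).2 fun h => ?_).symm
    rw [← residueSymbol_eq_zero_iff hq (hS P hP)] at h
    by_cases hPQ : P = Q
    · subst hPQ; rw [h] at huQ; norm_num at huQ
    · rw [huP P (Finset.mem_erase.2 ⟨hPQ, hP⟩)] at h; norm_num at h
  · rw [← Finset.mul_prod_erase S _ hQ, huQ, Finset.prod_eq_one fun P hP => by rw [huP P hP]; simp]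
    rw [Nat.not_even_iff_odd] at hodd
    push_cast
    rw [hodd.neg_one_pow, mul_one]

theorem prod_residueSymbol_eq_ite (hq : Odd (Fintype.card F)) {S : Finset F[X]}
    (hS : ∀ P ∈ S, IsMonicPrime P) {a : F[X] → ℕ} (heven : ∀ P ∈ S, Even (a P)) (D : F[X]) :
    ∏ P ∈ S, (residueSymbol D P : ℝ) ^ a P =
      if ∀ P ∈ S.filter (a · ≠ 0), ¬ P ∣ D then 1 else 0 := by
  split_ifs with h
  · refine Finset.prod_eq_one fun P hP => ?_
    by_cases ha : a P = 0
    · simp [ha]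
    · have h1 := residueSymbol_sq hq (hS P hP) (h P (Finset.mem_filter.2 ⟨hP, ha⟩))
      obtain ⟨b, hb⟩ := heven P hP
      rw [hb, ← two_mul, pow_mul]
      have h2 : (residueSymbol D P : ℝ) ^ 2 = 1 := by exact_mod_cast h1
      rw [h2, one_pow]
  · push Not at h
    obtain ⟨P, hP, hPD⟩ := h
    rw [Finset.mem_filter] at hP
    refine Finset.prod_eq_zero hP.1 ?_
    rw [(residueSymbol_eq_zero_iff hq (hS P hP.1)).2 hPD, Int.cast_zero, zero_pow hP.2]

/-- The link between the family and the model. Even exponents reduce to `abs_coprimeCount_sub_le`,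
an odd exponent to `abs_sum_squarefree_le`. The degree bound `g` is half the degree of `D`, and this
leaves an exponential saving in both cases. -/
theorem abs_expectation_prod_sub_le (hq : Odd (Fintype.card F)) {S : Finset F[X]}
    (hS : ∀ P ∈ S, IsMonicPrime P) (a : F[X] → ℕ) {g : ℕ} (hg : 1 ≤ g)
    (hdeg : ∑ P ∈ S, a P * P.natDegree ≤ g) :
    |expectation F (2 * g + 1) (fun D => ∏ P ∈ S, (residueSymbol D P : ℝ) ^ a P) -
      ∏ P ∈ S, modelMoment P (a P)| ≤ 2 * (Real.sqrt (3 / 2))⁻¹ ^ g := by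
  have h3 : (3 : ℝ) ≤ Fintype.card F := by exact_mod_cast three_le_card hq
  obtain ⟨hmul, habs, hper⟩ := prod_residueSymbol_props hq hS a
  set q : ℝ := (Fintype.card F : ℝ) with hqdef
  have hcard : ((squarefreeMonic F (2 * g + 1)).card : ℝ) = q ^ (2 * g + 1) * (1 - 1 / q) := by
    obtain ⟨n, hn⟩ : ∃ n, 2 * g + 1 = n + 2 := ⟨2 * g - 1, by omega⟩
    rw [hn, card_squarefreeMonic_add_two]
  have hc : (2 : ℝ) / 3 ≤ 1 - 1 / q := by
    have : 1 / q ≤ 1 / 3 := one_div_le_one_div_of_le (by norm_num) h3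
    linarith
  have hq0 : (0 : ℝ) < q := by linarith
  have hcpos : 0 < q ^ (2 * g + 1) * (1 - 1 / q) := by
    have : 0 < 1 - 1 / q := by linarith
    positivity
  have hinv : (q ^ (2 * g + 1) * (1 - 1 / q))⁻¹ ≤ 2 * (q ^ (2 * g + 1))⁻¹ := by
    rw [mul_inv, mul_comm]
    refine mul_le_mul_of_nonneg_right ?_ (by positivity)
    rw [inv_le_comm₀ (by linarith) (by norm_num)]; linarith
  set t := Real.sqrt (3 / 2) with ht
  have ht1 : 1 ≤ t := Real.one_le_sqrt.2 (by norm_num)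
  by_cases heven : ∀ P ∈ S, Even (a P)
  · set T := S.filter (a · ≠ 0) with hT
    have hTS : ∀ P ∈ T, IsMonicPrime P := fun P hP => hS P (Finset.mem_filter.1 hP).1
    have e1 : ∑ D ∈ squarefreeMonic F (2 * g + 1), ∏ P ∈ S, (residueSymbol D P : ℝ) ^ a P =
        coprimeCount T (2 * g + 1) := by
      simp_rw [prod_residueSymbol_eq_ite hq hS heven]
      rw [Finset.sum_boole]; rfl
    have e2 : ∏ P ∈ S, modelMoment P (a P) = ∏ P ∈ T, ((polyNorm P : ℝ) / (polyNorm P + 1)) := by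
      rw [hT, Finset.prod_filter]
      refine Finset.prod_congr rfl fun P hP => ?_
      by_cases ha : a P = 0
      · simp [modelMoment, ha]
      · simp [modelMoment, ha, heven P hP]
    -- Each prime of `T` has exponent at least `2`, so the loss `3 ^ |T|` is at most `√3 ^ g`, well
    -- below the saving `√q ^ (2 g + 1)`.
    have hTcard : 2 * T.card ≤ g := by
      refine le_trans ?_ hdeg
      rw [mul_comm, ← smul_eq_mul]
      refine (Finset.card_nsmul_le_sum T (fun P => a P * P.natDegree) 2 fun P hP => ?_).trans
        (Finset.sum_le_sum_of_subset (Finset.filter_subset _ _))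
      rw [Finset.mem_filter] at hP
      obtain ⟨b, hb⟩ := heven P hP.1
      have := (hS P hP.1).natDegree_pos
      have hb1 : 1 ≤ b := by have := hP.2; omega
      nlinarith
    have hmain := abs_coprimeCount_sub_le hq hTS (2 * g + 1)
    rw [← hqdef] at hmain
    set R := ∏ P ∈ T, ((polyNorm P : ℝ) / (polyNorm P + 1))
    have hs1 : (1 : ℝ) ≤ Real.sqrt 3 := Real.one_le_sqrt.2 (by norm_num)
    have hpow : (3 : ℝ) ^ T.card ≤ Real.sqrt 3 ^ g := by
      calc (3 : ℝ) ^ T.card = Real.sqrt 3 ^ (2 * T.card) := by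
            rw [pow_mul, Real.sq_sqrt (by norm_num)]
        _ ≤ _ := pow_le_pow_right₀ hs1 hTcard
    have hsq : Real.sqrt q ^ 2 = q := Real.sq_sqrt (by linarith)
    have hsq3 : Real.sqrt 3 ≤ Real.sqrt q := Real.sqrt_le_sqrt h3
    have ht3 : t ≤ Real.sqrt 3 := Real.sqrt_le_sqrt (by norm_num)
    rw [expectation, e1, e2, hcard]
    have e3 : (q ^ (2 * g + 1) * (1 - 1 / q))⁻¹ * coprimeCount T (2 * g + 1) - R =
        (q ^ (2 * g + 1) * (1 - 1 / q))⁻¹ *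
          (coprimeCount T (2 * g + 1) - (1 - 1 / q) * R * q ^ (2 * g + 1)) := by
      rw [show (1 - 1 / q) * R * q ^ (2 * g + 1) = (q ^ (2 * g + 1) * (1 - 1 / q)) * R by ring]
      generalize q ^ (2 * g + 1) * (1 - 1 / q) = b at hcpos
      rw [mul_sub, inv_mul_cancel_left₀ hcpos.ne']
    rw [e3, abs_mul, abs_of_pos (inv_pos.2 hcpos)]
    refine (mul_le_mul hinv hmain (abs_nonneg _) (by positivity)).trans ?_
    rw [mul_assoc]
    refine mul_le_mul_of_nonneg_left ?_ (by norm_num)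
    have hsq0 : 0 < Real.sqrt q := Real.sqrt_pos.2 hq0
    rw [inv_pow, inv_mul_le_iff₀ (by positivity), ← div_eq_mul_inv, le_div_iff₀ (by positivity)]
    have e4 : q ^ (2 * g + 1) = Real.sqrt q ^ (2 * g + 1) * Real.sqrt q ^ (2 * g + 1) := by
      rw [← mul_pow, ← pow_two, hsq]
    rw [e4]
    have h5 : Real.sqrt 3 ^ g * t ^ g ≤ Real.sqrt q ^ (2 * g + 1) := by
      calc Real.sqrt 3 ^ g * t ^ g ≤ Real.sqrt q ^ g * Real.sqrt q ^ g :=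
            mul_le_mul (pow_le_pow_left₀ (by positivity) hsq3 _)
              (pow_le_pow_left₀ (by positivity) (ht3.trans hsq3) _) (by positivity) (by positivity)
        _ = Real.sqrt q ^ (2 * g) := by rw [← pow_add, two_mul]
        _ ≤ _ := pow_le_pow_right₀ ((hs1.trans hsq3)) (by omega)
    have h6 : 3 ^ T.card * t ^ g ≤ Real.sqrt q ^ (2 * g + 1) :=
      (mul_le_mul_of_nonneg_right hpow (by positivity)).trans h5
    calc 3 ^ T.card * Real.sqrt q ^ (2 * g + 1) * t ^ g
        = 3 ^ T.card * t ^ g * Real.sqrt q ^ (2 * g + 1) := by ring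
      _ ≤ _ := mul_le_mul_of_nonneg_right h6 (by positivity)
  · push Not at heven
    obtain ⟨Q, hQ, hodd⟩ := heven
    obtain ⟨u, hu, hu1⟩ := exists_prod_residueSymbol_eq_neg_one hq hS a hQ hodd
    have hf : (∏ P ∈ S, P ^ a P).Monic := monic_prod_of_monic _ _ fun P hP => (hS P hP).1.pow _
    have hfd : (∏ P ∈ S, P ^ a P).natDegree = ∑ P ∈ S, a P * P.natDegree := by
      rw [natDegree_prod_of_monic _ _ fun P hP => (hS P hP).1.pow _]
      exact Finset.sum_congr rfl fun P hP => natDegree_pow _ _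
    have e0 : ∏ P ∈ S, modelMoment P (a P) = 0 := by
      refine Finset.prod_eq_zero hQ ?_
      have : a Q ≠ 0 := by rintro h; rw [h] at hodd; exact hodd (by simp)
      simp [modelMoment, this, hodd]
    have hmain := abs_sum_squarefree_le hq (χ := fun D => ∏ P ∈ S, (residueSymbol D P : ℝ) ^ a P)
      (m := g) hmul habs (fun n hn => sum_nonprincipal_eq_zero hf (fun x y => hper x y) hmul hu
        (by rw [hu1]; norm_num) (by rw [hfd]; omega)) (2 * g + 1)
    rw [← hqdef] at hmain
    rw [e0, sub_zero, expectation, abs_mul, hcard, abs_of_pos (inv_pos.2 hcpos)]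
    refine (mul_le_mul hinv hmain (abs_nonneg _) (by positivity)).trans ?_
    rw [mul_assoc]
    refine mul_le_mul_of_nonneg_left ?_ (by norm_num)
    set s := Real.sqrt (q / 2)
    set r := Real.sqrt (2 * q)
    have hts : t ≤ s := Real.sqrt_le_sqrt (by linarith)
    have hrs : s * r = q := by
      rw [← Real.sqrt_mul (by linarith), show q / 2 * (2 * q) = q ^ 2 by ring,
        Real.sqrt_sq (by linarith)]
    have hr0 : 0 < r := Real.sqrt_pos.2 (by linarith)
    rw [inv_pow, inv_mul_le_iff₀ (by positivity), ← div_eq_mul_inv, le_div_iff₀ (by positivity)]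
    rw [← hrs, mul_pow]
    have h5 : s ^ g * t ^ g ≤ s ^ (2 * g + 1) := by
      calc s ^ g * t ^ g ≤ s ^ g * s ^ g := mul_le_mul_of_nonneg_left
            (pow_le_pow_left₀ (by positivity) hts _) (by positivity)
        _ = s ^ (2 * g) := by rw [← pow_add, two_mul]
        _ ≤ _ := pow_le_pow_right₀ (ht1.trans hts) (by omega)
    calc s ^ g * r ^ (2 * g + 1) * t ^ g = s ^ g * t ^ g * r ^ (2 * g + 1) := by ring
      _ ≤ _ := mul_le_mul_of_nonneg_right h5 (by positivity)

end MonomialMoments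

/-! ### From monomial moments to exponential moments -/

section MomentComparison

/-- The tail of the exponential series is compared termwise with `y ^ M / M!` times the whole
series, since `M! n! ≤ (M + n)!`. -/
theorem exp_sub_sum_le {y : ℝ} (hy : 0 ≤ y) (M : ℕ) :
    Real.exp y - ∑ m ∈ Finset.range M, y ^ m / m.factorial ≤
      y ^ M / M.factorial * Real.exp y := by
  have hs : HasSum (fun n : ℕ => y ^ n / n.factorial) (Real.exp y) := by
    rw [Real.exp_eq_exp_ℝ]; exact NormedSpace.expSeries_div_hasSum_exp y
  rw [← hs.tsum_eq, ← hs.summable.sum_add_tsum_nat_add M, add_sub_cancel_left,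
    hs.summable.sum_add_tsum_nat_add M, ← tsum_mul_left]
  refine ((summable_nat_add_iff M).2 hs.summable).tsum_le_tsum (fun n => ?_)
    (hs.summable.mul_left _)
  rw [div_mul_div_comm, ← pow_add, add_comm M n]
  refine div_le_div_of_nonneg_left (by positivity) (by positivity) ?_
  have := Nat.le_of_dvd (Nat.factorial_pos _) (Nat.factorial_mul_factorial_dvd_factorial_add M n)
  rw [add_comm n M]
  exact_mod_cast this

theorem abs_exp_sub_sum_le {x W : ℝ} (hx : |x| ≤ W) (M : ℕ) :
    |Real.exp x - ∑ m ∈ Finset.range M, x ^ m / m.factorial| ≤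
      W ^ M / M.factorial * Real.exp W := by
  have h := Complex.norm_exp_sub_sum_le_exp_norm_sub_sum (x : ℂ) M
  have e : Complex.exp x - ∑ m ∈ Finset.range M, (x : ℂ) ^ m / m.factorial =
      ((Real.exp x - ∑ m ∈ Finset.range M, x ^ m / m.factorial : ℝ) : ℂ) := by push_cast; rfl
  rw [e, Complex.norm_real, Complex.norm_real, Real.norm_eq_abs, Real.norm_eq_abs] at h
  refine h.trans ((exp_sub_sum_le (abs_nonneg x) M).trans ?_)
  have hW : 0 ≤ W := (abs_nonneg x).trans hx
  gcongr

theorem pow_div_factorial_le {W : ℝ} (hW : 0 ≤ W) {M : ℕ} (hM : 0 < M) :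
    W ^ M / M.factorial ≤ (Real.exp 1 * W / M) ^ M := by
  have h := Real.pow_div_factorial_le_exp (M : ℝ) (by positivity) M
  have hM' : (0 : ℝ) < M := by exact_mod_cast hM
  rw [div_le_iff₀ (by positivity)] at h
  rw [div_pow, mul_pow, ← Real.exp_nat_mul, mul_one, div_le_div_iff₀ (by positivity) (by positivity)]
  nlinarith [pow_nonneg hW M]

variable {ι τ α β : Type*}

theorem sum_mul_sum_comm {T : Finset τ} {b : τ → ℝ} (I : Finset α) (p : α → ℝ) (G : τ → α → ℝ) :
    ∑ i ∈ I, p i * ∑ t ∈ T, b t * G t i = ∑ t ∈ T, b t * ∑ i ∈ I, p i * G t i := by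
  simp_rw [Finset.mul_sum]
  rw [Finset.sum_comm]
  exact Finset.sum_congr rfl fun t _ => Finset.sum_congr rfl fun i _ => by ring

theorem abs_sum_mul_exp_sub_le {I : Finset α} {p z : α → ℝ} {W : ℝ} {M : ℕ}
    (hp : ∀ i ∈ I, 0 ≤ p i) (hp1 : ∑ i ∈ I, p i = 1) (hz : ∀ i ∈ I, |z i| ≤ W) :
    |∑ i ∈ I, p i * Real.exp (z i) -
      ∑ m ∈ Finset.range M, (m.factorial : ℝ)⁻¹ * ∑ i ∈ I, p i * z i ^ m| ≤
      W ^ M / M.factorial * Real.exp W := by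
  rw [← sum_mul_sum_comm, ← Finset.sum_sub_distrib]
  refine (Finset.abs_sum_le_sum_abs _ _).trans ?_
  rw [← one_mul (W ^ M / M.factorial * Real.exp W), ← hp1, Finset.sum_mul]
  refine Finset.sum_le_sum fun i hi => ?_
  rw [← mul_sub, abs_mul, abs_of_nonneg (hp i hi)]
  refine mul_le_mul_of_nonneg_left ?_ (hp i hi)
  simpa only [div_eq_inv_mul] using abs_exp_sub_sum_le (hz i hi) M

/-- One factor of the `m`-th power is expanded at a time and absorbed into the monomial, raising its
degree by at most `N`; carrying an arbitrary monomial `a` is what lets the induction run. The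
coefficients contribute `∑ |b t|` at each step. -/
theorem abs_moment_sub_le {S : Finset ι} {T : Finset τ} {π : τ → ι} {e : τ → ℕ} {b : τ → ℝ}
    {d : ι → ℕ} {N L : ℕ} (hπ : ∀ t ∈ T, π t ∈ S) (hN : ∀ t ∈ T, e t * d (π t) ≤ N)
    {I : Finset α} {J : Finset β} {p : α → ℝ} {p' : β → ℝ} {x : α → ι → ℝ} {x' : β → ι → ℝ} {δ : ℝ}
    (hδ : ∀ a : ι → ℕ, ∑ P ∈ S, a P * d P ≤ L →
      |∑ i ∈ I, p i * ∏ P ∈ S, x i P ^ a P - ∑ i ∈ J, p' i * ∏ P ∈ S, x' i P ^ a P| ≤ δ) (m : ℕ) :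
    ∀ a : ι → ℕ, ∑ P ∈ S, a P * d P + m * N ≤ L →
      |∑ i ∈ I, p i * ((∏ P ∈ S, x i P ^ a P) * (∑ t ∈ T, b t * x i (π t) ^ e t) ^ m) -
        ∑ i ∈ J, p' i * ((∏ P ∈ S, x' i P ^ a P) * (∑ t ∈ T, b t * x' i (π t) ^ e t) ^ m)| ≤
        (∑ t ∈ T, |b t|) ^ m * δ := by
  induction m with
  | zero => intro a ha; simpa using hδ a (by simpa using ha)
  | succ m ih =>
    intro a ha
    have hprod : ∀ (y : ι → ℝ), ∀ t ∈ T, (∏ P ∈ S, y P ^ a P) * y (π t) ^ e t =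
        ∏ P ∈ S, y P ^ ((a P + (Pi.single (π t) (e t) : ι → ℕ) P)) := by
      intro y t ht
      simp_rw [pow_add, Finset.prod_mul_distrib]
      congr 1
      rw [Finset.prod_eq_single (π t)]
      · simp
      · intro P _ hP; simp [hP]
      · intro h; exact absurd (hπ t ht) h
    have hexp : ∀ (y : ι → ℝ), (∏ P ∈ S, y P ^ a P) * (∑ t ∈ T, b t * y (π t) ^ e t) ^ (m + 1) =
        ∑ t ∈ T, b t * ((∏ P ∈ S, y P ^ ((a P + (Pi.single (π t) (e t) : ι → ℕ) P))) *
          (∑ t ∈ T, b t * y (π t) ^ e t) ^ m) := by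
      intro y
      rw [pow_succ', ← mul_assoc, Finset.mul_sum, Finset.sum_mul]
      refine Finset.sum_congr rfl fun t ht => ?_
      rw [← hprod y t ht]; ring
    simp_rw [hexp]
    rw [sum_mul_sum_comm I p, sum_mul_sum_comm J p', ← Finset.sum_sub_distrib]
    refine (Finset.abs_sum_le_sum_abs _ _).trans ?_
    rw [pow_succ', mul_assoc, Finset.sum_mul]
    refine Finset.sum_le_sum fun t ht => ?_
    rw [← mul_sub, abs_mul]
    refine mul_le_mul_of_nonneg_left (ih _ ?_) (abs_nonneg _)
    have h1 : ∑ P ∈ S, (a P + (Pi.single (π t) (e t) : ι → ℕ) P) * d P =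
        ∑ P ∈ S, a P * d P + e t * d (π t) := by
      simp_rw [add_mul, Finset.sum_add_distrib]
      congr 1
      rw [Finset.sum_eq_single (π t)]
      · simp
      · intro P _ hP; simp [hP]
      · intro h; exact absurd (hπ t ht) h
    have h2 := hN t ht
    rw [h1]
    have : (m + 1) * N = m * N + N := by ring
    omega

/-- Both exponentials are truncated at `M`. Powers below `M` involve monomials of degree at most `M
* N ≤ L`, and their errors sum to at most `∑ W ^ m / m! * δ ≤ exp W * δ`; the other term is the two
Taylor tails. -/
theorem abs_exp_moment_sub_le {S : Finset ι} {T : Finset τ} {π : τ → ι} {e : τ → ℕ} {b : τ → ℝ}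
    {d : ι → ℕ} {N L M : ℕ} (hπ : ∀ t ∈ T, π t ∈ S) (hN : ∀ t ∈ T, e t * d (π t) ≤ N)
    (hM : M * N ≤ L)
    {I : Finset α} {J : Finset β} {p : α → ℝ} {p' : β → ℝ} {x : α → ι → ℝ} {x' : β → ι → ℝ} {δ : ℝ}
    (hδ : ∀ a : ι → ℕ, ∑ P ∈ S, a P * d P ≤ L →
      |∑ i ∈ I, p i * ∏ P ∈ S, x i P ^ a P - ∑ i ∈ J, p' i * ∏ P ∈ S, x' i P ^ a P| ≤ δ)
    (hp : ∀ i ∈ I, 0 ≤ p i) (hp' : ∀ i ∈ J, 0 ≤ p' i) (hp1 : ∑ i ∈ I, p i = 1)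
    (hp1' : ∑ i ∈ J, p' i = 1) (hx : ∀ i ∈ I, ∀ P ∈ S, |x i P| ≤ 1)
    (hx' : ∀ i ∈ J, ∀ P ∈ S, |x' i P| ≤ 1) {W : ℝ} (hW : ∑ t ∈ T, |b t| ≤ W) :
    |∑ i ∈ I, p i * Real.exp (∑ t ∈ T, b t * x i (π t) ^ e t) -
        ∑ i ∈ J, p' i * Real.exp (∑ t ∈ T, b t * x' i (π t) ^ e t)| ≤
      Real.exp W * δ + 2 * (W ^ M / M.factorial * Real.exp W) := by
  have hδ0 : 0 ≤ δ := (abs_nonneg _).trans (hδ 0 (by simp))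
  have hW0 : 0 ≤ W := (Finset.sum_nonneg fun _ _ => abs_nonneg _).trans hW
  have hbound : ∀ y : ι → ℝ, (∀ P ∈ S, |y P| ≤ 1) → |∑ t ∈ T, b t * y (π t) ^ e t| ≤ W := by
    intro y hy
    refine (Finset.abs_sum_le_sum_abs _ _).trans ((Finset.sum_le_sum fun t ht => ?_).trans hW)
    rw [abs_mul, abs_pow]
    exact mul_le_of_le_one_right (abs_nonneg _) (pow_le_one₀ (abs_nonneg _) (hy _ (hπ t ht)))
  have h1 := abs_sum_mul_exp_sub_le (M := M) hp hp1 fun i hi => hbound _ (hx i hi)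
  have h2 := abs_sum_mul_exp_sub_le (M := M) hp' hp1' fun i hi => hbound _ (hx' i hi)
  have h3 : |∑ m ∈ Finset.range M, (m.factorial : ℝ)⁻¹ *
          ∑ i ∈ I, p i * (∑ t ∈ T, b t * x i (π t) ^ e t) ^ m -
        ∑ m ∈ Finset.range M, (m.factorial : ℝ)⁻¹ *
          ∑ i ∈ J, p' i * (∑ t ∈ T, b t * x' i (π t) ^ e t) ^ m| ≤ Real.exp W * δ := by
    rw [← Finset.sum_sub_distrib]
    refine (Finset.abs_sum_le_sum_abs _ _).trans ?_
    refine le_trans ?_ (mul_le_mul_of_nonneg_right (Real.sum_le_exp_of_nonneg hW0 M) hδ0)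
    rw [Finset.sum_mul]
    refine Finset.sum_le_sum fun m hm => ?_
    rw [Finset.mem_range] at hm
    have h := abs_moment_sub_le (b := b) hπ hN hδ m 0 (by
      simp only [Pi.zero_apply, zero_mul, Finset.sum_const_zero, zero_add]
      exact (Nat.mul_le_mul_right N hm.le).trans hM)
    simp only [Pi.zero_apply, pow_zero, Finset.prod_const_one, one_mul] at h
    rw [← mul_sub, abs_mul, abs_of_nonneg (by positivity), div_eq_inv_mul, mul_assoc]
    refine mul_le_mul_of_nonneg_left (h.trans ?_) (by positivity)
    refine mul_le_mul_of_nonneg_right ?_ hδ0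
    exact pow_le_pow_left₀ (Finset.sum_nonneg fun _ _ => abs_nonneg _) hW m
  rw [abs_le] at *
  constructor <;> linarith [h1.1, h1.2, h2.1, h2.2, h3.1, h3.2]

end MomentComparison

/-! ### The independent random model and its comparison with the family -/

section RandomModel

variable (F) in
/-- The monic irreducible polynomials of degree at most `N`. -/
def primesLE (N : ℕ) : Finset F[X] :=
  Set.Finite.toFinset (s := {P : F[X] | IsMonicPrime P ∧ P.natDegree ≤ N}) <|
    (finite_natDegree_le (F := F) N).subset fun _ h => h.2

@[simp] theorem mem_primesLE {N : ℕ} {P : F[X]} :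
    P ∈ primesLE F N ↔ IsMonicPrime P ∧ P.natDegree ≤ N := by
  simp [primesLE]

theorem isMonicPrime_of_mem {N : ℕ} : ∀ P ∈ primesLE F N, IsMonicPrime P :=
  fun _ h => (mem_primesLE.1 h).1

/-- The probability that the random model of the residue symbol at `P` equals `e`. -/
def modelWeight (P : F[X]) (e : ℤ) : ℝ :=
  if e = 0 then 1 / (polyNorm P + 1) else polyNorm P / (2 * (polyNorm P + 1))

theorem modelWeight_nonneg (P : F[X]) (e : ℤ) : 0 ≤ modelWeight P e := by
  rw [modelWeight]; split_ifs <;> positivity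

theorem sum_modelWeight_mul (P : F[X]) (h : ℤ → ℝ) :
    ∑ e ∈ ({-1, 0, 1} : Finset ℤ), modelWeight P e * h e =
      1 / (polyNorm P + 1) * h 0 + polyNorm P / (polyNorm P + 1) * ((h 1 + h (-1)) / 2) := by
  rw [Finset.sum_insert (by decide), Finset.sum_insert (by decide), Finset.sum_singleton]
  simp only [modelWeight]
  norm_num
  field_simp
  ring

/-- Extension by zero of a sample point of the random model. -/
def modelEval (S : Finset F[X]) (i : ∀ P ∈ S, ℤ) (P : F[X]) : ℝ :=
  if h : P ∈ S then (i P h : ℝ) else 0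

/-- Independence: the weights are of product form, so the mean of a product of functions of single
coordinates factors. -/
theorem sum_model_eq_prod (S : Finset F[X]) (h : F[X] → ℝ → ℝ) :
    ∑ i ∈ S.pi (fun _ => ({-1, 0, 1} : Finset ℤ)),
      (∏ P ∈ S.attach, modelWeight P.1 (i P.1 P.2)) * ∏ P ∈ S, h P (modelEval S i P) =
    ∏ P ∈ S, ∑ e ∈ ({-1, 0, 1} : Finset ℤ), modelWeight P e * h P e := by
  rw [Finset.prod_sum]
  refine Finset.sum_congr rfl fun i _ => ?_
  rw [Finset.prod_mul_distrib]
  congr 1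
  rw [← Finset.prod_attach]
  refine Finset.prod_congr rfl fun P _ => ?_
  rw [modelEval, dif_pos P.2]

/-- The index set of the prime powers `P ^ j` of degree at most `N`. -/
def primePowers (S : Finset F[X]) (N : ℕ) : Finset (Σ _ : F[X], ℕ) :=
  S.sigma fun P => Finset.Icc 1 (N / P.natDegree)

/-- The coefficient of `χ (P ^ j)` in the logarithm of the partial Euler product to the `k`. -/
def primePowerCoeff (k : ℝ) (P : F[X]) (j : ℕ) : ℝ := k / (j * Real.sqrt (polyNorm P) ^ j)

/-- The mean of the factor at `P` of the `k`-th power of the partial Euler product over the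
random model. -/
def modelFactor (k : ℝ) (N : ℕ) (P : F[X]) : ℝ :=
  1 / (polyNorm P + 1) + polyNorm P / (polyNorm P + 1) *
    ((Real.exp (∑ j ∈ Finset.Icc 1 (N / P.natDegree), primePowerCoeff k P j) +
      Real.exp (∑ j ∈ Finset.Icc 1 (N / P.natDegree), primePowerCoeff k P j * (-1) ^ j)) / 2)

/-- Only prime powers `f = P ^ j` carry `Λ`, and there `Λ(f) / d(f) = 1 / j`. This puts the `k`-th
power in the form required by `abs_exp_moment_sub_le`. -/
theorem partialEuler_rpow (k : ℝ) {X : ℝ} (hX : 0 ≤ X) (D : F[X]) :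
    partialEuler X (1 / 2) D ^ k =
      Real.exp (∑ t ∈ primePowers (primesLE F ⌊X⌋₊) ⌊X⌋₊,
        primePowerCoeff k t.1 t.2 * (residueSymbol D t.1 : ℝ) ^ t.2) := by
  rw [partialEuler, ← Real.exp_mul, mul_comm, Finset.mul_sum]
  congr 1
  symm
  have hmem : ∀ t ∈ primePowers (primesLE F ⌊X⌋₊) ⌊X⌋₊, IsMonicPrime t.1 ∧ 1 ≤ t.2 ∧
      t.2 * t.1.natDegree ≤ ⌊X⌋₊ := by
    rintro ⟨P, j⟩ ht
    simp only [primePowers, Finset.mem_sigma, mem_primesLE, Finset.mem_Icc] at ht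
    exact ⟨ht.1.1, ht.2.1, (Nat.le_div_iff_mul_le ht.1.1.natDegree_pos).1 ht.2.2⟩
  refine Finset.sum_of_injOn (fun t => t.1 ^ t.2) ?_ ?_ ?_ ?_
  · rintro ⟨P, j⟩ ht ⟨Q, i⟩ ht' e
    obtain ⟨h1, h2, -⟩ := hmem _ ht
    obtain ⟨h1', h2', -⟩ := hmem _ ht'
    simp only at e h1 h2 h1' h2'
    have hPQ : P = Q := h1.eq_of_dvd h1' (h1.prime.dvd_of_dvd_pow
      ((dvd_pow_self P (by omega)).trans e.dvd))
    subst hPQ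
    have := congrArg natDegree e
    rw [natDegree_pow, natDegree_pow] at this
    rw [Nat.eq_of_mul_eq_mul_right h1.natDegree_pos this]
  · rintro ⟨P, j⟩ ht
    obtain ⟨h1, h2, h3⟩ := hmem _ ht
    simp only [monicLE, Set.Finite.coe_toFinset, Set.mem_ofPred_eq]
    refine ⟨h1.1.pow j, ?_⟩
    rw [natDegree_pow]
    exact (Nat.le_floor_iff hX).1 h3
  · intro f hf hnot
    simp only [monicLE, Set.Finite.mem_toFinset, Set.mem_ofPred_eq] at hf
    have : vonMangoldt f = 0 := by
      by_contra hne
      obtain ⟨P, hP, j, hj, rfl⟩ := exists_eq_pow_of_vonMangoldt_ne_zero hf.1 hne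
      refine hnot ⟨⟨P, j⟩, ?_, rfl⟩
      have hle : j * P.natDegree ≤ ⌊X⌋₊ := Nat.le_floor (by
        have := hf.2; rw [natDegree_pow] at this; exact this)
      simp only [primePowers, Finset.coe_sigma, Set.mem_sigma_iff, Finset.mem_coe, mem_primesLE,
        Finset.mem_Icc]
      exact ⟨⟨hP, le_trans (Nat.le_mul_of_pos_left _ hj) hle⟩, hj,
        (Nat.le_div_iff_mul_le hP.natDegree_pos).2 hle⟩
    simp [this]
  · rintro ⟨P, j⟩ ht
    obtain ⟨h1, h2, -⟩ := hmem _ ht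
    simp only at h1 h2
    simp only
    rw [vonMangoldt_pow h1 h2, chi_pow D h1, polyNorm_pow, natDegree_pow, primePowerCoeff,
      ← Real.sqrt_eq_rpow]
    have hd : (P.natDegree : ℝ) ≠ 0 := by exact_mod_cast h1.natDegree_pos.ne'
    have hj : (j : ℝ) ≠ 0 := by exact_mod_cast (by omega : j ≠ 0)
    have hs : Real.sqrt (polyNorm P) ≠ 0 :=
      (Real.sqrt_pos.2 (by exact_mod_cast polyNorm_pos P)).ne'
    push_cast
    rw [show Real.sqrt ((polyNorm P : ℝ) ^ j) = Real.sqrt (polyNorm P) ^ j by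
      rw [← Real.sqrt_sq (pow_nonneg (Real.sqrt_nonneg (polyNorm P : ℝ)) j), ← pow_mul, mul_comm j,
        pow_mul, Real.sq_sqrt (by positivity)]]
    field_simp

theorem sum_primePowers {S : Finset F[X]} {N : ℕ} (G : F[X] → ℕ → ℝ) :
    ∑ t ∈ primePowers S N, G t.1 t.2 = ∑ P ∈ S, ∑ j ∈ Finset.Icc 1 (N / P.natDegree), G P j :=
  Finset.sum_sigma _ _ _

/-- The abstract comparison with the uniform measure on square-frees on one side and the model on
the other; `M * ⌊X⌋₊ ≤ g` keeps every monomial within the range of `abs_expectation_prod_sub_le`. -/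
theorem abs_expectation_partialEuler_sub_le (hq : Odd (Fintype.card F)) (k : ℝ) {X : ℝ}
    (hX : 0 ≤ X) {g M : ℕ} (hg : 1 ≤ g) (hM : M * ⌊X⌋₊ ≤ g) {W : ℝ}
    (hW : ∑ P ∈ primesLE F ⌊X⌋₊, ∑ j ∈ Finset.Icc 1 (⌊X⌋₊ / P.natDegree),
      |primePowerCoeff k P j| ≤ W) :
    |expectation F (2 * g + 1) (fun D => partialEuler X (1 / 2) D ^ k) -
      ∏ P ∈ primesLE F ⌊X⌋₊, modelFactor k ⌊X⌋₊ P| ≤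
      Real.exp W * (2 * (Real.sqrt (3 / 2))⁻¹ ^ g) + 2 * (W ^ M / M.factorial * Real.exp W) := by
  set N := ⌊X⌋₊ with hN
  set S := primesLE F N with hSdef
  have hS : ∀ P ∈ S, IsMonicPrime P := isMonicPrime_of_mem
  have hcard : ((squarefreeMonic F (2 * g + 1)).card : ℝ) ≠ 0 := by
    obtain ⟨n, hn⟩ : ∃ n, 2 * g + 1 = n + 2 := ⟨2 * g - 1, by omega⟩
    have h3 : (3 : ℝ) ≤ Fintype.card F := by exact_mod_cast three_le_card hq
    rw [hn, card_squarefreeMonic_add_two]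
    have : (1 : ℝ) / Fintype.card F ≤ 1 / 3 := one_div_le_one_div_of_le (by norm_num) h3
    exact mul_ne_zero (by positivity) (by linarith)
  have hmodel : ∏ P ∈ S, modelFactor k N P =
      ∑ i ∈ S.pi (fun _ => ({-1, 0, 1} : Finset ℤ)),
        (∏ P ∈ S.attach, modelWeight P.1 (i P.1 P.2)) *
          Real.exp (∑ t ∈ primePowers S N, primePowerCoeff k t.1 t.2 * modelEval S i t.1 ^ t.2) := by
    have := sum_model_eq_prod S (fun P e =>
      Real.exp (∑ j ∈ Finset.Icc 1 (N / P.natDegree), primePowerCoeff k P j * e ^ j))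
    beta_reduce at this
    have e : ∀ i, ∏ P ∈ S, Real.exp (∑ j ∈ Finset.Icc 1 (N / P.natDegree),
        primePowerCoeff k P j * modelEval S i P ^ j) = Real.exp (∑ t ∈ primePowers S N,
          primePowerCoeff k t.1 t.2 * modelEval S i t.1 ^ t.2) := fun i => by
      rw [sum_primePowers (fun P j => primePowerCoeff k P j * modelEval S i P ^ j), Real.exp_sum]
    simp_rw [e] at this
    rw [this]
    refine Finset.prod_congr rfl fun P _ => ?_
    rw [sum_modelWeight_mul P (fun e => Real.exp (∑ j ∈ Finset.Icc 1 (N / P.natDegree),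
      primePowerCoeff k P j * (e : ℝ) ^ j)), modelFactor]
    have h0 : ∑ j ∈ Finset.Icc 1 (N / P.natDegree), primePowerCoeff k P j * ((0 : ℤ) : ℝ) ^ j = 0 :=
      Finset.sum_eq_zero fun j hj => by
        rw [Finset.mem_Icc] at hj
        rw [Int.cast_zero, zero_pow (by omega), mul_zero]
    simp only [h0]
    simp
  have hE : expectation F (2 * g + 1) (fun D => partialEuler X (1 / 2) D ^ k) =
      ∑ D ∈ squarefreeMonic F (2 * g + 1), ((squarefreeMonic F (2 * g + 1)).card : ℝ)⁻¹ *
        Real.exp (∑ t ∈ primePowers S N,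
          primePowerCoeff k t.1 t.2 * (residueSymbol D t.1 : ℝ) ^ t.2) := by
    rw [expectation, Finset.mul_sum]
    simp_rw [partialEuler_rpow k hX]
    rfl
  rw [hE, hmodel]
  refine abs_exp_moment_sub_le (S := S) (d := natDegree) (L := g) (N := N)
    (x := fun D P => (residueSymbol D P : ℝ)) ?_ ?_ hM ?_ ?_ ?_ ?_ ?_ ?_ ?_ ?_
  · rintro ⟨P, j⟩ ht
    exact (Finset.mem_sigma.1 ht).1
  · rintro ⟨P, j⟩ ht
    simp only [primePowers, Finset.mem_sigma, Finset.mem_Icc] at ht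
    exact (Nat.le_div_iff_mul_le (hS P ht.1).natDegree_pos).1 ht.2.2
  · intro a ha
    have h1 := abs_expectation_prod_sub_le hq hS a hg ha
    rw [expectation, Finset.mul_sum] at h1
    have h2 := sum_model_eq_prod S (fun P e => e ^ a P)
    rw [h2]
    convert h1 using 3
    refine Finset.prod_congr rfl fun P hP => ?_
    rw [sum_modelWeight_mul P (fun e => (e : ℝ) ^ a P), modelMoment]
    by_cases h0 : a P = 0
    · simp [h0]; field_simp; ring
    · by_cases he : Even (a P)
      · simp [h0, he, he.neg_one_pow]
      · have ho := Nat.not_even_iff_odd.1 he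
        simp [h0, he, ho.neg_one_pow]
  · intro _ _; positivity
  · intro i _; exact Finset.prod_nonneg fun P _ => modelWeight_nonneg _ _
  · rw [Finset.sum_const, nsmul_eq_mul, mul_inv_cancel₀ hcard]
  · have := sum_model_eq_prod S (fun _ _ => 1)
    simp only [Finset.prod_const_one, mul_one] at this
    rw [this]
    refine Finset.prod_eq_one fun P _ => ?_
    have := sum_modelWeight_mul P (fun _ => 1)
    simp only [mul_one] at this
    rw [this]; field_simp; ring
  · intro D _ P hP
    exact_mod_cast abs_residueSymbol_le hq (hS P hP) D
  · intro i hi P hP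
    rw [modelEval, dif_pos hP]
    have := Finset.mem_pi.1 hi P hP
    simp only [Finset.mem_insert, Finset.mem_singleton] at this
    rcases this with h | h | h <;> simp [h]
  · rw [sum_primePowers (fun P j => |primePowerCoeff k P j|)]
    exact hW

end RandomModel

/-! ### Prime polynomial theorem and Mertens' theorem -/

section PrimeSums

theorem pow_dvd_iff_le_count {P f : F[X]} (hP : IsMonicPrime P) (hf : f ≠ 0) (j : ℕ) :
    P ^ j ∣ f ↔ j ≤ (normalizedFactors f).count P := by
  rw [dvd_iff_normalizedFactors_le_normalizedFactors (hP.1.pow j).ne_zero hf,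
    hP.normalizedFactors_pow, Multiset.le_count_iff_replicate_le]

theorem isMonicPrime_of_mem_normalizedFactors {P f : F[X]} (h : P ∈ normalizedFactors f) :
    IsMonicPrime P :=
  ⟨by rw [← normalize_normalized_factor P h]
      exact monic_normalize (irreducible_of_normalized_factor P h).ne_zero,
    irreducible_of_normalized_factor P h⟩

theorem natDegree_eq_sum_count {f : F[X]} (hf : f.Monic) {N : ℕ} (hN : f.natDegree = N) :
    ∑ P ∈ primesLE F N, (normalizedFactors f).count P * P.natDegree = N := by
  have h1 : (normalizedFactors f).prod = f :=
    eq_of_monic_of_associated (by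
      have := monic_multiset_prod_of_monic (normalizedFactors f) id fun P hP =>
        (isMonicPrime_of_mem_normalizedFactors hP).1
      rwa [Multiset.map_id] at this) hf (prod_normalizedFactors hf.ne_zero)
  have h2 : ((normalizedFactors f).map natDegree).sum = N := by
    rw [← natDegree_multiset_prod _ (zero_notMem_normalizedFactors f), h1, hN]
  rw [Finset.sum_multiset_map_count] at h2
  refine Eq.trans (Eq.symm ?_) h2
  refine Finset.sum_subset (fun P hP => ?_) fun P _ hP => ?_
  · rw [Multiset.mem_toFinset] at hP
    rw [mem_primesLE, ← hN]
    exact ⟨isMonicPrime_of_mem_normalizedFactors hP,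
      natDegree_le_of_dvd (dvd_of_mem_normalizedFactors hP) hf.ne_zero⟩
  · rw [Multiset.mem_toFinset] at hP
    simp [Multiset.count_eq_zero_of_notMem hP]

theorem count_eq_card_filter {P f : F[X]} (hP : IsMonicPrime P) (hf : f.Monic) {N : ℕ}
    (hN : f.natDegree = N) : (normalizedFactors f).count P =
      ((Finset.Icc 1 (N / P.natDegree)).filter (fun j => P ^ j ∣ f)).card := by
  have hle : (normalizedFactors f).count P ≤ N / P.natDegree := by
    rw [Nat.le_div_iff_mul_le hP.natDegree_pos, ← natDegree_pow, ← hN]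
    exact natDegree_le_of_dvd ((pow_dvd_iff_le_count hP hf.ne_zero _).2 le_rfl) hf.ne_zero
  have : (Finset.Icc 1 (N / P.natDegree)).filter (fun j => P ^ j ∣ f) =
      Finset.Icc 1 ((normalizedFactors f).count P) := by
    ext j
    simp only [Finset.mem_filter, Finset.mem_Icc, pow_dvd_iff_le_count hP hf.ne_zero]
    omega
  rw [this, Nat.card_Icc]; omega

/-- Double counting of `∑ deg P` over monic `f` of degree `N` and prime powers `P ^ j ∣ f`: each `f`
contributes `N`, and `P ^ j` divides exactly the proportion `q ^ (-j deg P)` of them. -/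
theorem sum_natDegree_div (N : ℕ) : ∑ P ∈ primesLE F N, ∑ j ∈ Finset.Icc 1 (N / P.natDegree),
    (P.natDegree : ℝ) * ((Fintype.card F : ℝ) ^ (j * P.natDegree))⁻¹ = N := by
  have hq : (Fintype.card F : ℝ) ≠ 0 := by exact_mod_cast Fintype.card_ne_zero
  have h1 : ∑ f ∈ monicDeg F N, ∑ P ∈ primesLE F N, ∑ j ∈ Finset.Icc 1 (N / P.natDegree),
      (if P ^ j ∣ f then (P.natDegree : ℝ) else 0) = (Fintype.card F : ℝ) ^ N * N := by
    have : ∀ f ∈ monicDeg F N, ∑ P ∈ primesLE F N, ∑ j ∈ Finset.Icc 1 (N / P.natDegree),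
        (if P ^ j ∣ f then (P.natDegree : ℝ) else 0) = N := by
      intro f hf
      rw [mem_monicDeg] at hf
      have hN : ((∑ P ∈ primesLE F N, (normalizedFactors f).count P * P.natDegree : ℕ) : ℝ) = N := by
        rw [natDegree_eq_sum_count hf.1 hf.2]
      rw [← hN]
      push_cast
      refine Finset.sum_congr rfl fun P hP => ?_
      rw [count_eq_card_filter (mem_primesLE.1 hP).1 hf.1 hf.2, ← Finset.sum_filter,
        Finset.sum_const, nsmul_eq_mul]
    rw [Finset.sum_congr rfl this, Finset.sum_const, card_monicDeg, nsmul_eq_mul]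
    push_cast; rfl
  rw [Finset.sum_comm] at h1
  rw [← mul_right_inj' (pow_ne_zero N hq), ← h1, Finset.mul_sum]
  refine Finset.sum_congr rfl fun P hP => ?_
  rw [Finset.sum_comm, Finset.mul_sum]
  refine Finset.sum_congr rfl fun j hj => ?_
  have hP' := (mem_primesLE.1 hP).1
  rw [Finset.mem_Icc, Nat.le_div_iff_mul_le hP'.natDegree_pos] at hj
  rw [← Finset.sum_filter, Finset.sum_const, card_filter_dvd (hP'.1.pow j)
    (by rw [natDegree_pow]; exact hj.2), nsmul_eq_mul, natDegree_pow]
  push_cast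
  rw [pow_sub₀ _ hq hj.2]; ring

variable (F) in
/-- The sum of `Λ` over the monic polynomials of degree `m`. -/
def psi (m : ℕ) : ℝ := ∑ P ∈ (primesLE F m).filter (fun P => P.natDegree ∣ m), (P.natDegree : ℝ)

theorem sum_primes_eq_sum_psi (N : ℕ) (φ : ℕ → ℝ) :
    ∑ P ∈ primesLE F N, ∑ j ∈ Finset.Icc 1 (N / P.natDegree),
      (P.natDegree : ℝ) * φ (j * P.natDegree) = ∑ m ∈ Finset.Icc 1 N, psi F m * φ m := by
  have h1 : ∀ P ∈ primesLE F N, ∑ j ∈ Finset.Icc 1 (N / P.natDegree),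
      (P.natDegree : ℝ) * φ (j * P.natDegree) =
      ∑ m ∈ Finset.Icc 1 N, if P.natDegree ∣ m then (P.natDegree : ℝ) * φ m else 0 := by
    intro P hP
    have hd := (mem_primesLE.1 hP).1.natDegree_pos
    rw [← Finset.sum_filter]
    refine Finset.sum_bij (fun j _ => j * P.natDegree) ?_ ?_ ?_ (fun _ _ => rfl)
    · intro j hj
      rw [Finset.mem_Icc, Nat.le_div_iff_mul_le hd] at hj
      rw [Finset.mem_filter, Finset.mem_Icc]
      exact ⟨⟨Nat.mul_pos hj.1 hd, hj.2⟩, dvd_mul_left _ _⟩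
    · intro a _ b _ e
      exact Nat.eq_of_mul_eq_mul_right hd e
    · intro m hm
      rw [Finset.mem_filter, Finset.mem_Icc] at hm
      obtain ⟨⟨h1, h2⟩, c, rfl⟩ := hm
      refine ⟨c, ?_, mul_comm _ _⟩
      rw [Finset.mem_Icc, Nat.le_div_iff_mul_le hd, mul_comm c]
      exact ⟨Nat.pos_of_mul_pos_left h1, h2⟩
  rw [Finset.sum_congr rfl h1, Finset.sum_comm]
  refine Finset.sum_congr rfl fun m hm => ?_
  rw [Finset.mem_Icc] at hm
  rw [psi, Finset.sum_mul, ← Finset.sum_filter]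
  refine Finset.sum_congr ?_ fun _ _ => rfl
  ext P
  simp only [Finset.mem_filter, mem_primesLE]
  constructor
  · rintro ⟨⟨h1, h2⟩, h3⟩; exact ⟨⟨h1, Nat.le_of_dvd hm.1 h3⟩, h3⟩
  · rintro ⟨⟨h1, h2⟩, h3⟩; exact ⟨⟨h1, h2.trans hm.2⟩, h3⟩

/-- The prime polynomial theorem in exact form: `∑ psi m / q ^ m` over `1 ≤ m ≤ N` equals `N` for
every `N`, so consecutive differences give `psi m = q ^ m`. -/
theorem psi_eq (m : ℕ) (hm : 1 ≤ m) : psi F m = (Fintype.card F : ℝ) ^ m := by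
  have hq : (Fintype.card F : ℝ) ≠ 0 := by exact_mod_cast Fintype.card_ne_zero
  have h : ∀ N : ℕ, ∑ m ∈ Finset.Icc 1 N, psi F m * ((Fintype.card F : ℝ) ^ m)⁻¹ = N := fun N => by
    rw [← sum_primes_eq_sum_psi N (fun m => ((Fintype.card F : ℝ) ^ m)⁻¹), sum_natDegree_div]
  obtain ⟨n, rfl⟩ : ∃ n, m = n + 1 := ⟨m - 1, by omega⟩
  have h1 := h (n + 1)
  rw [Finset.sum_Icc_succ_top (by omega), h n] at h1
  push_cast at h1
  rw [add_right_inj] at h1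
  rwa [mul_inv_eq_one₀ (pow_ne_zero _ hq)] at h1

theorem sum_primes_eq (N : ℕ) (φ : ℕ → ℝ) :
    ∑ P ∈ primesLE F N, ∑ j ∈ Finset.Icc 1 (N / P.natDegree),
      (P.natDegree : ℝ) * φ (j * P.natDegree) =
      ∑ m ∈ Finset.Icc 1 N, (Fintype.card F : ℝ) ^ m * φ m := by
  rw [sum_primes_eq_sum_psi]
  exact Finset.sum_congr rfl fun m hm => by rw [psi_eq m (Finset.mem_Icc.1 hm).1]

theorem sum_primes_le (N : ℕ) {φ : ℕ → ℝ} (hφ : ∀ m, 0 ≤ φ m) :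
    ∑ P ∈ primesLE F N, (P.natDegree : ℝ) * φ P.natDegree ≤
      ∑ m ∈ Finset.Icc 1 N, (Fintype.card F : ℝ) ^ m * φ m := by
  rw [← sum_primes_eq]
  refine Finset.sum_le_sum fun P hP => ?_
  rw [mem_primesLE] at hP
  have h1 : 1 ∈ Finset.Icc 1 (N / P.natDegree) := by
    rw [Finset.mem_Icc, Nat.le_div_iff_mul_le hP.1.natDegree_pos]
    exact ⟨le_rfl, by simpa using hP.2⟩
  refine le_trans ?_ (Finset.single_le_sum (fun j _ => by have := hφ (j * P.natDegree); positivity) h1)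
  simp

theorem sqrt_polyNorm (P : F[X]) :
    Real.sqrt (polyNorm P) = Real.sqrt (Fintype.card F) ^ P.natDegree := by
  rw [polyNorm, ← Real.sqrt_sq (pow_nonneg (Real.sqrt_nonneg _) _), ← pow_mul,
    mul_comm P.natDegree, pow_mul, Real.sq_sqrt (by positivity)]
  push_cast; rfl

/-- By the prime polynomial theorem the sum is at most `∑ q ^ (-m / 2)`, dominated by the geometric
series of ratio `2 / 3`. The extra weight `deg P` is what turns bounds of size `deg P / N` into
errors `O(1 / N)` later. -/
theorem sum_natDegree_mul_le (hq : Odd (Fintype.card F)) (N : ℕ) :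
    ∑ P ∈ primesLE F N, (P.natDegree : ℝ) * (Real.sqrt (polyNorm P) ^ 3)⁻¹ ≤ 2 := by
  have hr := three_halves_le_sqrt_card hq
  have h := sum_primes_le (F := F) N
    (φ := fun m => ((Real.sqrt (Fintype.card F) ^ m) ^ 3)⁻¹) (fun m => by positivity)
  simp_rw [sqrt_polyNorm]
  refine h.trans ?_
  have hg : ∀ N : ℕ, ∑ j ∈ Finset.Icc 1 N, ((2 : ℝ) / 3) ^ j = 2 - 2 * (2 / 3) ^ N := by
    intro N
    induction N with
    | zero => simp
    | succ N ih => rw [Finset.sum_Icc_succ_top (by omega), ih]; ring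
  have h2 : ∑ j ∈ Finset.Icc 1 N, ((2 : ℝ) / 3) ^ j ≤ 2 := by
    rw [hg]
    have : (0 : ℝ) ≤ (2 / 3) ^ N := by positivity
    linarith
  refine le_trans (Finset.sum_le_sum fun m _ => ?_) h2
  have hsq : (Fintype.card F : ℝ) = Real.sqrt (Fintype.card F) ^ 2 :=
    (Real.sq_sqrt (by positivity)).symm
  set r := Real.sqrt (Fintype.card F)
  rw [hsq, ← pow_mul, ← pow_mul, mul_comm 2, mul_comm m 3, show 3 * m = m * 2 + m by ring, pow_add,
    mul_inv, mul_inv_cancel_left₀ (by positivity), ← inv_pow]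
  refine pow_le_pow_left₀ (by positivity) ?_ m
  rw [inv_le_comm₀ (by linarith) (by norm_num)]; linarith

theorem three_le_polyNorm (hq : Odd (Fintype.card F)) {P : F[X]} (hP : IsMonicPrime P) :
    (3 : ℝ) ≤ polyNorm P := by
  have h : 3 ≤ polyNorm P := (three_le_card hq).trans
    (Nat.le_self_pow hP.natDegree_pos.ne' _)
  exact_mod_cast h

theorem sum_natDegree_mul_sq_le (hq : Odd (Fintype.card F)) (N : ℕ) :
    ∑ P ∈ primesLE F N, (P.natDegree : ℝ) * ((1 / polyNorm P : ℝ)) ^ 2 ≤ 2 := by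
  refine (Finset.sum_le_sum fun P hP => ?_).trans (sum_natDegree_mul_le hq N)
  have h3 := three_le_polyNorm hq (mem_primesLE.1 hP).1
  refine mul_le_mul_of_nonneg_left ?_ (by positivity)
  have hs : (1 : ℝ) ≤ Real.sqrt (polyNorm P) := Real.one_le_sqrt.2 (by linarith)
  have e : (polyNorm P : ℝ) ^ 2 = Real.sqrt (polyNorm P) ^ 4 := by
    rw [show 4 = 2 * 2 by norm_num, pow_mul, Real.sq_sqrt (by positivity)]
  rw [one_div, inv_pow, e]
  exact inv_anti₀ (by positivity) (pow_le_pow_right₀ hs (by norm_num))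

theorem abs_log_add_sum_le {x : ℝ} (hx : |x| < 1) (J : ℕ) :
    |Real.log (1 - x) + ∑ j ∈ Finset.Icc 1 J, x ^ j / j| ≤
      |x| ^ (J + 1) / ((J + 1) * (1 - |x|)) := by
  have h := Real.hasSum_pow_div_log_of_abs_lt_one hx
  have h1 : ∑ j ∈ Finset.Icc 1 J, x ^ j / j =
      ∑ i ∈ Finset.range J, x ^ (i + 1) / ((i : ℝ) + 1) := by
    rw [Finset.range_eq_Ico, Finset.sum_Ico_add' (fun i : ℕ => x ^ i / (i : ℝ)) 0 J 1 |>.symm.trans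
      (Finset.sum_congr rfl fun i _ => by push_cast; rfl) |>.symm]
    rfl
  have h2 := h.summable.sum_add_tsum_nat_add J
  rw [h.tsum_eq] at h2
  have h3 : Real.log (1 - x) + ∑ j ∈ Finset.Icc 1 J, x ^ j / j =
      -∑' i : ℕ, x ^ (i + J + 1) / (((i + J : ℕ) : ℝ) + 1) := by rw [h1]; linarith
  rw [h3, abs_neg, ← Real.norm_eq_abs]
  have hg : HasSum (fun i : ℕ => |x| ^ i * (|x| ^ (J + 1) / (J + 1)))
      ((1 - |x|)⁻¹ * (|x| ^ (J + 1) / (J + 1))) :=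
    (hasSum_geometric_of_lt_one (abs_nonneg x) hx).mul_right _
  refine (tsum_of_norm_bounded hg fun i => ?_).trans (le_of_eq ?_)
  · rw [Real.norm_eq_abs, abs_div, abs_pow, add_assoc, pow_add, mul_div_assoc]
    refine mul_le_mul_of_nonneg_left ?_ (by positivity)
    refine div_le_div_of_nonneg_left (by positivity) (by positivity) ?_
    rw [abs_of_nonneg (by positivity)]; push_cast; linarith [Nat.cast_nonneg (α := ℝ) i]
  · rw [mul_comm (J + 1 : ℝ), ← div_div, ← div_eq_inv_mul, div_right_comm]

/-- Mertens' theorem with rate. The logarithmic series cut at `j deg P ≤ N` sum exactly to the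
harmonic number of `N`; the discarded tails cost at most `3 / N` and the distance of the harmonic
number from `log N + γ` at most `1 / N`. -/
theorem sum_log_polyNorm (hq : Odd (Fintype.card F)) {N : ℕ} (hN : 1 ≤ N) :
    |∑ P ∈ primesLE F N, Real.log (1 - 1 / polyNorm P) + Real.log N +
      Real.eulerMascheroniConstant| ≤ 4 / N := by
  have hN0 : (0 : ℝ) < N := by exact_mod_cast hN
  have h1 : ∑ P ∈ primesLE F N, ∑ j ∈ Finset.Icc 1 (N / P.natDegree),
      (1 / (polyNorm P : ℝ)) ^ j / j = (harmonic N : ℝ) := by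
    have := sum_primes_eq (F := F) N (fun m => ((Fintype.card F : ℝ) ^ m)⁻¹ / m)
    have hqne : (Fintype.card F : ℝ) ≠ 0 := by exact_mod_cast Fintype.card_ne_zero
    rw [harmonic_eq_sum_Icc]
    push_cast
    rw [← Finset.sum_congr rfl fun (m : ℕ) _ => (show (Fintype.card F : ℝ) ^ m *
      (((Fintype.card F : ℝ) ^ m)⁻¹ / (m : ℝ)) = (m : ℝ)⁻¹ by
        rw [mul_div_assoc', mul_inv_cancel₀ (pow_ne_zero _ hqne), one_div]), ← this]
    refine Finset.sum_congr rfl fun P hP => Finset.sum_congr rfl fun j _ => ?_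
    have hd : (P.natDegree : ℝ) ≠ 0 := by exact_mod_cast (mem_primesLE.1 hP).1.natDegree_pos.ne'
    rw [polyNorm]
    push_cast
    rw [one_div, inv_pow, ← pow_mul, mul_comm P.natDegree j]
    field_simp
  have h2 : |∑ P ∈ primesLE F N, Real.log (1 - 1 / polyNorm P) + harmonic N| ≤ 3 / N := by
    rw [← h1, ← Finset.sum_add_distrib]
    refine (Finset.abs_sum_le_sum_abs _ _).trans ?_
    have h3 : ∑ P ∈ primesLE F N, (3 / 2 / N : ℝ) * ((P.natDegree : ℝ) * ((1 / polyNorm P : ℝ)) ^ 2) ≤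
        3 / N := by
      rw [← Finset.mul_sum]
      refine (mul_le_mul_of_nonneg_left (sum_natDegree_mul_sq_le hq N) (by positivity)).trans
        (le_of_eq (by ring))
    refine (Finset.sum_le_sum fun P hP => ?_).trans h3
    rw [mem_primesLE] at hP
    have hp3 := three_le_polyNorm hq hP.1
    set x : ℝ := 1 / polyNorm P with hx
    have hx0 : 0 < x := by positivity
    have hx3 : x ≤ 1 / 3 := one_div_le_one_div_of_le (by norm_num) hp3
    have hxa : |x| = x := abs_of_pos hx0
    refine (abs_log_add_sum_le (by rw [hxa]; linarith) _).trans ?_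
    rw [hxa]
    set J := N / P.natDegree with hJ
    have hJ1 : 1 ≤ J := (Nat.le_div_iff_mul_le hP.1.natDegree_pos).2 (by simpa using hP.2)
    -- The tail starts at exponent `J + 1 ≥ N / deg P`, so its denominator supplies the factor `deg
    -- P / N`.
    have hJN : (N : ℝ) ≤ P.natDegree * (J + 1) := by
      exact_mod_cast (Nat.lt_mul_div_succ N hP.1.natDegree_pos).le
    have hpow : x ^ (J + 1) ≤ x ^ 2 := pow_le_pow_of_le_one hx0.le (by linarith) (by omega)
    have hJ0 : (0 : ℝ) < J + 1 := by positivity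
    rw [div_le_iff₀ (mul_pos hJ0 (by linarith))]
    have e : (3 / 2 / N : ℝ) * ((P.natDegree : ℝ) * x ^ 2) * ((J + 1) * (1 - x)) =
        x ^ 2 * ((P.natDegree * (J + 1)) / N) * (3 / 2 * (1 - x)) := by ring
    rw [e]
    have h4 : 1 ≤ (P.natDegree * ((J : ℝ) + 1)) / N := by rw [le_div_iff₀ hN0]; linarith
    have h5 : 1 ≤ 3 / 2 * (1 - x) := by linarith
    have h6 : x ^ 2 ≤ x ^ 2 * ((P.natDegree * ((J : ℝ) + 1)) / N) :=
      le_mul_of_one_le_right (by positivity) h4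
    exact hpow.trans (h6.trans (le_mul_of_one_le_right (by positivity) h5))
  have h3 := Real.eulerMascheroniSeq_lt_eulerMascheroniConstant N
  have h4 := Real.eulerMascheroniConstant_lt_eulerMascheroniSeq' N
  rw [Real.eulerMascheroniSeq] at h3
  rw [Real.eulerMascheroniSeq', if_neg (by omega)] at h4
  have h5 : Real.log (N + 1) ≤ Real.log N + 1 / N := by
    have : Real.log (N + 1) = Real.log N + Real.log (1 + 1 / N) := by
      rw [← Real.log_mul hN0.ne' (by positivity)]; congr 1; field_simp
    rw [this]
    have := Real.log_le_sub_one_of_pos (show (0 : ℝ) < 1 + 1 / N by positivity)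
    linarith
  have e4 : (4 : ℝ) / N = 3 / N + 1 / N := by ring
  rw [e4]
  rw [abs_le] at h2 ⊢
  constructor <;> linarith [h2.1, h2.2]

/-- Grouped by degree, the sum is `|k| ∑ q ^ (m / 2) / m`. This is the sup bound `W` on the
exponent; it has to be of smaller order than `g`, and this is where the restriction on `X` enters.
-/
theorem sum_abs_primePowerCoeff_le (hq : Odd (Fintype.card F)) (k : ℝ) (N : ℕ) :
    ∑ P ∈ primesLE F N, ∑ j ∈ Finset.Icc 1 (N / P.natDegree), |primePowerCoeff k P j| ≤
      |k| * (N * Real.sqrt (Fintype.card F) ^ N) := by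
  have hr := three_halves_le_sqrt_card hq
  have hsq : (Fintype.card F : ℝ) = Real.sqrt (Fintype.card F) ^ 2 :=
    (Real.sq_sqrt (by positivity)).symm
  have h := sum_primes_eq (F := F) N (fun m => (Real.sqrt (Fintype.card F) ^ m)⁻¹ / m)
  have h1 : ∑ P ∈ primesLE F N, ∑ j ∈ Finset.Icc 1 (N / P.natDegree), |primePowerCoeff k P j| =
      |k| * ∑ m ∈ Finset.Icc 1 N, (Fintype.card F : ℝ) ^ m *
        ((Real.sqrt (Fintype.card F) ^ m)⁻¹ / m) := by
    rw [← h, Finset.mul_sum]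
    refine Finset.sum_congr rfl fun P hP => ?_
    rw [Finset.mul_sum]
    refine Finset.sum_congr rfl fun j _ => ?_
    have hd : (P.natDegree : ℝ) ≠ 0 := by exact_mod_cast (mem_primesLE.1 hP).1.natDegree_pos.ne'
    rw [primePowerCoeff, abs_div, abs_of_nonneg (a := (j : ℝ) * _) (by positivity), sqrt_polyNorm,
      ← pow_mul, mul_comm P.natDegree j]
    push_cast
    field_simp
  rw [h1]
  refine mul_le_mul_of_nonneg_left ?_ (abs_nonneg k)
  refine (Finset.sum_le_card_nsmul _ _ (Real.sqrt (Fintype.card F) ^ N) fun m hm => ?_).trans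
    (by simp)
  rw [Finset.mem_Icc] at hm
  rw [hsq]
  set r := Real.sqrt (Fintype.card F)
  rw [Real.sqrt_sq (by positivity), ← pow_mul, mul_comm 2 m, pow_mul, pow_two, mul_div_assoc',
    mul_inv_cancel_right₀ (by positivity)]
  exact (div_le_self (by positivity) (by exact_mod_cast hm.1)).trans
    (pow_le_pow_right₀ (by linarith) hm.2)

end PrimeSums

/-! ### Local means at a single prime -/

section LocalFactors

/-- The value of the divisor function `τ_k` at the `a`-th power of a prime. -/
def tauCoeff (k : ℝ) (a : ℕ) : ℝ := (ascPochhammer ℝ a).eval k / a.factorial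

theorem hasSum_tauCoeff (k : ℝ) {y : ℝ} (hy : |y| < 1) :
    HasSum (fun a => tauCoeff k a * y ^ a) ((1 - y) ^ (-k)) := by
  have h := (Real.one_div_one_sub_rpow_hasFPowerSeriesOnBall_zero k).hasSum (y := y)
    (by simpa [enorm_eq_nnnorm, ← NNReal.coe_lt_coe] using hy)
  rw [zero_add] at h
  have hy1 : 0 < 1 - y := by linarith [(abs_lt.1 hy).2]
  rw [Real.rpow_neg hy1.le, ← one_div]
  refine h.congr_fun fun a => ?_
  rw [FormalMultilinearSeries.ofScalars_apply_eq, smul_eq_mul, ← Ring.multichoose_eq, tauCoeff]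
  congr 1
  have h1 := Ring.factorial_nsmul_multichoose_eq_ascPochhammer k a
  rw [ascPochhammer_smeval_eq_eval, nsmul_eq_mul] at h1
  rw [← h1, mul_div_cancel_left₀]
  exact_mod_cast a.factorial_ne_zero

theorem tauCoeff_zero (k : ℝ) : tauCoeff k 0 = 1 := by simp [tauCoeff]

theorem tauCoeff_two (k : ℝ) : tauCoeff k 2 = k * (k + 1) / 2 := by
  simp [tauCoeff, ascPochhammer_succ_right, Nat.factorial]

/-- Averaging the series at `y` and `-y` keeps the even powers. On the model side this is the
average over the two signs of the symbol. -/
theorem hasSum_tauCoeff_even (k : ℝ) {y : ℝ} (hy : |y| < 1) :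
    HasSum (fun i => tauCoeff k (2 * i) * y ^ (2 * i))
      (((1 - y) ^ (-k) + (1 + y) ^ (-k)) / 2) := by
  have h1 := hasSum_tauCoeff k hy
  have h2 := hasSum_tauCoeff k (y := -y) (by rwa [abs_neg])
  rw [sub_neg_eq_add] at h2
  have hs : Summable fun i => tauCoeff k (2 * i) * y ^ (2 * i) :=
    h1.summable.comp_injective (i := fun i : ℕ => 2 * i) fun a b h => by simpa using h
  have h3 := (h1.add h2).div_const 2
  have hz : ∀ n ∉ Set.range (fun i : ℕ => 2 * i),
      (tauCoeff k n * y ^ n + tauCoeff k n * (-y) ^ n) / 2 = 0 := by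
    intro n hn
    have hodd : Odd n := by
      rw [← Nat.not_even_iff_odd]
      rintro ⟨c, hc⟩
      exact hn ⟨c, by simp only; omega⟩
    rw [hodd.neg_pow]; ring
  have h4 := (Function.Injective.hasSum_iff (g := fun i : ℕ => 2 * i)
    (fun a b h => by simpa using h) hz).2 h3
  convert h4 using 2 with i
  simp only [Function.comp]
  rw [(even_two_mul i).neg_pow]; ring

theorem exists_abs_tsum_sub_le {c : ℕ → ℝ} {r : ℝ} (hr : 0 < r)
    (hc : Summable fun n => c n * r ^ n) :
    ∃ C, 0 ≤ C ∧ ∀ x s, 0 ≤ x → x ≤ r → HasSum (fun n => c n * x ^ n) s →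
      |s - c 0 - c 1 * x| ≤ C * x ^ 2 := by
  have hc2 : Summable fun n => |c (n + 2)| * r ^ n := by
    have h1 := ((summable_nat_add_iff 2).2 hc.abs).mul_right (r ^ 2)⁻¹
    refine h1.congr fun n => ?_
    rw [abs_mul, abs_of_nonneg (pow_nonneg hr.le _), pow_add]
    field_simp
  refine ⟨∑' n, |c (n + 2)| * r ^ n, tsum_nonneg fun n => by positivity, fun x s hx hxr hs => ?_⟩
  have h2 := (hasSum_nat_add_iff' 2).2 hs
  simp only [Finset.sum_range_succ, Finset.sum_range_zero, zero_add, pow_zero, mul_one, pow_one]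
    at h2
  rw [sub_sub, ← h2.tsum_eq, ← Real.norm_eq_abs]
  refine tsum_of_norm_bounded (hc2.hasSum.mul_right (x ^ 2)) fun n => ?_
  rw [Real.norm_eq_abs, abs_mul, abs_of_nonneg (pow_nonneg hx _), pow_add, ← mul_assoc]
  gcongr

/-- Passes from `G = 1 + a x + O(x²)` to `log G = a x + O(x²)` uniformly on `0 < x ≤ 1 / 3`,
including values of `x` for which the expansion does not keep `G` away from `0`; the lower bound `x
/ 2` covers those. -/
theorem exists_abs_log_sub_le (a C : ℝ) : ∃ C', 0 ≤ C' ∧ ∀ x G : ℝ, 0 < x → x ≤ 1 / 3 →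
    |G - 1 - a * x| ≤ C * x ^ 2 → x / 2 ≤ G → |Real.log G - a * x| ≤ C' * x ^ 2 := by
  set A := |a| + |C| with hA
  have hA0 : 0 ≤ A := by positivity
  refine ⟨A ^ 2 + |C| + 20 * A ^ 3, by positivity, fun x G hx hx3 hG hGx => ?_⟩
  have hC : C * x ^ 2 ≤ |C| * x ^ 2 := by gcongr; exact le_abs_self C
  have hax : |a * x| ≤ |a| * x := by rw [abs_mul, abs_of_pos hx]
  have hu : |G - 1| ≤ A * x := by
    have h1 : |G - 1| ≤ |G - 1 - a * x| + |a * x| := by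
      have := abs_add_le (G - 1 - a * x) (a * x)
      rwa [sub_add_cancel] at this
    have h2 : |C| * x ^ 2 ≤ |C| * x := by
      have := abs_nonneg C
      gcongr; nlinarith
    rw [hA]; linarith
  have hGpos : 0 < G := by linarith
  -- For small `A * x` the logarithm is expanded. Otherwise `x > 1 / (2 A)`, so `log G` is bounded
  -- in terms of `A` and `1 ≤ 4 (A x)²` turns a constant into a multiple of `x²`.
  rcases le_or_gt (A * x) (1 / 2) with h | h
  · have h1 := abs_log_add_sum_le (x := -(G - 1)) (by rw [abs_neg]; linarith) 1
    simp only [Finset.Icc_self, Finset.sum_singleton, pow_one, Nat.cast_one, div_one, abs_neg,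
      sub_neg_eq_add, add_sub_cancel] at h1
    have h2 : |G - 1| ^ (1 + 1) / ((1 + 1) * (1 - |G - 1|)) ≤ A ^ 2 * x ^ 2 := by
      rw [← mul_pow]
      have h3 : |G - 1| ^ (1 + 1) ≤ (A * x) ^ 2 := pow_le_pow_left₀ (abs_nonneg _) hu 2
      exact (div_le_self (by positivity) (by linarith)).trans h3
    have h4 : Real.log G - a * x = (Real.log G + -(G - 1)) + (G - 1 - a * x) := by ring
    rw [h4]
    refine (abs_add_le _ _).trans ?_
    have : 0 ≤ 20 * A ^ 3 * x ^ 2 := by positivity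
    nlinarith
  · have hApos : 0 < A := by
      by_contra hn
      have : A = 0 := le_antisymm (not_lt.1 hn) hA0
      rw [this] at h; norm_num at h
    have hlog1 : Real.log G ≤ A := by
      have h1 := Real.log_le_sub_one_of_pos hGpos
      have h2 := (le_abs_self _).trans hu
      nlinarith
    have hlog2 : -(4 * A) ≤ Real.log G := by
      have h1 : Real.log (x / 2) ≤ Real.log G := Real.log_le_log (by positivity) hGx
      have h2 := Real.log_le_sub_one_of_pos (show 0 < (x / 2)⁻¹ by positivity)
      rw [Real.log_inv] at h2
      have h3 : (x / 2)⁻¹ ≤ 4 * A := by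
        rw [inv_le_comm₀ (by positivity) (by positivity), inv_le_iff_one_le_mul₀ (by positivity)]
        nlinarith
      linarith
    have h5 : |Real.log G - a * x| ≤ 5 * A := by
      have h1 : |Real.log G| ≤ 4 * A := abs_le.2 ⟨hlog2, by linarith⟩
      have h2 : |a * x| ≤ A := hax.trans (by rw [hA]; nlinarith [abs_nonneg a, abs_nonneg C])
      exact (abs_sub _ _).trans (by linarith)
    have h6 : 5 * A ≤ 20 * A ^ 3 * x ^ 2 := by
      have : 1 / 4 ≤ (A * x) ^ 2 := by nlinarith
      calc 5 * A = 20 * A * (1 / 4) := by ring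
        _ ≤ 20 * A * (A * x) ^ 2 := by gcongr
        _ = _ := by ring
    have : 0 ≤ (A ^ 2 + |C|) * x ^ 2 := by positivity
    nlinarith

/-- The mean over the random model of the `k`-th power of the full Euler factor at `P`. -/
def eulerMean (k : ℝ) (P : F[X]) : ℝ :=
  1 / (polyNorm P + 1) + polyNorm P / (polyNorm P + 1) *
    (((1 - (Real.sqrt (polyNorm P))⁻¹) ^ (-k) + (1 + (Real.sqrt (polyNorm P))⁻¹) ^ (-k)) / 2)

theorem inv_sqrt_polyNorm (hq : Odd (Fintype.card F)) {P : F[X]} (hP : IsMonicPrime P) :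
    0 < (Real.sqrt (polyNorm P))⁻¹ ∧ (Real.sqrt (polyNorm P))⁻¹ ≤ (Real.sqrt 3)⁻¹ ∧
      (Real.sqrt (polyNorm P))⁻¹ ≤ 3 / 5 ∧
      (Real.sqrt (polyNorm P))⁻¹ ^ 2 = 1 / (polyNorm P : ℝ) := by
  have h3 := three_le_polyNorm hq hP
  have h1 : (5 : ℝ) / 3 ≤ Real.sqrt (polyNorm P) :=
    Real.le_sqrt_of_sq_le (by norm_num; linarith)
  have h2 : (Real.sqrt 3) ≤ Real.sqrt (polyNorm P) := Real.sqrt_le_sqrt h3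
  refine ⟨by positivity, inv_anti₀ (by positivity) h2, ?_, ?_⟩
  · rw [inv_le_comm₀ (by linarith) (by norm_num)]; linarith
  · rw [inv_pow, Real.sq_sqrt (by positivity), one_div]

theorem localTerm_eq (k : ℝ) {P : F[X]} (hP : IsMonicPrime P) (i : ℕ) :
    localTerm k P i = tauCoeff k (2 * (i + 1)) * (Real.sqrt (polyNorm P))⁻¹ ^ (2 * (i + 1)) := by
  rw [localTerm, tau_pow k hP (by omega), tauCoeff, pow_mul _ 2, inv_pow,
    Real.sq_sqrt (by positivity), inv_pow, div_eq_mul_inv]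

theorem hasSum_localTerm (hq : Odd (Fintype.card F)) (k : ℝ) {P : F[X]} (hP : IsMonicPrime P) :
    HasSum (localTerm k P) (((1 - (Real.sqrt (polyNorm P))⁻¹) ^ (-k) +
      (1 + (Real.sqrt (polyNorm P))⁻¹) ^ (-k)) / 2 - 1) := by
  obtain ⟨h1, -, h2, -⟩ := inv_sqrt_polyNorm hq hP
  have h := (hasSum_nat_add_iff' 1).2 (hasSum_tauCoeff_even k
    (y := (Real.sqrt (polyNorm P))⁻¹) (by rw [abs_of_pos h1]; linarith))
  simp only [Finset.sum_range_one, mul_zero, pow_zero, mul_one, tauCoeff_zero] at h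
  exact h.congr_fun fun i => localTerm_eq k hP i

theorem localFactor_eq (hq : Odd (Fintype.card F)) (k : ℝ) {P : F[X]} (hP : IsMonicPrime P) :
    localFactor k P = (1 - 1 / (polyNorm P : ℝ)) ^ (k * (k + 1) / 2) * eulerMean k P := by
  have h3 := three_le_polyNorm hq hP
  rw [localFactor, (hasSum_localTerm hq k hP).tsum_eq, eulerMean]
  congr 1
  have : (0 : ℝ) < polyNorm P := by linarith
  field_simp
  ring

/-- The model vanishes at `P` with probability `1 / (p + 1)`, and then the Euler factor equals `1`;
this alone gives the bound. -/
theorem half_le_model_mean {p m : ℝ} (hp : 3 ≤ p) (hm : 0 ≤ m) :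
    1 / p / 2 ≤ 1 / (p + 1) + p / (p + 1) * m := by
  have h1 : 0 ≤ p / (p + 1) * m := by positivity
  have h2 : 1 / p / 2 ≤ 1 / (p + 1) := by
    rw [div_div]; exact one_div_le_one_div_of_le (by linarith) (by linarith)
  linarith

theorem half_le_eulerMean (hq : Odd (Fintype.card F)) (k : ℝ) {P : F[X]} (hP : IsMonicPrime P) :
    1 / (polyNorm P : ℝ) / 2 ≤ eulerMean k P := by
  obtain ⟨h1, -, h2, -⟩ := inv_sqrt_polyNorm hq hP
  refine half_le_model_mean (three_le_polyNorm hq hP) ?_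
  have := Real.rpow_nonneg (show 0 ≤ 1 - (Real.sqrt (polyNorm P))⁻¹ by linarith) (-k)
  have := Real.rpow_nonneg (show 0 ≤ 1 + (Real.sqrt (polyNorm P))⁻¹ by linarith) (-k)
  linarith

theorem half_le_modelFactor (hq : Odd (Fintype.card F)) (k : ℝ) (N : ℕ) {P : F[X]}
    (hP : IsMonicPrime P) : 1 / (polyNorm P : ℝ) / 2 ≤ modelFactor k N P :=
  half_le_model_mean (three_le_polyNorm hq hP) (by positivity)

theorem abs_model_mean_sub_le {p m a C : ℝ} (hp : 3 ≤ p)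
    (hm : |m - 1 - a * (1 / p)| ≤ C * (1 / p) ^ 2) :
    |1 / (p + 1) + p / (p + 1) * m - 1 - a * (1 / p)| ≤ (C + |a|) * (1 / p) ^ 2 := by
  have hp0 : 0 < p := by linarith
  have e : 1 / (p + 1) + p / (p + 1) * m - 1 - a * (1 / p) =
      p / (p + 1) * (m - 1 - a * (1 / p)) - a * (1 / (p * (p + 1))) := by field_simp; ring
  rw [e]
  refine (abs_sub _ _).trans ?_
  rw [abs_mul, abs_mul, abs_of_pos (show 0 < p / (p + 1) by positivity),
    abs_of_pos (show 0 < 1 / (p * (p + 1)) by positivity), add_mul]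
  have h1 : p / (p + 1) ≤ 1 := by rw [div_le_one (by positivity)]; linarith
  have h2 : 1 / (p * (p + 1)) ≤ (1 / p) ^ 2 := by
    rw [div_pow, one_pow, pow_two]
    exact one_div_le_one_div_of_le (by positivity) (by nlinarith)
  refine add_le_add ?_ (mul_le_mul_of_nonneg_left h2 (abs_nonneg a))
  exact (mul_le_of_le_one_left (abs_nonneg _) h1).trans hm

/-- As a power series in `1 / |P|`, the average over signs has linear coefficient `τ_k(P²) = k (k +
1) / 2`. The radius `1 / 3` is admissible for every prime because `|P| ≥ 3`. -/
theorem exists_abs_log_eulerMean_sub_le (hq : Odd (Fintype.card F)) (k : ℝ) :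
    ∃ C, 0 ≤ C ∧ ∀ P : F[X], IsMonicPrime P →
      |Real.log (eulerMean k P) - k * (k + 1) / 2 * (1 / polyNorm P)| ≤
        C * (1 / (polyNorm P : ℝ)) ^ 2 := by
  have h3 : |(Real.sqrt 3)⁻¹| < 1 := by
    rw [abs_of_pos (by positivity)]
    exact inv_lt_one_of_one_lt₀ (Real.lt_sqrt_of_sq_lt (by norm_num))
  obtain ⟨C, hC, h⟩ := exists_abs_tsum_sub_le (c := fun i => tauCoeff k (2 * i)) (r := 1 / 3)
    (by norm_num) ((hasSum_tauCoeff_even k h3).summable.congr fun i => by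
      rw [pow_mul, inv_pow, Real.sq_sqrt (by norm_num), one_div])
  obtain ⟨C', hC', h'⟩ := exists_abs_log_sub_le (k * (k + 1) / 2) (C + |k * (k + 1) / 2|)
  refine ⟨C', hC', fun P hP => ?_⟩
  obtain ⟨h1, -, h2, hsq⟩ := inv_sqrt_polyNorm hq hP
  have hp := three_le_polyNorm hq hP
  have hx3 : 1 / (polyNorm P : ℝ) ≤ 1 / 3 := one_div_le_one_div_of_le (by norm_num) hp
  refine h' _ _ (by positivity) hx3 ?_ (half_le_eulerMean hq k hP)
  refine abs_model_mean_sub_le hp ?_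
  have hs := hasSum_tauCoeff_even k (y := (Real.sqrt (polyNorm P))⁻¹)
    (by rw [abs_of_pos h1]; linarith)
  have := h (1 / polyNorm P) _ (by positivity) hx3 (hs.congr_fun fun i => by rw [← hsq, ← pow_mul])
  simpa only [mul_zero, mul_one, tauCoeff_zero, tauCoeff_two] using this

theorem abs_cosh_sub_le (t : ℝ) :
    |(Real.exp t + Real.exp (-t)) / 2 - 1 - t ^ 2 / 2| ≤ t ^ 4 * Real.exp |t| := by
  have h1 := abs_exp_sub_sum_le (x := t) le_rfl 4
  have h2 := abs_exp_sub_sum_le (x := -t) (W := |t|) (by rw [abs_neg]) 4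
  simp only [Finset.sum_range_succ, Finset.sum_range_zero, Nat.factorial] at h1 h2
  have h4 : |t| ^ 4 = t ^ 4 := (even_two_mul 2).pow_abs t
  rw [h4] at h1 h2
  norm_num at h1 h2
  have h5 : 0 ≤ t ^ 4 * Real.exp |t| := by positivity
  have e : (Real.exp t + Real.exp (-t)) / 2 - 1 - t ^ 2 / 2 =
      ((Real.exp t - (1 + t + t ^ 2 / 2 + t ^ 3 / 6)) +
        (Real.exp (-t) - (1 + -t + t ^ 2 / 2 + (-t) ^ 3 / 6))) / 2 := by ring
  rw [e, abs_le]
  rw [abs_le] at h1 h2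
  constructor <;> nlinarith [h1.1, h1.2, h2.1, h2.2]

/-- When only `j = 1` survives the truncation, the average over signs is `cosh (k / √|P|)`, with
coefficient `k² / 2` in place of `k (k + 1) / 2`. -/
theorem exists_abs_log_modelFactor_sub_le (hq : Odd (Fintype.card F)) (k : ℝ) :
    ∃ C, 0 ≤ C ∧ ∀ (P : F[X]) (N : ℕ), IsMonicPrime P → N / P.natDegree = 1 →
      |Real.log (modelFactor k N P) - k ^ 2 / 2 * (1 / polyNorm P)| ≤
        C * (1 / (polyNorm P : ℝ)) ^ 2 := by
  obtain ⟨C', hC', h'⟩ := exists_abs_log_sub_le (k ^ 2 / 2) (k ^ 4 * Real.exp |k| + |k ^ 2 / 2|)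
  refine ⟨C', hC', fun P N hP hN => ?_⟩
  obtain ⟨h1, -, h2, hsq⟩ := inv_sqrt_polyNorm hq hP
  have hp := three_le_polyNorm hq hP
  have hx3 : 1 / (polyNorm P : ℝ) ≤ 1 / 3 := one_div_le_one_div_of_le (by norm_num) hp
  refine h' _ _ (by positivity) hx3 ?_ (half_le_modelFactor hq k N hP)
  rw [modelFactor, hN]
  refine abs_model_mean_sub_le hp ?_
  have h := abs_cosh_sub_le (k * (Real.sqrt (polyNorm P))⁻¹)
  simp only [Finset.Icc_self, Finset.sum_singleton, primePowerCoeff, Nat.cast_one, one_mul, pow_one,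
    mul_neg, mul_one]
  rw [← div_eq_mul_inv] at h
  rw [← hsq]
  refine le_trans (le_of_eq ?_) (h.trans ?_)
  · congr 1; ring
  · rw [div_eq_mul_inv, mul_pow, ← pow_mul, mul_right_comm]
    refine mul_le_mul_of_nonneg_right ?_ (by positivity)
    refine mul_le_mul_of_nonneg_left (Real.exp_le_exp.2 ?_) (by positivity)
    rw [abs_mul, abs_of_pos h1]
    exact mul_le_of_le_one_right (abs_nonneg k) (by linarith)

/-- Moving both exponents by at most `η` multiplies the positive combination by a factor between
`exp (-η)` and `exp η`, the constant `u` only helping. -/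
theorem abs_log_mean_sub_log_mean_le {u v a b a' b' η : ℝ} (hu : 0 < u) (hv : 0 < v)
    (ha : |a - a'| ≤ η) (hb : |b - b'| ≤ η) :
    |Real.log (u + v * ((Real.exp a + Real.exp b) / 2)) -
      Real.log (u + v * ((Real.exp a' + Real.exp b') / 2))| ≤ η := by
  have key : ∀ {a b a' b' : ℝ}, a ≤ η + a' → b ≤ η + b' → 0 ≤ η →
      Real.log (u + v * ((Real.exp a + Real.exp b) / 2)) ≤
        η + Real.log (u + v * ((Real.exp a' + Real.exp b') / 2)) := by
    intro a b a' b' ha hb hη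
    have h1 : Real.exp a ≤ Real.exp η * Real.exp a' := by
      rw [← Real.exp_add]; exact Real.exp_le_exp.2 ha
    have h2 : Real.exp b ≤ Real.exp η * Real.exp b' := by
      rw [← Real.exp_add]; exact Real.exp_le_exp.2 hb
    have h3 : 1 ≤ Real.exp η := Real.one_le_exp hη
    rw [← Real.log_exp η]
    rw [← Real.log_mul (Real.exp_pos _).ne' (by positivity)]
    refine Real.log_le_log (by positivity) ?_
    have h4 : v * ((Real.exp a + Real.exp b) / 2) ≤
        v * ((Real.exp η * Real.exp a' + Real.exp η * Real.exp b') / 2) := by gcongr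
    nlinarith
  have hη : 0 ≤ η := (abs_nonneg _).trans ha
  rw [abs_le] at *
  have k1 := key (a := a) (b := b) (a' := a') (b' := b') (by linarith [ha.2]) (by linarith [hb.2]) hη
  have k2 := key (a := a') (b := b') (a' := a) (b' := b) (by linarith [ha.1]) (by linarith [hb.1]) hη
  constructor <;> linarith

/-- If `deg P ≤ N / 2`, the truncated logarithm keeps at least the terms `j = 1, 2`, so its tail is
of order `|P| ^ (-3 / 2)`, with an extra `deg P / N` from the denominators. The constant `3` bounds
`1 / (1 - y)` for `y ≤ 3 / 5`. -/
theorem abs_log_modelFactor_sub_log_eulerMean_le (hq : Odd (Fintype.card F)) (k : ℝ) {N : ℕ}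
    (hN : 1 ≤ N) {P : F[X]} (hP : IsMonicPrime P) (hPN : 2 * P.natDegree ≤ N) :
    |Real.log (modelFactor k N P) - Real.log (eulerMean k P)| ≤
      3 * |k| / N * ((P.natDegree : ℝ) * (Real.sqrt (polyNorm P) ^ 3)⁻¹) := by
  obtain ⟨h1, -, h2, hsq⟩ := inv_sqrt_polyNorm hq hP
  have hp := three_le_polyNorm hq hP
  have hN0 : (0 : ℝ) < N := by exact_mod_cast hN
  set y := (Real.sqrt (polyNorm P))⁻¹ with hy
  set J := N / P.natDegree with hJ
  have hJ2 : 2 ≤ J := (Nat.le_div_iff_mul_le hP.natDegree_pos).2 hPN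
  have hJN : (N : ℝ) ≤ P.natDegree * (J + 1) := by
    exact_mod_cast (Nat.lt_mul_div_succ N hP.natDegree_pos).le
  have htail : ∀ z : ℝ, |z| = y → |k * ∑ j ∈ Finset.Icc 1 J, z ^ j / j - Real.log (1 - z) * (-k)| ≤
      3 * |k| / N * ((P.natDegree : ℝ) * (Real.sqrt (polyNorm P) ^ 3)⁻¹) := by
    intro z hz
    have e : k * ∑ j ∈ Finset.Icc 1 J, z ^ j / j - Real.log (1 - z) * (-k) =
        k * (Real.log (1 - z) + ∑ j ∈ Finset.Icc 1 J, z ^ j / j) := by ring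
    rw [e, abs_mul]
    have h3 := abs_log_add_sum_le (x := z) (by rw [hz]; linarith) J
    rw [hz] at h3
    have e2 : 3 * |k| / N * ((P.natDegree : ℝ) * (Real.sqrt (polyNorm P) ^ 3)⁻¹) =
        |k| * (3 / N * (P.natDegree * y ^ 3)) := by rw [hy, inv_pow]; ring
    rw [e2]
    refine mul_le_mul_of_nonneg_left (h3.trans ?_) (abs_nonneg k)
    have hJ0 : (0 : ℝ) < J + 1 := by positivity
    rw [div_le_iff₀ (mul_pos hJ0 (by linarith))]
    have hpow : y ^ (J + 1) ≤ y ^ 3 := pow_le_pow_of_le_one h1.le (by linarith) (by omega)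
    have h4 : 1 ≤ (P.natDegree * ((J : ℝ) + 1)) / N := by rw [le_div_iff₀ hN0]; linarith
    have h5 : 1 ≤ 3 * (1 - y) := by linarith
    have e3 : 3 / N * (P.natDegree * y ^ 3) * ((J + 1) * (1 - y)) =
        y ^ 3 * ((P.natDegree * ((J : ℝ) + 1)) / N) * (3 * (1 - y)) := by ring
    rw [e3]
    exact hpow.trans ((le_mul_of_one_le_right (by positivity) h4).trans
      (le_mul_of_one_le_right (by positivity) h5))
  have hcoef : ∀ j : ℕ, primePowerCoeff k P j = k * (y ^ j / j) := by
    intro j; rw [primePowerCoeff, hy, inv_pow]; field_simp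
  have t1 := htail y (abs_of_pos h1)
  have t2 := htail (-y) (by rw [abs_neg, abs_of_pos h1])
  rw [Finset.mul_sum] at t1 t2
  rw [sub_neg_eq_add] at t2
  have hm := abs_log_mean_sub_log_mean_le (u := 1 / ((polyNorm P : ℝ) + 1))
    (v := (polyNorm P : ℝ) / (polyNorm P + 1)) (by positivity) (by positivity) t1 t2
  rw [← Real.rpow_def_of_pos (by linarith), ← Real.rpow_def_of_pos (by linarith)] at hm
  rw [modelFactor, eulerMean, ← hJ, ← hy]
  simp_rw [hcoef]
  convert hm using 8
  refine congrArg Real.exp (Finset.sum_congr rfl fun j _ => ?_)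
  rw [neg_pow y]; ring

end LocalFactors

/-! ### Convergence of `A_k` and asymptotics of the model mean -/

section ModelAsymptotics

theorem sum_primesLE_sdiff_le (hq : Odd (Fintype.card F)) {N N' : ℕ} (hN : 1 ≤ N) :
    ∑ P ∈ primesLE F N' \ primesLE F N, (1 / (polyNorm P : ℝ)) ^ 2 ≤
      (2 / N : ℝ) := by
  have hN0 : (0 : ℝ) < N := by exact_mod_cast hN
  rw [le_div_iff₀ hN0, Finset.sum_mul]
  refine le_trans ?_ (sum_natDegree_mul_sq_le hq N')
  refine (Finset.sum_le_sum fun P hP => ?_).trans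
    (Finset.sum_le_sum_of_subset_of_nonneg Finset.sdiff_subset fun P _ _ => by positivity)
  rw [Finset.mem_sdiff, mem_primesLE, mem_primesLE] at hP
  have : N ≤ P.natDegree := by
    by_contra h
    exact hP.2 ⟨hP.1.1, by omega⟩
  have h2 : (N : ℝ) ≤ P.natDegree := by exact_mod_cast this
  rw [mul_comm]
  exact mul_le_mul_of_nonneg_right h2 (by positivity)

theorem primesLE_mono {N N' : ℕ} (h : N ≤ N') : primesLE F N ⊆ primesLE F N' := fun P hP => by
  rw [mem_primesLE] at hP ⊢; exact ⟨hP.1, hP.2.trans h⟩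

theorem sum_subtype_primesLE (N : ℕ) (G : F[X] → ℝ) :
    ∑ P ∈ (primesLE F N).subtype IsMonicPrime, G P.1 = ∑ P ∈ primesLE F N, G P :=
  Finset.sum_subtype_of_mem G isMonicPrime_of_mem

theorem summable_of_abs_le_sq (hq : Odd (Fintype.card F)) {G : F[X] → ℝ} {C : ℝ}
    (hG : ∀ P, IsMonicPrime P → |G P| ≤ C * (1 / (polyNorm P : ℝ)) ^ 2) :
    Summable (fun P : MonicPrime F => G P.1) := by
  have h : Summable (fun P : MonicPrime F => (1 / (polyNorm P.1 : ℝ)) ^ 2) := by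
    refine summable_of_sum_le (c := 2) (fun P => by positivity) fun u => ?_
    obtain ⟨N, hN⟩ : ∃ N, ∀ P ∈ u, P.1.natDegree ≤ N :=
      ⟨u.sup fun P => P.1.natDegree, fun P hP => Finset.le_sup (f := fun P => P.1.natDegree) hP⟩
    have hsub : u ⊆ (primesLE F N).subtype IsMonicPrime := fun P hP => by
      rw [Finset.mem_subtype, mem_primesLE]; exact ⟨P.2, hN P hP⟩
    refine (Finset.sum_le_sum_of_subset_of_nonneg hsub fun P _ _ => by positivity).trans ?_
    rw [sum_subtype_primesLE N (fun P => (1 / (polyNorm P : ℝ)) ^ 2)]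
    refine (Finset.sum_le_sum fun P hP => ?_).trans (sum_natDegree_mul_sq_le hq N)
    refine le_mul_of_one_le_left (by positivity) ?_
    exact_mod_cast (mem_primesLE.1 hP).1.natDegree_pos
  exact (h.mul_left C).of_norm_bounded fun P => hG P.1 P.2

/-- Exhausting the primes by degree, the tail beyond `N` is `O(1 / N)` because `deg P / |P|²` is
summable and `deg P ≥ N` there. -/
theorem abs_tsum_sub_sum_le (hq : Odd (Fintype.card F)) {G : F[X] → ℝ} {C : ℝ} (hC : 0 ≤ C)
    (hG : ∀ P, IsMonicPrime P → |G P| ≤ C * (1 / (polyNorm P : ℝ)) ^ 2) {N : ℕ} (hN : 1 ≤ N) :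
    |∑' P : MonicPrime F, G P.1 - ∑ P ∈ primesLE F N, G P| ≤ 2 * C / N := by
  have hs := (summable_of_abs_le_sq hq hG).hasSum
  have hmono : Monotone fun N' : ℕ => (primesLE F N').subtype IsMonicPrime := fun a b hab =>
    Finset.subtype_mono (primesLE_mono hab)
  have ht : Filter.Tendsto (fun N' : ℕ => (primesLE F N').subtype IsMonicPrime) Filter.atTop
      Filter.atTop := Filter.tendsto_atTop_finset_of_monotone hmono fun P =>
    ⟨P.1.natDegree, by rw [Finset.mem_subtype, mem_primesLE]; exact ⟨P.2, le_rfl⟩⟩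
  have h1 : Filter.Tendsto (fun N' : ℕ => ∑ P ∈ primesLE F N', G P) Filter.atTop
      (nhds (∑' P : MonicPrime F, G P.1)) := by
    refine (hs.comp ht).congr fun N' => ?_
    exact sum_subtype_primesLE N' G
  have h2 := (h1.sub_const (∑ P ∈ primesLE F N, G P)).abs
  refine le_of_tendsto h2 ?_
  filter_upwards [Filter.eventually_ge_atTop N] with N' hN'
  rw [← Finset.sum_sdiff (primesLE_mono hN'), add_sub_cancel_right]
  refine (Finset.abs_sum_le_sum_abs _ _).trans ?_
  have h3 : ∀ P ∈ primesLE F N' \ primesLE F N, |G P| ≤ C * (1 / (polyNorm P : ℝ)) ^ 2 :=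
    fun P hP => hG P (isMonicPrime_of_mem P (Finset.sdiff_subset hP))
  refine (Finset.sum_le_sum h3).trans ?_
  rw [← Finset.mul_sum]
  exact (mul_le_mul_of_nonneg_left (sum_primesLE_sdiff_le hq hN) hC).trans (le_of_eq (by ring))

theorem abs_log_one_sub_add_le {x : ℝ} (hx : 0 < x) (hx3 : x ≤ 1 / 3) :
    |Real.log (1 - x) + x| ≤ x ^ 2 := by
  have hxa := abs_of_pos hx
  have h := abs_log_add_sum_le (x := x) (by rw [hxa]; linarith) 1
  simp only [Finset.Icc_self, Finset.sum_singleton, pow_one, Nat.cast_one, div_one, hxa] at h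
  exact h.trans (div_le_self (by positivity) (by linarith))

theorem one_div_polyNorm_bounds (hq : Odd (Fintype.card F)) {P : F[X]} (hP : IsMonicPrime P) :
    0 < 1 / (polyNorm P : ℝ) ∧ 1 / (polyNorm P : ℝ) ≤ 1 / 3 := by
  have h := three_le_polyNorm hq hP
  exact ⟨by positivity, one_div_le_one_div_of_le (by norm_num) h⟩

theorem eulerMean_pos (hq : Odd (Fintype.card F)) (k : ℝ) {P : F[X]} (hP : IsMonicPrime P) :
    0 < eulerMean k P :=
  (half_pos (one_div_polyNorm_bounds hq hP).1).trans_le (half_le_eulerMean hq k hP)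

theorem modelFactor_pos (hq : Odd (Fintype.card F)) (k : ℝ) (N : ℕ) {P : F[X]}
    (hP : IsMonicPrime P) : 0 < modelFactor k N P :=
  (half_pos (one_div_polyNorm_bounds hq hP).1).trans_le (half_le_modelFactor hq k N hP)

theorem localFactor_pos (hq : Odd (Fintype.card F)) (k : ℝ) {P : F[X]} (hP : IsMonicPrime P) :
    0 < localFactor k P := by
  rw [localFactor_eq hq k hP]
  have h := one_div_polyNorm_bounds hq hP
  exact mul_pos (Real.rpow_pos_of_pos (by linarith [h.2]) _) (eulerMean_pos hq k hP)

theorem log_localFactor (hq : Odd (Fintype.card F)) (k : ℝ) {P : F[X]} (hP : IsMonicPrime P) :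
    Real.log (localFactor k P) = k * (k + 1) / 2 * Real.log (1 - 1 / polyNorm P) +
      Real.log (eulerMean k P) := by
  have h := one_div_polyNorm_bounds hq hP
  have h1 : 0 < 1 - 1 / (polyNorm P : ℝ) := by linarith [h.2]
  rw [localFactor_eq hq k hP, Real.log_mul (Real.rpow_pos_of_pos h1 _).ne'
    (eulerMean_pos hq k hP).ne', Real.log_rpow h1]

/-- The exponent `k (k + 1) / 2` in the local factor is the one that cancels the `1 / |P|` term of
`log (eulerMean k P)`; this gives unconditional convergence of the product. -/
theorem exists_abs_log_localFactor_le (hq : Odd (Fintype.card F)) (k : ℝ) :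
    ∃ C, 0 ≤ C ∧ ∀ P : F[X], IsMonicPrime P →
      |Real.log (localFactor k P)| ≤ C * (1 / (polyNorm P : ℝ)) ^ 2 := by
  obtain ⟨C, hC, h⟩ := exists_abs_log_eulerMean_sub_le hq k
  refine ⟨C + |k * (k + 1) / 2|, by positivity, fun P hP => ?_⟩
  obtain ⟨hx, hx3⟩ := one_div_polyNorm_bounds hq hP
  rw [log_localFactor hq k hP]
  have h1 := h P hP
  have h2 := abs_log_one_sub_add_le hx hx3
  set x := 1 / (polyNorm P : ℝ)
  have e : k * (k + 1) / 2 * Real.log (1 - x) + Real.log (eulerMean k P) =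
      (Real.log (eulerMean k P) - k * (k + 1) / 2 * x) +
        k * (k + 1) / 2 * (Real.log (1 - x) + x) := by ring
  rw [e, add_mul]
  refine (abs_add_le _ _).trans (add_le_add h1 ?_)
  rw [abs_mul]
  exact mul_le_mul_of_nonneg_left h2 (abs_nonneg _)

theorem multipliable_localFactor (hq : Odd (Fintype.card F)) (k : ℝ) :
    Multipliable (fun P : MonicPrime F => localFactor k P.1) := by
  obtain ⟨C, hC, h⟩ := exists_abs_log_localFactor_le hq k
  exact Real.multipliable_of_summable_log (fun P => localFactor_pos hq k P.2)
    (summable_of_abs_le_sq hq (G := fun P => Real.log (localFactor k P)) h)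

theorem arithConst_eq (hq : Odd (Fintype.card F)) (k : ℝ) :
    arithConst F k = Real.exp (∑' P : MonicPrime F, Real.log (localFactor k P.1)) := by
  obtain ⟨C, hC, h⟩ := exists_abs_log_localFactor_le hq k
  exact (Real.rexp_tsum_eq_tprod (fun P : MonicPrime F => localFactor_pos hq k P.2)
    (summable_of_abs_le_sq hq (G := fun P => Real.log (localFactor k P)) h)).symm

theorem abs_log_half_sub_le {N : ℕ} (hN : 2 ≤ N) :
    |Real.log N - Real.log (N / 2 : ℕ) - Real.log 2| ≤ 2 / N := by
  have hN2 : (2 : ℝ) ≤ N := by exact_mod_cast hN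
  have h1 : (N : ℝ) - 1 ≤ 2 * (N / 2 : ℕ) := by
    have : N ≤ 2 * (N / 2) + 1 := by omega
    have h : (N : ℝ) ≤ 2 * (N / 2 : ℕ) + 1 := by exact_mod_cast this
    linarith
  have h2 : 2 * ((N / 2 : ℕ) : ℝ) ≤ N := by
    have : 2 * (N / 2) ≤ N := by omega
    exact_mod_cast this
  have hm : (0 : ℝ) < (N / 2 : ℕ) := by
    have : 0 < N / 2 := by omega
    exact_mod_cast this
  rw [sub_sub, ← Real.log_mul hm.ne' (by norm_num), mul_comm]
  rw [abs_of_nonneg (sub_nonneg.2 (Real.log_le_log (by positivity) h2)),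
    ← Real.log_div (by positivity) (by positivity)]
  refine (Real.log_le_sub_one_of_pos (by positivity)).trans ?_
  rw [div_sub_one (by positivity), div_le_div_iff₀ (by positivity) (by positivity)]
  nlinarith

/-- Difference of Mertens' theorem at `N` and at `N / 2`. The case `N = 1` is separate because `N /
2` is then `0`. -/
theorem abs_sum_log_sdiff_add_log_two_le (hq : Odd (Fintype.card F)) {N : ℕ} (hN : 1 ≤ N) :
    |∑ P ∈ primesLE F N \ primesLE F (N / 2), Real.log (1 - 1 / polyNorm P) + Real.log 2| ≤
      18 / N := by
  have hN0 : (0 : ℝ) < N := by exact_mod_cast hN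
  have hsd := Finset.sum_sdiff (f := fun P => Real.log (1 - 1 / (polyNorm P : ℝ)))
    (primesLE_mono (F := F) (Nat.div_le_self N 2))
  have h1 := sum_log_polyNorm hq hN
  rcases Nat.lt_or_ge N 2 with h | h
  · obtain rfl : N = 1 := by omega
    have he : primesLE F (1 / 2) = ∅ := by
      ext P
      simp only [mem_primesLE, Finset.notMem_empty, iff_false, not_and]
      intro hP; have := hP.natDegree_pos; omega
    rw [he, Finset.sum_empty, add_zero] at hsd
    rw [he, hsd]
    simp only [Nat.cast_one, Real.log_one, add_zero, div_one] at h1 ⊢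
    have h2 := Real.eulerMascheroniConstant_lt_two_thirds
    have h3 := Real.one_half_lt_eulerMascheroniConstant
    have h4 := Real.log_two_lt_d9
    have h5 := Real.log_two_gt_d9
    rw [abs_le] at h1 ⊢
    constructor <;> linarith [h1.1, h1.2]
  · have h2 := sum_log_polyNorm hq (N := N / 2) (by omega)
    have h3 := abs_log_half_sub_le h
    have h4 : (4 : ℝ) / (N / 2 : ℕ) ≤ 12 / N := by
      have hm : (0 : ℝ) < (N / 2 : ℕ) := by
        have : 0 < N / 2 := by omega
        exact_mod_cast this
      rw [div_le_div_iff₀ hm hN0]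
      have : N ≤ 3 * (N / 2) := by omega
      have : (N : ℝ) ≤ 3 * (N / 2 : ℕ) := by exact_mod_cast this
      linarith
    have e : (18 : ℝ) / N = 4 / N + 12 / N + 2 / N := by ring
    rw [e]
    replace h2 := h2.trans h4
    rw [abs_le] at h1 h2 h3 ⊢
    constructor <;> linarith [h1.1, h1.2, h2.1, h2.2, h3.1, h3.2]

/-- The origin of `2 ^ (-k / 2)`. Degrees up to `N / 2` contribute `O(1 / N)`; above `N / 2` the
local discrepancy is `-(k / 2) / |P|` up to `O(1 / |P|²)`, hence `(k / 2) log (1 - 1 / |P|)`, and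
Mertens sums it to `-(k / 2) log 2`. -/
theorem exists_abs_sum_log_modelFactor_sub_le (hq : Odd (Fintype.card F)) (k : ℝ) :
    ∃ C, 0 ≤ C ∧ ∀ N : ℕ, 1 ≤ N →
      |∑ P ∈ primesLE F N, Real.log (modelFactor k N P) -
        ∑ P ∈ primesLE F N, Real.log (eulerMean k P) + k / 2 * Real.log 2| ≤ C / N := by
  obtain ⟨C₁, hC₁, h₁⟩ := exists_abs_log_eulerMean_sub_le hq k
  obtain ⟨C₂, hC₂, h₂⟩ := exists_abs_log_modelFactor_sub_le hq k
  set C := C₁ + C₂ + |k / 2| with hC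
  have hC0 : 0 ≤ C := by positivity
  refine ⟨4 * C + 6 * |k| + |k / 2| * 18, by positivity, fun N hN => ?_⟩
  have hN0 : (0 : ℝ) < N := by exact_mod_cast hN
  set S := primesLE F N
  set T := primesLE F (N / 2)
  have hTS : T ⊆ S := primesLE_mono (Nat.div_le_self N 2)
  have hlow : |∑ P ∈ T, (Real.log (modelFactor k N P) - Real.log (eulerMean k P))| ≤
      6 * |k| / N := by
    refine (Finset.abs_sum_le_sum_abs _ _).trans ?_
    have h3 : ∀ P ∈ T, |Real.log (modelFactor k N P) - Real.log (eulerMean k P)| ≤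
        3 * |k| / N * ((P.natDegree : ℝ) * (Real.sqrt (polyNorm P) ^ 3)⁻¹) := fun P hP => by
      have := mem_primesLE.1 hP
      exact abs_log_modelFactor_sub_log_eulerMean_le hq k hN this.1 (by omega)
    refine (Finset.sum_le_sum h3).trans ?_
    rw [← Finset.mul_sum]
    exact (mul_le_mul_of_nonneg_left (sum_natDegree_mul_le hq _) (by positivity)).trans
      (le_of_eq (by ring))
  have hhigh : |∑ P ∈ S \ T, (Real.log (modelFactor k N P) - Real.log (eulerMean k P) -
      k / 2 * Real.log (1 - 1 / polyNorm P))| ≤ 4 * C / N := by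
    refine (Finset.abs_sum_le_sum_abs _ _).trans ?_
    have h3 : ∀ P ∈ S \ T, |Real.log (modelFactor k N P) - Real.log (eulerMean k P) -
        k / 2 * Real.log (1 - 1 / polyNorm P)| ≤
        2 * C / N * ((P.natDegree : ℝ) * (1 / (polyNorm P : ℝ)) ^ 2) := fun P hP => by
      rw [Finset.mem_sdiff, mem_primesLE, mem_primesLE] at hP
      have hd : N / 2 < P.natDegree := by
        by_contra h
        exact hP.2 ⟨hP.1.1, by omega⟩
      have hJ : N / P.natDegree = 1 := by
        refine le_antisymm ?_ ?_
        · exact Nat.lt_succ_iff.1 ((Nat.div_lt_iff_lt_mul hP.1.1.natDegree_pos).2 (by omega))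
        · exact (Nat.le_div_iff_mul_le hP.1.1.natDegree_pos).2 (by simpa using hP.1.2)
      have g1 := h₁ P hP.1.1
      have g2 := h₂ P N hP.1.1 hJ
      obtain ⟨hx, hx3⟩ := one_div_polyNorm_bounds hq hP.1.1
      have g3 := abs_log_one_sub_add_le hx hx3
      set x := 1 / (polyNorm P : ℝ)
      have e : Real.log (modelFactor k N P) - Real.log (eulerMean k P) - k / 2 * Real.log (1 - x) =
          (Real.log (modelFactor k N P) - k ^ 2 / 2 * x) -
            (Real.log (eulerMean k P) - k * (k + 1) / 2 * x) -
            k / 2 * (Real.log (1 - x) + x) := by ring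
      have g4 : |Real.log (modelFactor k N P) - Real.log (eulerMean k P) -
          k / 2 * Real.log (1 - x)| ≤ C * x ^ 2 := by
        rw [e]
        refine (abs_sub _ _).trans ((add_le_add (abs_sub _ _) le_rfl).trans ?_)
        rw [abs_mul, hC]
        have := mul_le_mul_of_nonneg_left g3 (abs_nonneg (k / 2))
        linarith
      refine g4.trans ?_
      have h5 : (1 : ℝ) ≤ 2 * P.natDegree / N := by
        rw [le_div_iff₀ hN0, one_mul]
        have : N ≤ 2 * P.natDegree := by omega
        exact_mod_cast this
      have e2 : 2 * C / N * ((P.natDegree : ℝ) * x ^ 2) =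
          C * x ^ 2 * (2 * P.natDegree / N) := by ring
      rw [e2]
      exact le_mul_of_one_le_right (by positivity) h5
    refine (Finset.sum_le_sum h3).trans ?_
    rw [← Finset.mul_sum]
    have h6 : ∑ P ∈ S \ T, (P.natDegree : ℝ) * (1 / (polyNorm P : ℝ)) ^ 2 ≤ 2 :=
      (Finset.sum_le_sum_of_subset_of_nonneg Finset.sdiff_subset
        fun P _ _ => by positivity).trans (sum_natDegree_mul_sq_le hq N)
    exact (mul_le_mul_of_nonneg_left h6 (by positivity)).trans (le_of_eq (by ring))
  have hlog := abs_sum_log_sdiff_add_log_two_le hq hN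
  have hlog' : |k / 2 * (∑ P ∈ S \ T, Real.log (1 - 1 / polyNorm P) + Real.log 2)| ≤
      |k / 2| * (18 / N) := by
    rw [abs_mul]; exact mul_le_mul_of_nonneg_left hlog (abs_nonneg _)
  have e : ∑ P ∈ S, Real.log (modelFactor k N P) - ∑ P ∈ S, Real.log (eulerMean k P) +
      k / 2 * Real.log 2 =
      ∑ P ∈ S \ T, (Real.log (modelFactor k N P) - Real.log (eulerMean k P) -
        k / 2 * Real.log (1 - 1 / polyNorm P)) +
      ∑ P ∈ T, (Real.log (modelFactor k N P) - Real.log (eulerMean k P)) +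
      k / 2 * (∑ P ∈ S \ T, Real.log (1 - 1 / polyNorm P) + Real.log 2) := by
    rw [← Finset.sum_sub_distrib, ← Finset.sum_sdiff hTS, Finset.sum_sub_distrib
      (s := S \ T) (g := fun P => k / 2 * Real.log (1 - 1 / (polyNorm P : ℝ))), ← Finset.mul_sum]
    ring
  rw [e]
  refine (abs_add_le _ _).trans ((add_le_add (abs_add_le _ _) le_rfl).trans ?_)
  have e3 : (4 * C + 6 * |k| + |k / 2| * 18) / N =
      4 * C / N + 6 * |k| / N + |k / 2| * (18 / N) := by ring
  rw [e3]
  exact add_le_add (add_le_add hhigh hlow) hlog'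

theorem exists_abs_log_prod_modelFactor_sub_le (hq : Odd (Fintype.card F)) (k : ℝ) :
    ∃ C, 0 ≤ C ∧ ∀ N : ℕ, 1 ≤ N →
      |Real.log (∏ P ∈ primesLE F N, modelFactor k N P) -
        (-(k / 2) * Real.log 2 + Real.log (arithConst F k) +
          k * (k + 1) / 2 * (Real.eulerMascheroniConstant + Real.log N))| ≤ C / N := by
  obtain ⟨C₁, hC₁, h₁⟩ := exists_abs_sum_log_modelFactor_sub_le hq k
  obtain ⟨C₂, hC₂, h₂⟩ := exists_abs_log_localFactor_le hq k
  refine ⟨C₁ + 2 * C₂ + |k * (k + 1) / 2| * 4, by positivity, fun N hN => ?_⟩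
  have g1 := h₁ N hN
  have g2 := abs_tsum_sub_sum_le hq (G := fun P => Real.log (localFactor k P)) hC₂ h₂ hN
  have g3 := sum_log_polyNorm hq hN
  have g4 : |k * (k + 1) / 2 * (∑ P ∈ primesLE F N, Real.log (1 - 1 / polyNorm P) + Real.log N +
      Real.eulerMascheroniConstant)| ≤ |k * (k + 1) / 2| * (4 / N) := by
    rw [abs_mul]; exact mul_le_mul_of_nonneg_left g3 (abs_nonneg _)
  rw [arithConst_eq hq k, Real.log_exp, Real.log_prod fun P hP =>
    (modelFactor_pos hq k N (isMonicPrime_of_mem P hP)).ne']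
  have e : ∑ P ∈ primesLE F N, Real.log (localFactor k P) =
      k * (k + 1) / 2 * ∑ P ∈ primesLE F N, Real.log (1 - 1 / polyNorm P) +
        ∑ P ∈ primesLE F N, Real.log (eulerMean k P) := by
    rw [Finset.mul_sum, ← Finset.sum_add_distrib]
    exact Finset.sum_congr rfl fun P hP => log_localFactor hq k (isMonicPrime_of_mem P hP)
  rw [e] at g2
  have e3 : (C₁ + 2 * C₂ + |k * (k + 1) / 2| * 4) / N =
      C₁ / N + 2 * C₂ / N + |k * (k + 1) / 2| * (4 / N) := by ring
  rw [e3]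
  rw [abs_le] at g1 g2 g4 ⊢
  constructor <;> linarith [g1.1, g1.2, g2.1, g2.2, g4.1, g4.2]

end ModelAsymptotics

/-! ### Choice of the truncation and assembly of the errors -/

section FinalEstimates

/-- The condition `exp 3 * W ≤ M` makes `W ^ M / M!` at most `exp (-2 M)`, which pays for `exp W ≤
exp M` and for `g² ≤ exp M`. In the other term `t ^ g` pays for `exp W` and `g²`. -/
theorem exp_error_mul_sq_le {t W : ℝ} {g M : ℕ} (ht1 : 1 < t) (hgpos : (0 : ℝ) < g) (hW0 : 0 ≤ W)
    (hMpos : 0 < M) (hWM : Real.exp 3 * W ≤ M) (hMlog : 2 * Real.log g ≤ M)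
    (hWt : W + 2 * Real.log g ≤ g * Real.log t) :
    (Real.exp W * (2 * t⁻¹ ^ g) + 2 * (W ^ M / M.factorial * Real.exp W)) * (g : ℝ) ^ 2 ≤ 4 := by
  have hgsq : (g : ℝ) ^ 2 = Real.exp (2 * Real.log g) := by
    rw [two_mul, Real.exp_add, Real.exp_log hgpos, pow_two]
  have htg : t⁻¹ ^ g = Real.exp (-(g * Real.log t)) := by
    rw [Real.exp_neg, mul_comm, Real.exp_mul, Real.exp_log (by linarith),
      Real.rpow_natCast, inv_pow]
  have term1 : Real.exp W * (2 * t⁻¹ ^ g) * (g : ℝ) ^ 2 ≤ 2 := by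
    have : Real.exp W * (2 * t⁻¹ ^ g) * (g : ℝ) ^ 2 =
        2 * Real.exp (W + -(g * Real.log t) + 2 * Real.log g) := by
      rw [htg, hgsq, Real.exp_add, Real.exp_add]; ring
    rw [this]
    have : Real.exp (W + -(g * Real.log t) + 2 * Real.log g) ≤ 1 := Real.exp_le_one_iff.2 (by linarith)
    linarith
  have hMpos' : (0 : ℝ) < M := by exact_mod_cast hMpos
  have term2 : 2 * (W ^ M / M.factorial * Real.exp W) * (g : ℝ) ^ 2 ≤ 2 := by
    have h10 : W ^ M / M.factorial ≤ Real.exp (-2) ^ M := by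
      refine (pow_div_factorial_le hW0 hMpos).trans (pow_le_pow_left₀ (by positivity) ?_ M)
      rw [div_le_iff₀ hMpos']
      have : Real.exp 1 * W = Real.exp (-2) * (Real.exp 3 * W) := by
        rw [← mul_assoc, ← Real.exp_add]; norm_num
      rw [this]
      exact mul_le_mul_of_nonneg_left hWM (Real.exp_pos _).le
    rw [← Real.exp_nat_mul] at h10
    have h11 : W ≤ M := (le_mul_of_one_le_left hW0 (Real.one_le_exp (by norm_num))).trans hWM
    have h12 : W ^ M / M.factorial * Real.exp W * (g : ℝ) ^ 2 ≤
        Real.exp (M * -2) * Real.exp M * Real.exp M := by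
      rw [hgsq]
      gcongr
    have h13 : Real.exp (M * -2) * Real.exp M * Real.exp M = 1 := by
      rw [← Real.exp_add, ← Real.exp_add, ← Real.exp_zero]; congr 1; ring
    linarith
  linarith

/-- Here `u` is `g ^ (ε / 4)`, which dominates `log g` and, up to a factor `2`, also `N`. Then `W`
is at most of order `g / u ^ 3` while `M = g / N` is at least `g / (4 u)`, so the spare powers of
`u` absorb all constants. -/
theorem error_parameters_bounds {a u lt : ℝ} {g N : ℕ} (hgpos : (0 : ℝ) < g) (hlt0 : 0 < lt)
    (ha : 0 ≤ a) (hN : 1 ≤ N) (hU1 : 8 ≤ u) (hU2 : 8 * Real.exp 3 * a ≤ u) (hU3 : 4 * a ≤ u * lt)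
    (hU4 : 4 ≤ u * lt) (hu4g : u ^ 4 ≤ g) (h1 : Real.log g ≤ u) (hNg : (N : ℝ) ≤ 2 * Real.log g) :
    Real.exp 3 * (a * (N * (g / u ^ 4))) ≤ (g / N : ℕ) ∧ 2 * Real.log g ≤ (g / N : ℕ) ∧
      a * (N * (g / u ^ 4)) + 2 * Real.log g ≤ g * lt ∧ 0 < g / N := by
  have hu0 : 0 < u := by linarith
  set W := a * (N * ((g : ℝ) / u ^ 4)) with hW
  set M := g / N with hM
  have hNu : (N : ℝ) ≤ 2 * u := by linarith
  have hWle : W ≤ 2 * a * g / u ^ 3 := by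
    rw [hW]
    calc a * (N * (g / u ^ 4)) ≤ a * (2 * u * (g / u ^ 4)) := by gcongr
      _ = 2 * a * g / u ^ 3 := by field_simp
  have hMlow : (g : ℝ) / (4 * u) ≤ M := by
    have h3 : (g : ℝ) < N * (M + 1) := by exact_mod_cast Nat.lt_mul_div_succ g (by omega)
    have h4 : (g : ℝ) ≤ 2 * u * (M + 1) :=
      h3.le.trans (mul_le_mul_of_nonneg_right hNu (by positivity))
    rw [div_le_iff₀ (by positivity)]
    have h5 : 4 * u ≤ u ^ 4 := by
      have : (4 : ℝ) ≤ u ^ 3 := by nlinarith [sq_nonneg u, pow_pos hu0 3]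
      calc 4 * u ≤ u ^ 3 * u := by gcongr
        _ = u ^ 4 := by ring
    nlinarith
  have hu2 : u ≤ u ^ 2 := by nlinarith
  have hu3 : u ≤ u ^ 3 := by nlinarith
  have hWM : Real.exp 3 * W ≤ M := by
    refine le_trans ?_ hMlow
    refine (mul_le_mul_of_nonneg_left hWle (Real.exp_pos 3).le).trans ?_
    rw [mul_div_assoc', div_le_div_iff₀ (by positivity) (by positivity)]
    have : 8 * Real.exp 3 * a ≤ u ^ 2 := hU2.trans hu2
    calc Real.exp 3 * (2 * a * g) * (4 * u) = (8 * Real.exp 3 * a) * (g * u) := by ring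
      _ ≤ u ^ 2 * (g * u) := by gcongr
      _ = g * u ^ 3 := by ring
  have hMlog : 2 * Real.log g ≤ M := by
    refine le_trans ?_ hMlow
    rw [le_div_iff₀ (by positivity)]
    calc 2 * Real.log g * (4 * u) ≤ 2 * u * (4 * u) := by gcongr
      _ = 8 * u ^ 2 := by ring
      _ ≤ u * u ^ 2 := by gcongr
      _ ≤ u ^ 4 := by nlinarith [pow_pos hu0 3]
      _ ≤ g := hu4g
  have hWt : W + 2 * Real.log g ≤ g * lt := by
    have h5 : W ≤ g * lt / 2 := by
      refine hWle.trans ?_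
      rw [div_le_div_iff₀ (by positivity) (by norm_num)]
      have : 4 * a ≤ u ^ 3 * lt := hU3.trans (by gcongr)
      nlinarith
    have h6 : 2 * Real.log g ≤ g * lt / 2 := by
      have h7 : 4 ≤ u ^ 3 * lt := hU4.trans (by gcongr)
      have h8 : 4 * u ≤ g * lt := by
        calc 4 * u ≤ u ^ 3 * lt * u := by gcongr
          _ = u ^ 4 * lt := by ring
          _ ≤ g * lt := by gcongr
      linarith
    linarith
  refine ⟨hWM, hMlog, hWt, ?_⟩
  have h9 : 0 < (g : ℝ) / (4 * u) := by positivity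
  exact_mod_cast h9.trans_le hMlow

theorem exists_error_le (k : ℝ) {ε : ℝ} (hε : 0 < ε) (hε1 : ε < 1) :
    ∃ B, 0 ≤ B ∧ ∀ g N : ℕ, 1 ≤ g → 1 ≤ N → (N : ℝ) ≤ 2 * Real.log g →
      Real.exp (|k| * (N * (g : ℝ) ^ (1 - ε))) * (2 * (Real.sqrt (3 / 2))⁻¹ ^ g) +
        2 * ((|k| * (N * (g : ℝ) ^ (1 - ε))) ^ (g / N) / (g / N).factorial *
          Real.exp (|k| * (N * (g : ℝ) ^ (1 - ε)))) ≤ B / (g : ℝ) ^ 2 := by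
  set t := Real.sqrt (3 / 2) with ht
  have ht1 : 1 < t := Real.lt_sqrt_of_sq_lt (by norm_num)
  set lt := Real.log t with hlt
  have hlt0 : 0 < lt := Real.log_pos ht1
  set U := 8 + 8 * Real.exp 3 * |k| + 4 * |k| / lt + 4 / lt with hU
  have hk0 := abs_nonneg k
  have ev1 : ∀ᶠ x : ℝ in Filter.atTop, Real.log x ≤ x ^ (ε / 4) := by
    filter_upwards [(isLittleO_log_rpow_atTop (show 0 < ε / 4 by positivity)).bound one_pos,
      Filter.eventually_ge_atTop 1] with x hx hx1
    rw [one_mul, Real.norm_eq_abs, Real.norm_eq_abs,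
      abs_of_nonneg (Real.rpow_nonneg (by linarith) _)] at hx
    exact (le_abs_self _).trans hx
  have ev2 := (tendsto_rpow_atTop (show 0 < ε / 4 by positivity)).eventually_ge_atTop U
  obtain ⟨x₀, hx₀⟩ := Filter.eventually_atTop.1 (ev1.and ev2)
  set G := max x₀ 1 with hG
  set W₀ := |k| * (2 * G * G) with hW₀
  refine ⟨max 4 (Real.exp W₀ * (2 + 2 * Real.exp W₀) * G ^ 2), by positivity,
    fun g N hg hN hNg => ?_⟩
  have hg1 : (1 : ℝ) ≤ g := by exact_mod_cast hg
  have hN1 : (1 : ℝ) ≤ N := by exact_mod_cast hN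
  set W := |k| * (N * (g : ℝ) ^ (1 - ε)) with hW
  have hW0 : 0 ≤ W := by positivity
  set M := g / N with hM
  have hinv : t⁻¹ ≤ 1 := inv_le_one_of_one_le₀ ht1.le
  rw [le_div_iff₀ (by positivity)]
  -- For the bounded range `g < G` every quantity is bounded, and the constant is simply taken large
  -- enough.
  rcases le_or_gt G g with h | h
  · refine le_trans ?_ (le_max_left _ _)
    obtain ⟨h1, h2⟩ := hx₀ g ((le_max_left _ _).trans h)
    set u := (g : ℝ) ^ (ε / 4) with hu
    have hexp3 : 0 < Real.exp 3 := Real.exp_pos 3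
    have hU1 : 8 ≤ u := by
      have : 0 ≤ 8 * Real.exp 3 * |k| + 4 * |k| / lt + 4 / lt := by positivity
      linarith
    have hU2 : 8 * Real.exp 3 * |k| ≤ u := by
      have : 0 ≤ 4 * |k| / lt + 4 / lt := by positivity
      linarith
    have hU3 : 4 * |k| / lt ≤ u := by
      have : 0 ≤ 8 * Real.exp 3 * |k| + 4 / lt := by positivity
      linarith
    have hU4 : 4 / lt ≤ u := by
      have : 0 ≤ 8 * Real.exp 3 * |k| + 4 * |k| / lt := by positivity
      linarith
    rw [div_le_iff₀ hlt0] at hU3 hU4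
    have hu0 : 0 < u := by linarith
    have hgpos : (0 : ℝ) < g := by linarith
    have hu4 : u ^ 4 = (g : ℝ) ^ ε := by
      rw [hu, ← Real.rpow_natCast, ← Real.rpow_mul hgpos.le]; congr 1; push_cast; ring
    have hu4g : u ^ 4 ≤ g := by
      rw [hu4]; exact (Real.rpow_le_rpow_of_exponent_le hg1 hε1.le).trans (by rw [Real.rpow_one])
    have hgε : (g : ℝ) ^ (1 - ε) = g / u ^ 4 := by rw [hu4, Real.rpow_sub hgpos, Real.rpow_one]
    obtain ⟨b1, b2, b3, b4⟩ := error_parameters_bounds (lt := lt) hgpos hlt0 hk0 hN hU1 hU2 hU3 hU4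
      hu4g h1 hNg
    rw [← hgε] at b1 b3
    exact exp_error_mul_sq_le ht1 hgpos hW0 b4 b1 b2 b3
  · refine le_trans ?_ (le_max_right _ _)
    have hG1 : 1 ≤ G := le_max_right _ _
    have hlogG : Real.log g ≤ G :=
      ((Real.log_le_sub_one_of_pos (by linarith)).trans (by linarith)).trans h.le
    have hrp : (g : ℝ) ^ (1 - ε) ≤ G := by
      refine (Real.rpow_le_rpow_of_exponent_le hg1 (show 1 - ε ≤ 1 by linarith)).trans ?_
      rw [Real.rpow_one]; exact h.le
    have hWW : W ≤ W₀ := by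
      rw [hW, hW₀]
      have : (N : ℝ) ≤ 2 * G := by linarith
      gcongr
    have h1 : t⁻¹ ^ g ≤ 1 := pow_le_one₀ (by positivity) hinv
    have h2 : W ^ M / M.factorial ≤ Real.exp W := Real.pow_div_factorial_le_exp W hW0 M
    have h3 : Real.exp W ≤ Real.exp W₀ := Real.exp_le_exp.2 hWW
    have h4 : Real.exp W * (2 * t⁻¹ ^ g) + 2 * (W ^ M / M.factorial * Real.exp W) ≤
        Real.exp W₀ * (2 * 1) + 2 * (Real.exp W₀ * Real.exp W₀) := by
      have := h2.trans h3
      gcongr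
    calc _ ≤ (Real.exp W₀ * (2 * 1) + 2 * (Real.exp W₀ * Real.exp W₀)) * G ^ 2 := by gcongr
      _ = _ := by ring

/-- The reason for the range of `X`: `q ^ (X / 2)` stays below `g` by a power. -/
theorem sqrt_card_pow_le {c : ℝ} (hq : Odd (Fintype.card F)) {g N : ℕ} {X : ℝ} (hg : 1 ≤ g)
    (hN : (N : ℝ) ≤ X) (hX : X ≤ (2 - c) * Real.log g / Real.log (Fintype.card F)) :
    Real.sqrt (Fintype.card F) ^ N ≤ (g : ℝ) ^ (1 - c / 2) := by
  have h3 : (3 : ℝ) ≤ Fintype.card F := by exact_mod_cast three_le_card hq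
  have hg0 : (0 : ℝ) < g := by exact_mod_cast hg
  have hL : 0 < Real.log (Fintype.card F) := Real.log_pos (by linarith)
  have h := (le_div_iff₀ hL).1 (hN.trans hX)
  rw [← Real.rpow_natCast, Real.sqrt_eq_rpow, ← Real.rpow_mul (by linarith),
    Real.rpow_def_of_pos (by linarith), Real.rpow_def_of_pos hg0]
  refine Real.exp_le_exp.2 ?_
  linarith

theorem exists_abs_expectation_sub_prod_le (hq : Odd (Fintype.card F)) (k : ℝ) {c : ℝ}
    (hc : 0 < c) (hc2 : c < 2) :
    ∃ B, 0 ≤ B ∧ ∀ (g : ℕ) (X : ℝ), 1 ≤ g → 1 ≤ X →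
      X ≤ (2 - c) * Real.log g / Real.log (Fintype.card F) →
      |expectation F (2 * g + 1) (fun D => partialEuler X (1 / 2) D ^ k) -
        ∏ P ∈ primesLE F ⌊X⌋₊, modelFactor k ⌊X⌋₊ P| ≤ B * X ^ (k * (k + 1) / 2 - 1) := by
  obtain ⟨B, hB, h⟩ := exists_error_le k (ε := c / 2) (by linarith) (by linarith)
  refine ⟨4 * B, by positivity, fun g X hg hX hXg => ?_⟩
  have h3 : (3 : ℝ) ≤ Fintype.card F := by exact_mod_cast three_le_card hq
  have hg1 : (1 : ℝ) ≤ g := by exact_mod_cast hg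
  have hlg : 0 ≤ Real.log g := Real.log_nonneg hg1
  have hL : 1 ≤ Real.log (Fintype.card F) := by
    rw [Real.le_log_iff_exp_le (by linarith)]
    linarith [Real.exp_one_lt_d9]
  have hXlog : X ≤ 2 * Real.log g := by
    refine hXg.trans ((div_le_self (mul_nonneg (by linarith) hlg) hL).trans ?_)
    nlinarith
  have hN : ((⌊X⌋₊ : ℕ) : ℝ) ≤ X := Nat.floor_le (by linarith)
  have hN1 : 1 ≤ ⌊X⌋₊ := Nat.le_floor (by simpa using hX)
  have hpow := sqrt_card_pow_le hq hg hN hXg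
  have hW : ∑ P ∈ primesLE F ⌊X⌋₊, ∑ j ∈ Finset.Icc 1 (⌊X⌋₊ / P.natDegree),
      |primePowerCoeff k P j| ≤ |k| * (⌊X⌋₊ * (g : ℝ) ^ (1 - c / 2)) := by
    refine (sum_abs_primePowerCoeff_le hq k _).trans ?_
    gcongr
  refine (abs_expectation_partialEuler_sub_le hq k (by linarith) hg
    (Nat.div_mul_le_self g ⌊X⌋₊) hW).trans ((h g _ hg hN1 (hN.trans hXlog)).trans ?_)
  have hX2 : X ≤ 2 * g := by
    have := Real.log_le_sub_one_of_pos (show (0 : ℝ) < g by linarith)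
    linarith
  -- The minimum of `k (k + 1) / 2` is `-1 / 8`, so the target exponent always exceeds `-2`;
  -- together with `X ≤ 2 g` this lets `B / g²` fit into the error term for every real `k`.
  have hXpow : X ^ (-2 : ℝ) ≤ X ^ (k * (k + 1) / 2 - 1) :=
    Real.rpow_le_rpow_of_exponent_le hX (by nlinarith [sq_nonneg (2 * k + 1)])
  rw [show (-2 : ℝ) = -((2 : ℕ) : ℝ) by norm_num, Real.rpow_neg (by linarith),
    Real.rpow_natCast] at hXpow
  have h5 : B / (g : ℝ) ^ 2 ≤ 4 * B * (X ^ 2)⁻¹ := by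
    rw [← div_eq_mul_inv, div_le_div_iff₀ (by positivity) (by positivity)]
    have : X ^ 2 ≤ (2 * g) ^ 2 := pow_le_pow_left₀ (by linarith) hX2 2
    nlinarith
  exact h5.trans (mul_le_mul_of_nonneg_left hXpow (by positivity))

theorem abs_sub_le_of_abs_log_sub_le {a b η K : ℝ} (ha : 0 < a) (hb : 0 < b)
    (h : |Real.log a - Real.log b| ≤ η) (hK : η ≤ K) : |a - b| ≤ b * (η * Real.exp K) := by
  have e : a - b = b * (Real.exp (Real.log a - Real.log b) - 1) := by
    rw [Real.exp_sub, Real.exp_log ha, Real.exp_log hb]; field_simp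
  rw [e, abs_mul, abs_of_pos hb]
  have h1 := abs_exp_sub_sum_le h 1
  simp only [Finset.sum_range_one, pow_zero, Nat.factorial, Nat.cast_one, div_one, pow_one,
    Nat.succ_eq_add_one, zero_add, mul_one] at h1
  have hη : 0 ≤ η := (abs_nonneg _).trans h
  refine mul_le_mul_of_nonneg_left (h1.trans ?_) hb.le
  exact mul_le_mul_of_nonneg_left (Real.exp_le_exp.2 hK) hη

/-- Exponentiates the logarithmic asymptotics. Replacing `⌊X⌋` by `X` costs a further relative error
`O(1 / X)`, and `X ≤ 2 ⌊X⌋` accounts for the factor `2` in `K`. -/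
theorem exists_abs_prod_modelFactor_sub_le (hq : Odd (Fintype.card F)) (k : ℝ) :
    ∃ B, 0 ≤ B ∧ ∀ X : ℝ, 1 ≤ X →
      |∏ P ∈ primesLE F ⌊X⌋₊, modelFactor k ⌊X⌋₊ P - (2 : ℝ) ^ (-k / 2) * arithConst F k *
        (Real.exp Real.eulerMascheroniConstant * X) ^ (k * (k + 1) / 2)| ≤
        B * X ^ (k * (k + 1) / 2 - 1) := by
  obtain ⟨C, hC, h⟩ := exists_abs_log_prod_modelFactor_sub_le hq k
  set κ := k * (k + 1) / 2 with hκ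
  have hA : 0 < arithConst F k := by rw [arithConst_eq hq k]; exact Real.exp_pos _
  set K := 2 * (C + |κ|) with hK
  have hK0 : 0 ≤ K := by positivity
  refine ⟨(2 : ℝ) ^ (-k / 2) * arithConst F k * Real.exp Real.eulerMascheroniConstant ^ κ *
    (K * Real.exp K), by positivity, fun X hX => ?_⟩
  have hX0 : 0 < X := by linarith
  set N := ⌊X⌋₊ with hNdef
  have hN : ((N : ℕ) : ℝ) ≤ X := Nat.floor_le (by linarith)
  have hXN : X < N + 1 := Nat.lt_floor_add_one X
  have hN1 : 1 ≤ N := Nat.le_floor (by simpa using hX)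
  have hN1' : (1 : ℝ) ≤ N := by exact_mod_cast hN1
  have hlogX : |Real.log N - Real.log X| ≤ 1 / N := by
    rw [abs_sub_comm, ← Real.log_div hX0.ne' (by positivity),
      abs_of_nonneg (Real.log_nonneg (by rw [le_div_iff₀ (by positivity)]; linarith))]
    refine (Real.log_le_sub_one_of_pos (by positivity)).trans ?_
    rw [div_sub_one (by positivity)]
    gcongr; linarith
  set main := (2 : ℝ) ^ (-k / 2) * arithConst F k *
    (Real.exp Real.eulerMascheroniConstant * X) ^ κ with hmain
  have hmain0 : 0 < main := by positivity
  have hlogmain : Real.log main = -(k / 2) * Real.log 2 + Real.log (arithConst F k) +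
      κ * (Real.eulerMascheroniConstant + Real.log X) := by
    rw [hmain, Real.log_mul (by positivity) (by positivity), Real.log_mul (by positivity) hA.ne',
      Real.log_rpow (by norm_num), Real.log_rpow (by positivity),
      Real.log_mul (Real.exp_pos _).ne' hX0.ne', Real.log_exp]
    ring
  have hprod : 0 < ∏ P ∈ primesLE F N, modelFactor k N P :=
    Finset.prod_pos fun P hP => modelFactor_pos hq k N (isMonicPrime_of_mem P hP)
  have h1 := h N hN1
  have h2 : |Real.log (∏ P ∈ primesLE F N, modelFactor k N P) - Real.log main| ≤ K / X := by
    have e : Real.log (∏ P ∈ primesLE F N, modelFactor k N P) - Real.log main =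
        (Real.log (∏ P ∈ primesLE F N, modelFactor k N P) -
          (-(k / 2) * Real.log 2 + Real.log (arithConst F k) +
            κ * (Real.eulerMascheroniConstant + Real.log N))) +
          κ * (Real.log N - Real.log X) := by rw [hlogmain]; ring
    rw [e]
    refine (abs_add_le _ _).trans ?_
    rw [abs_mul]
    have h4 := mul_le_mul_of_nonneg_left hlogX (abs_nonneg κ)
    have h5 : C / N + |κ| * (1 / N) ≤ K / X := by
      rw [mul_one_div, ← add_div, hK, div_le_div_iff₀ (by positivity) hX0]
      have : 0 ≤ C + |κ| := by positivity
      nlinarith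
    linarith
  refine (abs_sub_le_of_abs_log_sub_le hprod hmain0 h2 (div_le_self hK0 hX)).trans (le_of_eq ?_)
  rw [hmain, Real.mul_rpow (Real.exp_pos _).le hX0.le, Real.rpow_sub hX0, Real.rpow_one]
  ring

end FinalEstimates

end

end PartialEulerMoments

theorem mainTheorem2 (F : Type*) [Field F] [Fintype F] (hq : Odd (Fintype.card F)) (k : ℝ) :
    (∀ P : PartialEulerMoments.MonicPrime F, Summable (PartialEulerMoments.localTerm k P.1)) ∧
    Multipliable (fun P : PartialEulerMoments.MonicPrime F =>
      PartialEulerMoments.localFactor k P.1) ∧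
    ∀ c : ℝ, 0 < c → c < 2 → ∃ B : ℝ, ∀ (g : ℕ) (X : ℝ), 1 ≤ g → 1 ≤ X →
      X ≤ (2 - c) * Real.log g / Real.log (Fintype.card F) →
      |PartialEulerMoments.expectation F (2 * g + 1)
            (fun D => PartialEulerMoments.partialEuler X (1 / 2) D ^ k)
          - (2 : ℝ) ^ (-k / 2) * PartialEulerMoments.arithConst F k *
            (Real.exp Real.eulerMascheroniConstant * X) ^ (k * (k + 1) / 2)|
        ≤ B * X ^ (k * (k + 1) / 2 - 1) := by
  refine ⟨fun P => (PartialEulerMoments.hasSum_localTerm hq k P.2).summable,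
    PartialEulerMoments.multipliable_localFactor hq k, fun c hc hc2 => ?_⟩
  obtain ⟨B₁, -, h₁⟩ := PartialEulerMoments.exists_abs_expectation_sub_prod_le hq k hc hc2
  obtain ⟨B₂, -, h₂⟩ := PartialEulerMoments.exists_abs_prod_modelFactor_sub_le hq k
  refine ⟨B₁ + B₂, fun g X hg hX hXg => ?_⟩
  rw [add_mul]
  exact (abs_sub_le _ _ _).trans (add_le_add (h₁ g X hg hX hXg) (h₂ X hX))
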